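/- **Definitions.** A *CRT-module* $M=\{M^O,M^U,M^T\}$ consists of three $\mathbb Z$-graded abelian groups with additive operations (for all $n\in\mathbb Z$) $c:M^O_n\to M^U_n$, $r:M^U_n\to M^O_n$, $\varepsilon:M^O_n\to M^T_n$, $\zeta:M^T_n\to M^U_n$, $\psi_U:M^U_n\to M^U_n$, $\psi_T:M^T_n\to M^T_n$, $\gamma:M^U_n\to M^T_{n-1}$, $\tau:M^T_n\to M^O_{n+1}$ and isomorphisms $\beta_O:M^O_n\to M^O_{n+8}$, $\beta_U:M^U_n\to M^U_{n+2}$, $\beta_T:M^T_n\to M^T_{n+4}$. Put $\eta_O=\tau\varepsilon$, $\xi=r\beta_U^2c$, $\eta_T=\gamma\beta_U\zeta$, $\omega=\beta_T\gamma\zeta$ (with the $\beta$'s, these give the module structures over $K_*(\mathbb R)$, $K_*(\mathbb C)$, $K_*(T)$). The required relations are $rc=2$, $cr=1+\psi_U$, $r=\tau\gamma$, $c=\zeta\varepsilon$, $\psi_U^2=1$, $\psi_T^2=1$, $\psi_T\varepsilon=\varepsilon$, $\zeta\gamma=0$, $\zeta=\psi_U\zeta$, $\psi_U\beta_U=-\beta_U\psi_U$,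 $\psi_T\beta_T=\beta_T\psi_T$, $\varepsilon\beta_O=\beta_T^2\varepsilon$, $\zeta\beta_T=\beta_U^2\zeta$, $\gamma\beta_U^2=\beta_T\gamma$, $\tau\beta_T^2=\beta_O\tau$, $\gamma=\gamma\psi_U$, $\beta_T\varepsilon\tau=\varepsilon\tau\beta_T+\eta_T\beta_T$, $\varepsilon r\zeta=1+\psi_T$, $\gamma c\tau=1-\psi_T$, $\tau=-\tau\psi_T$, $\tau\beta_T\varepsilon=0$, $\varepsilon\xi=2\beta_T\varepsilon$, $\xi\tau=2\tau\beta_T$. Homomorphisms of degree $0$ are degree-preserving additive maps of the three parts commuting with all operations; they form the group $[M,N]_0$. A CRT-module is *injective* if it is an injective object of the category of CRT-modules and homomorphisms of degree $0$. $M$ is *acyclic* if the three sequences $$\cdots\to M^O_n\xrightarrow{\eta_O}M^O_{n+1}\xrightarrow{c}M^U_{n+1}\xrightarrow{r\beta_U^{-1}}M^O_{n-1}\xrightarrow{\eta_O}\cdots$$ $$\cdots\to M^O_n\xrightarrow{\eta_O^2}M^O_{n+2}\xrightarrow{\varepsilon}M^T_{n+2}\xrightarrow{\tau\beta_T^{-1}}M^O_{n-1}\xrightarrow{\eta_O^2}\cdots$$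 $$\cdots\to M^U_{n+1}\xrightarrow{\gamma}M^T_n\xrightarrow{\zeta}M^U_n\xrightarrow{1-\psi_U}M^U_n\xrightarrow{\gamma}M^T_{n-1}\to\cdots$$ are exact. A *CRT-pairing* from CRT-modules $L,M$ to a CRT-module $P$ consists of biadditive maps $L^X_i\times M^X_j\to P^X_{i+j}$, $X\in\{O,U,T\}$, that are bilinear (in the graded sense) over $K_*(\mathbb R)$, $K_*(\mathbb C)$, $K_*(T)$ respectively and satisfy $c(l\cdot m)=c(l)\cdot c(m)$, $r(c(l)\cdot m)=l\cdot r(m)$, $r(l\cdot c(m))=r(l)\cdot m$, $\varepsilon(l\cdot m)=\varepsilon(l)\cdot\varepsilon(m)$, $\zeta(l\cdot m)=\zeta(l)\cdot\zeta(m)$, $\psi_U(l\cdot m)=\psi_U(l)\cdot\psi_U(m)$, $\psi_T(l\cdot m)=\psi_T(l)\cdot\psi_T(m)$, $\gamma(l\cdot\zeta(m))=\gamma(l)\cdot m$, $\gamma(\zeta(l)\cdot m)=(-1)^{|l|}\,l\cdot\gamma(m)$, $\tau(l\cdot\varepsilon(m))=\tau(l)\cdot m$, $\tau(\varepsilon(l)\cdot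 m)=(-1)^{|l|}\,l\cdot\tau(m)$, $\varepsilon\tau(l\cdot m)=\varepsilon\tau(l)\cdot m+(-1)^{|l|}\,l\cdot\varepsilon\tau(m)+\eta_T(l\cdot m)$. The tensor product $L\otimes_{CRT}M$ is the target of the universal CRT-pairing on $L,M$. Let $F(b,i,X)$ be the free CRT-module on one generator $b\in F(b,i,X)^X_i$. For CRT-modules $M,N$, the CRT-module $\mathrm{Hom}_{CRT}(M,N)$ is given by $$\mathrm{Hom}_{CRT}(M,N)^X_i=[F(b,i,X)\otimes_{CRT}M,\,N]_0,$$ where an operation $\theta$ from degree $i$ of part $X$ to degree $j$ of part $Y$ acts by $\theta(\alpha)=\alpha\circ(\mu_\theta\otimes1)$, with $\mu_\theta:F(b',j,Y)\to F(b,i,X)$ the homomorphism carrying $b'$ to $\theta(b)$. **Proposition.** Let $M$ be an acyclic CRT-module and let $N$ be an injective CRT-module. Then the CRT-module $\mathrm{Hom}_{CRT}(M,N)$ is acyclic. -/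

import Mathlib

open CategoryTheory

universe u

/-! ### CRT-modules -/

/-- The three parts of a CRT-module: real, complex, self-conjugate. -/
inductive CRTPart : Type
  | O
  | U
  | T

/-- The CRT-operations, `CRTOp X i Y j` being the operations from degree `i` of the part `X` to
degree `j` of the part `Y`.  The operations `betaO`, `betaU`, `betaT` are the multiplications by
the invertible elements of degree `8`, `2`, `4` of `K_*(ℝ)`, `K_*(ℂ)`, `K_*(T)`. -/
inductive CRTOp : CRTPart → ℤ → CRTPart → ℤ → Type
  | c (i : ℤ) : CRTOp .O i .U i
  | r (i : ℤ) : CRTOp .U i .O i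
  | eps (i : ℤ) : CRTOp .O i .T i
  | zeta (i : ℤ) : CRTOp .T i .U i
  | psiU (i : ℤ) : CRTOp .U i .U i
  | psiT (i : ℤ) : CRTOp .T i .T i
  | gamma (i j : ℤ) (h : j = i - 1 := by omega) : CRTOp .U i .T j
  | tau (i j : ℤ) (h : j = i + 1 := by omega) : CRTOp .T i .O j
  | betaO (i j : ℤ) (h : j = i + 8 := by omega) : CRTOp .O i .O j
  | betaOInv (i j : ℤ) (h : j = i - 8 := by omega) : CRTOp .O i .O j
  | betaU (i j : ℤ) (h : j = i + 2 := by omega) : CRTOp .U i .U j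
  | betaUInv (i j : ℤ) (h : j = i - 2 := by omega) : CRTOp .U i .U j
  | betaT (i j : ℤ) (h : j = i + 4 := by omega) : CRTOp .T i .T j
  | betaTInv (i j : ℤ) (h : j = i - 4 := by omega) : CRTOp .T i .T j

/-- A CRT-module: three `ℤ`-graded abelian groups with the CRT-operations, subject to the
CRT-relations.  The multiplications by the remaining generators of the coefficient rings are the
composites `η_O = τ ε`, `ξ = r β_U² c`, `η_T = γ β_U ζ`, `ω = β_T γ ζ`; they are written out
below.  The ring relations of `K_*(ℝ)` and `K_*(T)` then hold: for instance
`2 η_O = 0` because `τ ε = τ ψ_T ε = - τ ε`, and `ξ² = r β_U² (1 + ψ_U) β_U² c = 4 β_O`. -/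
structure CRTModule where
  obj : CRTPart → ℤ → Type u
  [grp : ∀ X i, AddCommGroup (obj X i)]
  act : ∀ {X : CRTPart} {i : ℤ} {Y : CRTPart} {j : ℤ}, CRTOp X i Y j → obj X i →+ obj Y j
  /-- `β_O`, `β_U`, `β_T` are invertible -/
  betaO_inv : ∀ i (x : obj .O i), act (.betaO (i - 8) i) (act (.betaOInv i (i - 8)) x) = x
  inv_betaO : ∀ i (x : obj .O i), act (.betaOInv (i + 8) i) (act (.betaO i (i + 8)) x) = x
  betaU_inv : ∀ i (x : obj .U i), act (.betaU (i - 2) i) (act (.betaUInv i (i - 2)) x) = x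
  inv_betaU : ∀ i (x : obj .U i), act (.betaUInv (i + 2) i) (act (.betaU i (i + 2)) x) = x
  betaT_inv : ∀ i (x : obj .T i), act (.betaT (i - 4) i) (act (.betaTInv i (i - 4)) x) = x
  inv_betaT : ∀ i (x : obj .T i), act (.betaTInv (i + 4) i) (act (.betaT i (i + 4)) x) = x
  /-- `r c = 2` -/
  r_c : ∀ i (x : obj .O i), act (.r i) (act (.c i) x) = 2 • x
  /-- `c r = 1 + ψ_U` -/
  c_r : ∀ i (x : obj .U i), act (.c i) (act (.r i) x) = x + act (.psiU i) x
  /-- `r = τ γ` -/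
  r_eq : ∀ i (x : obj .U i), act (.r i) x = act (.tau (i - 1) i) (act (.gamma i (i - 1)) x)
  /-- `c = ζ ε` -/
  c_eq : ∀ i (x : obj .O i), act (.c i) x = act (.zeta i) (act (.eps i) x)
  /-- `ψ_U² = 1` -/
  psiU_psiU : ∀ i (x : obj .U i), act (.psiU i) (act (.psiU i) x) = x
  /-- `ψ_T² = 1` -/
  psiT_psiT : ∀ i (x : obj .T i), act (.psiT i) (act (.psiT i) x) = x
  /-- `ψ_T ε = ε` -/
  psiT_eps : ∀ i (x : obj .O i), act (.psiT i) (act (.eps i) x) = act (.eps i) x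
  /-- `ζ γ = 0` -/
  zeta_gamma : ∀ i (x : obj .U i), act (.zeta (i - 1)) (act (.gamma i (i - 1)) x) = 0
  /-- `ζ = ψ_U ζ` -/
  psiU_zeta : ∀ i (x : obj .T i), act (.zeta i) x = act (.psiU i) (act (.zeta i) x)
  /-- `ψ_U β_U = - β_U ψ_U` -/
  psiU_betaU : ∀ i (x : obj .U i),
    act (.psiU (i + 2)) (act (.betaU i (i + 2)) x) = - act (.betaU i (i + 2)) (act (.psiU i) x)
  /-- `ψ_T β_T = β_T ψ_T` -/
  psiT_betaT : ∀ i (x : obj .T i),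
    act (.psiT (i + 4)) (act (.betaT i (i + 4)) x) = act (.betaT i (i + 4)) (act (.psiT i) x)
  /-- `ε β_O = β_T² ε` -/
  eps_betaO : ∀ i (x : obj .O i), act (.eps (i + 8)) (act (.betaO i (i + 8)) x) =
    act (.betaT (i + 4) (i + 8)) (act (.betaT i (i + 4)) (act (.eps i) x))
  /-- `ζ β_T = β_U² ζ` -/
  zeta_betaT : ∀ i (x : obj .T i), act (.zeta (i + 4)) (act (.betaT i (i + 4)) x) =
    act (.betaU (i + 2) (i + 4)) (act (.betaU i (i + 2)) (act (.zeta i) x))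
  /-- `γ β_U² = β_T γ` -/
  gamma_betaU : ∀ i (x : obj .U i),
    act (.gamma (i + 4) (i + 3)) (act (.betaU (i + 2) (i + 4)) (act (.betaU i (i + 2)) x)) =
      act (.betaT (i - 1) (i + 3)) (act (.gamma i (i - 1)) x)
  /-- `τ β_T² = β_O τ` -/
  tau_betaT : ∀ i (x : obj .T i),
    act (.tau (i + 8) (i + 9)) (act (.betaT (i + 4) (i + 8)) (act (.betaT i (i + 4)) x)) =
      act (.betaO (i + 1) (i + 9)) (act (.tau i (i + 1)) x)
  /-- `γ = γ ψ_U` -/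
  gamma_psiU : ∀ i (x : obj .U i),
    act (.gamma i (i - 1)) x = act (.gamma i (i - 1)) (act (.psiU i) x)
  /-- `β_T ε τ = ε τ β_T + η_T β_T` -/
  betaT_eps_tau : ∀ i (x : obj .T i),
    act (.betaT (i + 1) (i + 5)) (act (.eps (i + 1)) (act (.tau i (i + 1)) x)) =
      act (.eps (i + 5)) (act (.tau (i + 4) (i + 5)) (act (.betaT i (i + 4)) x)) +
      act (.gamma (i + 6) (i + 5)) (act (.betaU (i + 4) (i + 6)) (act (.zeta (i + 4))
        (act (.betaT i (i + 4)) x)))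
  /-- `ε r ζ = 1 + ψ_T` -/
  eps_r_zeta : ∀ i (x : obj .T i),
    act (.eps i) (act (.r i) (act (.zeta i) x)) = x + act (.psiT i) x
  /-- `γ c τ = 1 - ψ_T` -/
  gamma_c_tau : ∀ i (x : obj .T i),
    act (.gamma (i + 1) i) (act (.c (i + 1)) (act (.tau i (i + 1)) x)) = x - act (.psiT i) x
  /-- `τ = - τ ψ_T` -/
  tau_psiT : ∀ i (x : obj .T i),
    act (.tau i (i + 1)) x = - act (.tau i (i + 1)) (act (.psiT i) x)
  /-- `τ β_T ε = 0` -/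
  tau_betaT_eps : ∀ i (x : obj .O i),
    act (.tau (i + 4) (i + 5)) (act (.betaT i (i + 4)) (act (.eps i) x)) = 0
  /-- `ε ξ = 2 β_T ε` -/
  eps_xi : ∀ i (x : obj .O i),
    act (.eps (i + 4)) (act (.r (i + 4)) (act (.betaU (i + 2) (i + 4)) (act (.betaU i (i + 2))
      (act (.c i) x)))) = 2 • act (.betaT i (i + 4)) (act (.eps i) x)
  /-- `ξ τ = 2 τ β_T` -/
  xi_tau : ∀ i (x : obj .T i),
    act (.r (i + 5)) (act (.betaU (i + 3) (i + 5)) (act (.betaU (i + 1) (i + 3))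
      (act (.c (i + 1)) (act (.tau i (i + 1)) x)))) =
      2 • act (.tau (i + 4) (i + 5)) (act (.betaT i (i + 4)) x)

namespace CRTModule

attribute [instance] CRTModule.grp

/-! ### Acyclic CRT-modules -/

/-- `η_O = τ ε` -/
def etaO (M : CRTModule.{u}) (i j : ℤ) (h : j = i + 1 := by omega) : M.obj .O i →+ M.obj .O j :=
  (M.act (.tau i j h)).comp (M.act (.eps i))

/-- A CRT-module is acyclic if the three sequences
`⋯ → M_n^O -η_O→ M_{n+1}^O -c→ M_{n+1}^U -r β_U⁻¹→ M_{n-1}^O -η_O→ ⋯`,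
`⋯ → M_n^O -η_O²→ M_{n+2}^O -ε→ M_{n+2}^T -τ β_T⁻¹→ M_{n-1}^O -η_O²→ ⋯`,
`⋯ → M_{n+1}^U -γ→ M_n^T -ζ→ M_n^U -(1 - ψ_U)→ M_n^U -γ→ M_{n-1}^T → ⋯` are exact. -/
structure Acyclic (M : CRTModule.{u}) : Prop where
  ou_eta_c : ∀ n : ℤ, Function.Exact (M.etaO n (n + 1)) (M.act (.c (n + 1)))
  ou_c_r : ∀ n : ℤ, Function.Exact (M.act (.c (n + 1)))
    ((M.act (.r (n - 1))).comp (M.act (.betaUInv (n + 1) (n - 1))))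
  ou_r_eta : ∀ n : ℤ, Function.Exact
    ((M.act (.r (n - 1))).comp (M.act (.betaUInv (n + 1) (n - 1)))) (M.etaO (n - 1) n)
  ot_eta_eps : ∀ n : ℤ, Function.Exact
    ((M.etaO (n + 1) (n + 2)).comp (M.etaO n (n + 1))) (M.act (.eps (n + 2)))
  ot_eps_tau : ∀ n : ℤ, Function.Exact (M.act (.eps (n + 2)))
    ((M.act (.tau (n - 2) (n - 1))).comp (M.act (.betaTInv (n + 2) (n - 2))))
  ot_tau_eta : ∀ n : ℤ, Function.Exact
    ((M.act (.tau (n - 2) (n - 1))).comp (M.act (.betaTInv (n + 2) (n - 2))))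
    ((M.etaO n (n + 1)).comp (M.etaO (n - 1) n))
  ut_gamma_zeta : ∀ n : ℤ, Function.Exact (M.act (.gamma (n + 1) n)) (M.act (.zeta n))
  ut_zeta_psi : ∀ n : ℤ, Function.Exact (M.act (.zeta n))
    (AddMonoidHom.id (M.obj .U n) - M.act (.psiU n))
  ut_psi_gamma : ∀ n : ℤ, Function.Exact
    (AddMonoidHom.id (M.obj .U n) - M.act (.psiU n)) (M.act (.gamma n (n - 1)))

/-! ### The category of CRT-modules -/

/-- CRT-module homomorphisms of degree `0`. -/
@[ext]
structure Hom (M N : CRTModule.{u}) where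
  app : ∀ (X : CRTPart) (i : ℤ), M.obj X i →+ N.obj X i
  comm : ∀ {X : CRTPart} {i : ℤ} {Y : CRTPart} {j : ℤ} (θ : CRTOp X i Y j) (x : M.obj X i),
    app Y j (M.act θ x) = N.act θ (app X i x)

instance : Category CRTModule.{u} where
  Hom := Hom
  id M := ⟨fun _ _ => AddMonoidHom.id _, fun _ _ => rfl⟩
  comp f g := ⟨fun X i => (g.app X i).comp (f.app X i), fun θ x => by simp [f.comm, g.comm]⟩

theorem hom_ext {M N : CRTModule.{u}} {f g : M ⟶ N} (h : ∀ X i x, f.app X i x = g.app X i x) :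
    f = g := by
  apply Hom.ext
  funext X i
  exact AddMonoidHom.ext (h X i)

@[simp] theorem id_app (M : CRTModule.{u}) (X : CRTPart) (i : ℤ) (x : M.obj X i) :
    Hom.app (𝟙 M) X i x = x := rfl

@[simp] theorem comp_app {M N P : CRTModule.{u}} (f : M ⟶ N) (g : N ⟶ P) (X : CRTPart) (i : ℤ)
    (x : M.obj X i) : Hom.app (f ≫ g) X i x = g.app X i (f.app X i x) := rfl

instance (M N : CRTModule.{u}) : Add (M ⟶ N) where
  add f g := ⟨fun X i => f.app X i + g.app X i, fun θ x => by simp [f.comm, g.comm]⟩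

instance (M N : CRTModule.{u}) : Zero (M ⟶ N) where
  zero := ⟨fun _ _ => 0, fun θ x => by simp⟩

instance (M N : CRTModule.{u}) : Neg (M ⟶ N) where
  neg f := ⟨fun X i => - f.app X i, fun θ x => by simp [f.comm]⟩

/-- The group `[M, N]_0`, with pointwise addition. -/
instance (M N : CRTModule.{u}) : AddCommGroup (M ⟶ N) where
  add_assoc f g h := hom_ext fun X i x => add_assoc (f.app X i x) (g.app X i x) (h.app X i x)
  zero_add f := hom_ext fun X i x => zero_add (f.app X i x)
  add_zero f := hom_ext fun X i x => add_zero (f.app X i x)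
  neg_add_cancel f := hom_ext fun X i x => neg_add_cancel (f.app X i x)
  add_comm f g := hom_ext fun X i x => add_comm (f.app X i x) (g.app X i x)
  nsmul := nsmulRec
  zsmul := zsmulRec

@[simp] theorem add_app {M N : CRTModule.{u}} (f g : M ⟶ N) (X : CRTPart) (i : ℤ)
    (x : M.obj X i) : Hom.app (f + g) X i x = f.app X i x + g.app X i x := rfl

/-! ### CRT-modules given by generators and relations -/

/-- Formal expressions built from a family `G` of graded generators by the group operations and
the CRT-operations. -/
inductive Word (G : CRTPart → ℤ → Type u) : CRTPart → ℤ → Type u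
  | gen {X : CRTPart} {i : ℤ} (g : G X i) : Word G X i
  | zero {X : CRTPart} {i : ℤ} : Word G X i
  | plus {X : CRTPart} {i : ℤ} (a b : Word G X i) : Word G X i
  | minus {X : CRTPart} {i : ℤ} (a : Word G X i) : Word G X i
  | act {X : CRTPart} {i : ℤ} {Y : CRTPart} {j : ℤ} (θ : CRTOp X i Y j) (a : Word G X i) :
      Word G Y j

/-- The value of an expression in a CRT-module `P` under an assignment `f` of the generators. -/
def Word.eval {G : CRTPart → ℤ → Type u} (P : CRTModule.{u}) (f : ∀ X i, G X i → P.obj X i) :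
    ∀ {X : CRTPart} {i : ℤ}, Word G X i → P.obj X i
  | _, _, .gen g => f _ _ g
  | _, _, .zero => 0
  | _, _, .plus a b => a.eval P f + b.eval P f
  | _, _, .minus a => - a.eval P f
  | _, _, .act θ a => P.act θ (a.eval P f)

section presented

variable (G : CRTPart → ℤ → Type u)
  (R : ∀ P : CRTModule.{u}, (∀ X i, G X i → P.obj X i) → Prop)

/-- Two expressions are identified when they have the same value under every assignment of the
generators that satisfies the condition `R`. -/
def wordSetoid (X : CRTPart) (i : ℤ) : Setoid (Word G X i) where
  r a b := ∀ (P : CRTModule.{u}) (f : ∀ X i, G X i → P.obj X i), R P f → a.eval P f = b.eval P f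
  iseqv := ⟨fun _ _ _ _ => rfl, fun h P f hf => (h P f hf).symm,
    fun h h' P f hf => (h P f hf).trans (h' P f hf)⟩

instance (X : CRTPart) (i : ℤ) : Add (Quotient (wordSetoid G R X i)) where
  add := Quotient.map₂ Word.plus fun _ _ h _ _ h' P f hf =>
    congrArg₂ (· + ·) (h P f hf) (h' P f hf)

instance (X : CRTPart) (i : ℤ) : Zero (Quotient (wordSetoid G R X i)) where
  zero := Quotient.mk _ Word.zero

instance (X : CRTPart) (i : ℤ) : Neg (Quotient (wordSetoid G R X i)) where
  neg := Quotient.map Word.minus fun _ _ h P f hf => congrArg (- ·) (h P f hf)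

instance (X : CRTPart) (i : ℤ) : AddCommGroup (Quotient (wordSetoid G R X i)) where
  add_assoc := by
    rintro ⟨a⟩ ⟨b⟩ ⟨c⟩
    exact Quotient.sound fun P f _ => add_assoc (a.eval P f) (b.eval P f) (c.eval P f)
  zero_add := by
    rintro ⟨a⟩
    exact Quotient.sound fun P f _ => zero_add (a.eval P f)
  add_zero := by
    rintro ⟨a⟩
    exact Quotient.sound fun P f _ => add_zero (a.eval P f)
  neg_add_cancel := by
    rintro ⟨a⟩
    exact Quotient.sound fun P f _ => neg_add_cancel (a.eval P f)
  add_comm := by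
    rintro ⟨a⟩ ⟨b⟩
    exact Quotient.sound fun P f _ => add_comm (a.eval P f) (b.eval P f)
  nsmul := nsmulRec
  zsmul := zsmulRec

/-- The CRT-module with generators `G` that is universal among the CRT-modules with an assignment
of the generators satisfying `R`. -/
def presented : CRTModule.{u} where
  obj X i := Quotient (wordSetoid G R X i)
  act θ :=
    { toFun := Quotient.map (Word.act θ) fun _ _ h P f hf => congrArg (P.act θ) (h P f hf)
      map_zero' := Quotient.sound fun P _ _ => (P.act θ).map_zero
      map_add' := by
        rintro ⟨a⟩ ⟨b⟩
        exact Quotient.sound fun P f _ => (P.act θ).map_add (a.eval P f) (b.eval P f) }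
  betaO_inv := by rintro i ⟨a⟩; exact Quotient.sound fun P f _ => P.betaO_inv i (a.eval P f)
  inv_betaO := by rintro i ⟨a⟩; exact Quotient.sound fun P f _ => P.inv_betaO i (a.eval P f)
  betaU_inv := by rintro i ⟨a⟩; exact Quotient.sound fun P f _ => P.betaU_inv i (a.eval P f)
  inv_betaU := by rintro i ⟨a⟩; exact Quotient.sound fun P f _ => P.inv_betaU i (a.eval P f)
  betaT_inv := by rintro i ⟨a⟩; exact Quotient.sound fun P f _ => P.betaT_inv i (a.eval P f)
  inv_betaT := by rintro i ⟨a⟩; exact Quotient.sound fun P f _ => P.inv_betaT i (a.eval P f)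
  r_c := by
    rintro i ⟨a⟩
    refine Eq.trans ?_ (two_nsmul _).symm
    exact Quotient.sound fun P f _ => (P.r_c i (a.eval P f)).trans (two_nsmul _)
  c_r := by rintro i ⟨a⟩; exact Quotient.sound fun P f _ => P.c_r i (a.eval P f)
  r_eq := by rintro i ⟨a⟩; exact Quotient.sound fun P f _ => P.r_eq i (a.eval P f)
  c_eq := by rintro i ⟨a⟩; exact Quotient.sound fun P f _ => P.c_eq i (a.eval P f)
  psiU_psiU := by rintro i ⟨a⟩; exact Quotient.sound fun P f _ => P.psiU_psiU i (a.eval P f)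
  psiT_psiT := by rintro i ⟨a⟩; exact Quotient.sound fun P f _ => P.psiT_psiT i (a.eval P f)
  psiT_eps := by rintro i ⟨a⟩; exact Quotient.sound fun P f _ => P.psiT_eps i (a.eval P f)
  zeta_gamma := by rintro i ⟨a⟩; exact Quotient.sound fun P f _ => P.zeta_gamma i (a.eval P f)
  psiU_zeta := by rintro i ⟨a⟩; exact Quotient.sound fun P f _ => P.psiU_zeta i (a.eval P f)
  psiU_betaU := by rintro i ⟨a⟩; exact Quotient.sound fun P f _ => P.psiU_betaU i (a.eval P f)
  psiT_betaT := by rintro i ⟨a⟩; exact Quotient.sound fun P f _ => P.psiT_betaT i (a.eval P f)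
  eps_betaO := by rintro i ⟨a⟩; exact Quotient.sound fun P f _ => P.eps_betaO i (a.eval P f)
  zeta_betaT := by rintro i ⟨a⟩; exact Quotient.sound fun P f _ => P.zeta_betaT i (a.eval P f)
  gamma_betaU := by rintro i ⟨a⟩; exact Quotient.sound fun P f _ => P.gamma_betaU i (a.eval P f)
  tau_betaT := by rintro i ⟨a⟩; exact Quotient.sound fun P f _ => P.tau_betaT i (a.eval P f)
  gamma_psiU := by rintro i ⟨a⟩; exact Quotient.sound fun P f _ => P.gamma_psiU i (a.eval P f)
  betaT_eps_tau := by
    rintro i ⟨a⟩; exact Quotient.sound fun P f _ => P.betaT_eps_tau i (a.eval P f)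
  eps_r_zeta := by rintro i ⟨a⟩; exact Quotient.sound fun P f _ => P.eps_r_zeta i (a.eval P f)
  gamma_c_tau := by
    rintro i ⟨a⟩
    refine Eq.trans ?_ (sub_eq_add_neg _ _).symm
    exact Quotient.sound fun P f _ => (P.gamma_c_tau i (a.eval P f)).trans (sub_eq_add_neg _ _)
  tau_psiT := by rintro i ⟨a⟩; exact Quotient.sound fun P f _ => P.tau_psiT i (a.eval P f)
  tau_betaT_eps := by
    rintro i ⟨a⟩; exact Quotient.sound fun P f _ => P.tau_betaT_eps i (a.eval P f)
  eps_xi := by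
    rintro i ⟨a⟩
    refine Eq.trans ?_ (two_nsmul _).symm
    exact Quotient.sound fun P f _ => (P.eps_xi i (a.eval P f)).trans (two_nsmul _)
  xi_tau := by
    rintro i ⟨a⟩
    refine Eq.trans ?_ (two_nsmul _).symm
    exact Quotient.sound fun P f _ => (P.xi_tau i (a.eval P f)).trans (two_nsmul _)

variable {G R}

/-- The class of a generator. -/
def presentedGen {X : CRTPart} {i : ℤ} (g : G X i) : (presented G R).obj X i :=
  Quotient.mk (wordSetoid G R X i) (Word.gen g)

/-- The homomorphism out of a presented CRT-module given by an admissible assignment. -/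
def presentedLift {P : CRTModule.{u}} (f : ∀ X i, G X i → P.obj X i) (hf : R P f) :
    presented G R ⟶ P where
  app X i :=
    { toFun := Quotient.lift (Word.eval P f) fun _ _ h => h P f hf
      map_zero' := rfl
      map_add' := by rintro ⟨a⟩ ⟨b⟩; rfl }
  comm := by rintro X i Y j θ ⟨a⟩; rfl

@[simp] theorem presentedLift_gen {P : CRTModule.{u}} (f : ∀ X i, G X i → P.obj X i)
    (hf : R P f) {X : CRTPart} {i : ℤ} (g : G X i) :
    (presentedLift f hf).app X i (presentedGen g) = f X i g := rfl

theorem presented_ext {P : CRTModule.{u}} {f f' : presented G R ⟶ P}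
    (h : ∀ X i (g : G X i), f.app X i (presentedGen g) = f'.app X i (presentedGen g)) :
    f = f' := by
  apply hom_ext
  intro X i x
  obtain ⟨a, rfl⟩ := Quotient.exists_rep x
  induction a with
  | gen g => exact h _ _ g
  | zero => exact (f.app _ _).map_zero.trans (f'.app _ _).map_zero.symm
  | plus a b ha hb =>
    exact ((f.app _ _).map_add (Quotient.mk _ a) (Quotient.mk _ b)).trans
      ((congrArg₂ (· + ·) ha hb).trans
        ((f'.app _ _).map_add (Quotient.mk _ a) (Quotient.mk _ b)).symm)
  | minus a ha =>
    exact ((f.app _ _).map_neg (Quotient.mk _ a)).trans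
      ((congrArg (- ·) ha).trans ((f'.app _ _).map_neg (Quotient.mk _ a)).symm)
  | act θ a ha =>
    exact (f.comm θ (Quotient.mk _ a)).trans
      ((congrArg (P.act θ) ha).trans (f'.comm θ (Quotient.mk _ a)).symm)

end presented

/-! ### Free CRT-modules on one generator -/

/-- A single generator, in degree `i` of the part `X`. -/
inductive FreeGen (X : CRTPart) (i : ℤ) : CRTPart → ℤ → Type u
  | b : FreeGen X i X i

/-- The free CRT-module `F(b, i, X)` with a single generator `b` in degree `i` of the part `X`. -/
def free (X : CRTPart) (i : ℤ) : CRTModule.{u} := presented (FreeGen.{u} X i) fun _ _ => True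

/-- The generator `b` of `F(b, i, X)`. -/
def freeGen (X : CRTPart) (i : ℤ) : (free.{u} X i).obj X i := presentedGen FreeGen.b

/-- The homomorphism `F(b, i, X) ⟶ M` which carries `b` to `m`. -/
def freeLift {M : CRTModule.{u}} {X : CRTPart} {i : ℤ} (m : M.obj X i) : free X i ⟶ M :=
  presentedLift (fun _ _ g => match g with | .b => m) trivial

@[simp] theorem freeLift_gen {M : CRTModule.{u}} {X : CRTPart} {i : ℤ} (m : M.obj X i) :
    (freeLift m).app X i (freeGen X i) = m := rfl

theorem free_ext {M : CRTModule.{u}} {X : CRTPart} {i : ℤ} {f f' : free X i ⟶ M}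
    (h : f.app X i (freeGen X i) = f'.app X i (freeGen X i)) : f = f' := by
  apply presented_ext
  rintro _ _ ⟨⟩
  exact h

/-! ### CRT-pairings and the tensor product -/

/-- CRT-pairings: three families of biadditive products `l · m` (one for each part), adding
degrees, compatible with the operations as displayed.  Compatibility with the remaining
generators of the coefficient rings follows, for instance
`η_O l · m = τ (ε l · ε m) = η_O (l · m)` and
`ω l · m = γ ζ β_T l · m = γ (ζ β_T l · ζ m) = γ ζ β_T (l · m) = ω (l · m)`. -/
structure IsPairing (L M P : CRTModule.{u})
    (dot : ∀ {X : CRTPart} {i j k : ℤ}, i + j = k → L.obj X i → M.obj X j → P.obj X k) :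
    Prop where
  add_left : ∀ {X i j k} (h : i + j = k) (l l' : L.obj X i) (m : M.obj X j),
    dot h (l + l') m = dot h l m + dot h l' m
  add_right : ∀ {X i j k} (h : i + j = k) (l : L.obj X i) (m m' : M.obj X j),
    dot h l (m + m') = dot h l m + dot h l m'
  betaO_left : ∀ {i j k} (h : i + j = k) (l : L.obj .O i) (m : M.obj .O j),
    P.act (.betaO k (k + 8)) (dot h l m) =
      dot (by omega) (L.act (.betaO i (i + 8)) l) m
  betaO_right : ∀ {i j k} (h : i + j = k) (l : L.obj .O i) (m : M.obj .O j),
    P.act (.betaO k (k + 8)) (dot h l m) =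
      dot (by omega) l (M.act (.betaO j (j + 8)) m)
  betaU_left : ∀ {i j k} (h : i + j = k) (l : L.obj .U i) (m : M.obj .U j),
    P.act (.betaU k (k + 2)) (dot h l m) =
      dot (by omega) (L.act (.betaU i (i + 2)) l) m
  betaU_right : ∀ {i j k} (h : i + j = k) (l : L.obj .U i) (m : M.obj .U j),
    P.act (.betaU k (k + 2)) (dot h l m) =
      dot (by omega) l (M.act (.betaU j (j + 2)) m)
  betaT_left : ∀ {i j k} (h : i + j = k) (l : L.obj .T i) (m : M.obj .T j),
    P.act (.betaT k (k + 4)) (dot h l m) =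
      dot (by omega) (L.act (.betaT i (i + 4)) l) m
  betaT_right : ∀ {i j k} (h : i + j = k) (l : L.obj .T i) (m : M.obj .T j),
    P.act (.betaT k (k + 4)) (dot h l m) =
      dot (by omega) l (M.act (.betaT j (j + 4)) m)
  /-- `c (l · m) = c l · c m` -/
  c_dot : ∀ {i j k} (h : i + j = k) (l : L.obj .O i) (m : M.obj .O j),
    P.act (.c k) (dot h l m) = dot h (L.act (.c i) l) (M.act (.c j) m)
  /-- `r (c l · m) = l · r m` -/
  r_left : ∀ {i j k} (h : i + j = k) (l : L.obj .O i) (m : M.obj .U j),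
    P.act (.r k) (dot h (L.act (.c i) l) m) = dot h l (M.act (.r j) m)
  /-- `r (l · c m) = r l · m` -/
  r_right : ∀ {i j k} (h : i + j = k) (l : L.obj .U i) (m : M.obj .O j),
    P.act (.r k) (dot h l (M.act (.c j) m)) = dot h (L.act (.r i) l) m
  /-- `ε (l · m) = ε l · ε m` -/
  eps_dot : ∀ {i j k} (h : i + j = k) (l : L.obj .O i) (m : M.obj .O j),
    P.act (.eps k) (dot h l m) = dot h (L.act (.eps i) l) (M.act (.eps j) m)
  /-- `ζ (l · m) = ζ l · ζ m` -/
  zeta_dot : ∀ {i j k} (h : i + j = k) (l : L.obj .T i) (m : M.obj .T j),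
    P.act (.zeta k) (dot h l m) = dot h (L.act (.zeta i) l) (M.act (.zeta j) m)
  /-- `ψ_U (l · m) = ψ_U l · ψ_U m` -/
  psiU_dot : ∀ {i j k} (h : i + j = k) (l : L.obj .U i) (m : M.obj .U j),
    P.act (.psiU k) (dot h l m) = dot h (L.act (.psiU i) l) (M.act (.psiU j) m)
  /-- `ψ_T (l · m) = ψ_T l · ψ_T m` -/
  psiT_dot : ∀ {i j k} (h : i + j = k) (l : L.obj .T i) (m : M.obj .T j),
    P.act (.psiT k) (dot h l m) = dot h (L.act (.psiT i) l) (M.act (.psiT j) m)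
  /-- `γ (l · ζ m) = γ l · m` -/
  gamma_right : ∀ {i j k} (h : i + j = k) (l : L.obj .U i) (m : M.obj .T j),
    P.act (.gamma k (k - 1)) (dot h l (M.act (.zeta j) m)) =
      dot (by omega) (L.act (.gamma i (i - 1)) l) m
  /-- `γ (ζ l · m) = (-1)^{|l|} l · γ m` -/
  gamma_left : ∀ {i j k} (h : i + j = k) (l : L.obj .T i) (m : M.obj .U j),
    P.act (.gamma k (k - 1)) (dot h (L.act (.zeta i) l) m) =
      (i.negOnePow : ℤ) • dot (by omega) l (M.act (.gamma j (j - 1)) m)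
  /-- `τ (l · ε m) = τ l · m` -/
  tau_right : ∀ {i j k} (h : i + j = k) (l : L.obj .T i) (m : M.obj .O j),
    P.act (.tau k (k + 1)) (dot h l (M.act (.eps j) m)) =
      dot (by omega) (L.act (.tau i (i + 1)) l) m
  /-- `τ (ε l · m) = (-1)^{|l|} l · τ m` -/
  tau_left : ∀ {i j k} (h : i + j = k) (l : L.obj .O i) (m : M.obj .T j),
    P.act (.tau k (k + 1)) (dot h (L.act (.eps i) l) m) =
      (i.negOnePow : ℤ) • dot (by omega) l (M.act (.tau j (j + 1)) m)
  /-- `ε τ (l · m) = ε τ l · m + (-1)^{|l|} l · ε τ m + η_T (l · m)` -/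
  eps_tau_dot : ∀ {i j k} (h : i + j = k) (l : L.obj .T i) (m : M.obj .T j),
    P.act (.eps (k + 1)) (P.act (.tau k (k + 1)) (dot h l m)) =
      dot (by omega) (L.act (.eps (i + 1)) (L.act (.tau i (i + 1)) l)) m +
      (i.negOnePow : ℤ) •
        dot (by omega) l (M.act (.eps (j + 1)) (M.act (.tau j (j + 1)) m)) +
      P.act (.gamma (k + 2) (k + 1)) (P.act (.betaU k (k + 2)) (P.act (.zeta k) (dot h l m)))

/-- The symbols `l ⊗ m`. -/
inductive TensorGen (L M : CRTModule.{u}) : CRTPart → ℤ → Type u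
  | tmul {X : CRTPart} {i j k : ℤ} (h : i + j = k) (l : L.obj X i) (m : M.obj X j) :
      TensorGen L M X k

/-- The tensor product `L ⊗_CRT M`: the CRT-module generated by the symbols `l ⊗ m`, universal
for the condition that `(l, m) ↦ l ⊗ m` be a CRT-pairing. -/
def tensor (L M : CRTModule.{u}) : CRTModule.{u} :=
  presented (TensorGen L M) fun P f => IsPairing L M P fun h l m => f _ _ (.tmul h l m)

/-- The element `l ⊗ m`. -/
def tmul {L M : CRTModule.{u}} {X : CRTPart} {i j k : ℤ} (h : i + j = k) (l : L.obj X i)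
    (m : M.obj X j) : (tensor L M).obj X k := presentedGen (TensorGen.tmul h l m)


theorem isPairing_tmul (L M : CRTModule.{u}) :
    IsPairing L M (tensor L M) fun h l m => tmul h l m where
  add_left h l l' m := Quotient.sound fun _ _ hf => hf.add_left h l l' m
  add_right h l m m' := Quotient.sound fun _ _ hf => hf.add_right h l m m'
  betaO_left h l m := Quotient.sound fun _ _ hf => hf.betaO_left h l m
  betaO_right h l m := Quotient.sound fun _ _ hf => hf.betaO_right h l m
  betaU_left h l m := Quotient.sound fun _ _ hf => hf.betaU_left h l m
  betaU_right h l m := Quotient.sound fun _ _ hf => hf.betaU_right h l m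
  betaT_left h l m := Quotient.sound fun _ _ hf => hf.betaT_left h l m
  betaT_right h l m := Quotient.sound fun _ _ hf => hf.betaT_right h l m
  c_dot h l m := Quotient.sound fun _ _ hf => hf.c_dot h l m
  r_left h l m := Quotient.sound fun _ _ hf => hf.r_left h l m
  r_right h l m := Quotient.sound fun _ _ hf => hf.r_right h l m
  eps_dot h l m := Quotient.sound fun _ _ hf => hf.eps_dot h l m
  zeta_dot h l m := Quotient.sound fun _ _ hf => hf.zeta_dot h l m
  psiU_dot h l m := Quotient.sound fun _ _ hf => hf.psiU_dot h l m
  psiT_dot h l m := Quotient.sound fun _ _ hf => hf.psiT_dot h l m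
  gamma_right h l m := Quotient.sound fun _ _ hf => hf.gamma_right h l m
  gamma_left {i j k} h l m := by
    rcases Int.even_or_odd i with hi | hi
    · rw [Int.negOnePow_even i hi, Units.val_one, one_smul]
      exact Quotient.sound fun _ _ hf => by
        have := hf.gamma_left h l m
        rwa [Int.negOnePow_even i hi, Units.val_one, one_smul] at this
    · rw [Int.negOnePow_odd i hi, Units.val_neg, Units.val_one, neg_one_smul]
      exact Quotient.sound fun _ _ hf => by
        have := hf.gamma_left h l m
        rwa [Int.negOnePow_odd i hi, Units.val_neg, Units.val_one, neg_one_smul] at this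
  tau_right h l m := Quotient.sound fun _ _ hf => hf.tau_right h l m
  tau_left {i j k} h l m := by
    rcases Int.even_or_odd i with hi | hi
    · rw [Int.negOnePow_even i hi, Units.val_one, one_smul]
      exact Quotient.sound fun _ _ hf => by
        have := hf.tau_left h l m
        rwa [Int.negOnePow_even i hi, Units.val_one, one_smul] at this
    · rw [Int.negOnePow_odd i hi, Units.val_neg, Units.val_one, neg_one_smul]
      exact Quotient.sound fun _ _ hf => by
        have := hf.tau_left h l m
        rwa [Int.negOnePow_odd i hi, Units.val_neg, Units.val_one, neg_one_smul] at this
  eps_tau_dot {i j k} h l m := by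
    rcases Int.even_or_odd i with hi | hi
    · rw [Int.negOnePow_even i hi, Units.val_one, one_smul]
      exact Quotient.sound fun _ _ hf => by
        have := hf.eps_tau_dot h l m
        rwa [Int.negOnePow_even i hi, Units.val_one, one_smul] at this
    · rw [Int.negOnePow_odd i hi, Units.val_neg, Units.val_one, neg_one_smul]
      exact Quotient.sound fun _ _ hf => by
        have := hf.eps_tau_dot h l m
        rwa [Int.negOnePow_odd i hi, Units.val_neg, Units.val_one, neg_one_smul] at this

/-- Pulling a pairing back along a homomorphism in the first variable. -/
theorem IsPairing.precomp {L L' M P : CRTModule.{u}}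
    {dot : ∀ {X : CRTPart} {i j k : ℤ}, i + j = k → L'.obj X i → M.obj X j → P.obj X k}
    (hd : IsPairing L' M P dot) (f : L ⟶ L') :
    IsPairing L M P fun {X i _ _} h l m => dot h (f.app X i l) m where
  add_left h l l' m := by rw [map_add, hd.add_left]
  add_right h l m m' := hd.add_right h _ m m'
  betaO_left h l m := by rw [hd.betaO_left, f.comm]
  betaO_right h l m := hd.betaO_right h _ m
  betaU_left h l m := by rw [hd.betaU_left, f.comm]
  betaU_right h l m := hd.betaU_right h _ m
  betaT_left h l m := by rw [hd.betaT_left, f.comm]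
  betaT_right h l m := hd.betaT_right h _ m
  c_dot h l m := by rw [hd.c_dot, f.comm]
  r_left h l m := by rw [f.comm, hd.r_left]
  r_right h l m := by rw [hd.r_right, f.comm]
  eps_dot h l m := by rw [hd.eps_dot, f.comm]
  zeta_dot h l m := by rw [hd.zeta_dot, f.comm]
  psiU_dot h l m := by rw [hd.psiU_dot, f.comm]
  psiT_dot h l m := by rw [hd.psiT_dot, f.comm]
  gamma_right h l m := by rw [hd.gamma_right, f.comm]
  gamma_left h l m := by rw [f.comm, hd.gamma_left]
  tau_right h l m := by rw [hd.tau_right, f.comm]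
  tau_left h l m := by rw [f.comm, hd.tau_left]
  eps_tau_dot h l m := by rw [f.comm, f.comm]; exact hd.eps_tau_dot h _ m

/-- The homomorphism out of the tensor product given by a CRT-pairing. -/
def tensorLift {L M P : CRTModule.{u}}
    {dot : ∀ {X : CRTPart} {i j k : ℤ}, i + j = k → L.obj X i → M.obj X j → P.obj X k}
    (hd : IsPairing L M P dot) : tensor L M ⟶ P :=
  presentedLift (fun _ _ g => match g with | .tmul h l m => dot h l m) hd

@[simp] theorem tensorLift_tmul {L M P : CRTModule.{u}}
    {dot : ∀ {X : CRTPart} {i j k : ℤ}, i + j = k → L.obj X i → M.obj X j → P.obj X k}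
    (hd : IsPairing L M P dot) {X : CRTPart} {i j k : ℤ} (h : i + j = k) (l : L.obj X i)
    (m : M.obj X j) : (tensorLift hd).app X k (tmul h l m) = dot h l m := rfl

theorem tensor_ext {L M P : CRTModule.{u}} {f f' : tensor L M ⟶ P}
    (h : ∀ {X : CRTPart} {i j k : ℤ} (h : i + j = k) (l : L.obj X i) (m : M.obj X j),
      f.app X k (tmul h l m) = f'.app X k (tmul h l m)) : f = f' := by
  apply presented_ext
  rintro X k ⟨hk, l, m⟩
  exact h hk l m

/-- The homomorphism `f ⊗ 1 : L ⊗_CRT M ⟶ L' ⊗_CRT M`. -/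
def rTensor {L L' : CRTModule.{u}} (f : L ⟶ L') (M : CRTModule.{u}) :
    tensor L M ⟶ tensor L' M :=
  tensorLift ((isPairing_tmul L' M).precomp f)

@[simp] theorem rTensor_tmul {L L' : CRTModule.{u}} (f : L ⟶ L') (M : CRTModule.{u})
    {X : CRTPart} {i j k : ℤ} (h : i + j = k) (l : L.obj X i) (m : M.obj X j) :
    (rTensor f M).app X k (tmul h l m) = tmul h (f.app X i l) m := rfl

/-! ### The CRT-module `Hom_CRT(M, N)` -/

/-- The homomorphism `μ_θ : F(c, j, Y) ⟶ F(b, i, X)` which carries `c` to `θ b`. -/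
def mu {X : CRTPart} {i : ℤ} {Y : CRTPart} {j : ℤ} (θ : CRTOp X i Y j) :
    free.{u} Y j ⟶ free.{u} X i :=
  freeLift ((free X i).act θ (freeGen X i))

variable {M N : CRTModule.{u}}

/-- The operation `θ` of `Hom_CRT(M, N)`: `θ α = α ∘ (μ_θ ⊗ 1)`. -/
def homAct {X : CRTPart} {i : ℤ} {Y : CRTPart} {j : ℤ} (θ : CRTOp X i Y j) :
    (tensor (free X i) M ⟶ N) →+ (tensor (free Y j) M ⟶ N) :=
  AddMonoidHom.mk' (fun α => rTensor (mu θ) M ≫ α) fun _ _ => rfl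

/-- The element `α ∘ (μ ⊗ 1)`, where `μ` carries the generator to `p`. -/
def homStar {X : CRTPart} {i : ℤ} {Y : CRTPart} {j : ℤ} (α : tensor (free X i) M ⟶ N) :
    (free.{u} X i).obj Y j →+ (tensor (free Y j) M ⟶ N) :=
  AddMonoidHom.mk' (fun p => rTensor (freeLift p) M ≫ α) fun p q => by
    have : (freeLift (p + q) : free Y j ⟶ free X i) = freeLift p + freeLift q := free_ext rfl
    rw [this]
    apply tensor_ext
    intro Z a b k h l m
    rw [add_app, comp_app, comp_app, comp_app, rTensor_tmul, rTensor_tmul, rTensor_tmul,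
      add_app, (isPairing_tmul _ _).add_left, map_add]

theorem homStar_gen {X : CRTPart} {i : ℤ} (α : tensor (free X i) M ⟶ N) :
    homStar α (freeGen X i) = α := by
  have : (freeLift (freeGen X i) : free X i ⟶ free X i) = 𝟙 _ := free_ext rfl
  apply tensor_ext
  intro Z a b k h l m
  change α.app _ _ (tmul h ((freeLift (freeGen X i)).app _ _ l) m) = _
  rw [this, id_app]

theorem homAct_star {X : CRTPart} {i : ℤ} {Y : CRTPart} {j : ℤ} {Z : CRTPart} {k : ℤ}
    (θ : CRTOp Y j Z k) (α : tensor (free X i) M ⟶ N) (p : (free.{u} X i).obj Y j) :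
    homAct θ (homStar α p) = homStar α ((free X i).act θ p) := by
  have : (freeLift ((free X i).act θ p) : free Z k ⟶ free X i) = mu θ ≫ freeLift p :=
    free_ext ((freeLift p).comm θ (freeGen Y j)).symm
  apply tensor_ext
  intro Z a b k h l m
  change α.app _ _ (tmul h ((mu θ ≫ freeLift p).app _ _ l) m) =
    α.app _ _ (tmul h ((freeLift ((free X i).act θ p)).app _ _ l) m)
  rw [this]

theorem homAct_eq {X : CRTPart} {i : ℤ} {Y : CRTPart} {j : ℤ} (θ : CRTOp X i Y j)
    (α : tensor (free X i) M ⟶ N) :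
    homAct θ α = homStar α ((free X i).act θ (freeGen X i)) := rfl

end CRTModule

open CRTModule in
/-- The CRT-module `Hom_CRT(M, N)`, with `Hom_CRT(M, N)_i^X = [F(b, i, X) ⊗_CRT M, N]_0` and
operations `θ α = α ∘ (μ_θ ⊗ 1)`. -/
def CRTHom (M N : CRTModule.{u}) : CRTModule.{u} where
  obj X i := tensor (free X i) M ⟶ N
  act θ := homAct θ
  betaO_inv i α := by
    simpa only [← homAct_star, map_add, map_sub, map_neg, map_nsmul, map_zero, homStar_gen] using
      congrArg (homStar α) ((free.{u} .O i).betaO_inv i (freeGen .O i))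
  inv_betaO i α := by
    simpa only [← homAct_star, map_add, map_sub, map_neg, map_nsmul, map_zero, homStar_gen] using
      congrArg (homStar α) ((free.{u} .O i).inv_betaO i (freeGen .O i))
  betaU_inv i α := by
    simpa only [← homAct_star, map_add, map_sub, map_neg, map_nsmul, map_zero, homStar_gen] using
      congrArg (homStar α) ((free.{u} .U i).betaU_inv i (freeGen .U i))
  inv_betaU i α := by
    simpa only [← homAct_star, map_add, map_sub, map_neg, map_nsmul, map_zero, homStar_gen] using
      congrArg (homStar α) ((free.{u} .U i).inv_betaU i (freeGen .U i))
  betaT_inv i α := by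
    simpa only [← homAct_star, map_add, map_sub, map_neg, map_nsmul, map_zero, homStar_gen] using
      congrArg (homStar α) ((free.{u} .T i).betaT_inv i (freeGen .T i))
  inv_betaT i α := by
    simpa only [← homAct_star, map_add, map_sub, map_neg, map_nsmul, map_zero, homStar_gen] using
      congrArg (homStar α) ((free.{u} .T i).inv_betaT i (freeGen .T i))
  r_c i α := by
    simpa only [← homAct_star, map_add, map_sub, map_neg, map_nsmul, map_zero, homStar_gen] using
      congrArg (homStar α) ((free.{u} .O i).r_c i (freeGen .O i))
  c_r i α := by
    simpa only [← homAct_star, map_add, map_sub, map_neg, map_nsmul, map_zero, homStar_gen] using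
      congrArg (homStar α) ((free.{u} .U i).c_r i (freeGen .U i))
  r_eq i α := by
    simpa only [← homAct_star, map_add, map_sub, map_neg, map_nsmul, map_zero, homStar_gen] using
      congrArg (homStar α) ((free.{u} .U i).r_eq i (freeGen .U i))
  c_eq i α := by
    simpa only [← homAct_star, map_add, map_sub, map_neg, map_nsmul, map_zero, homStar_gen] using
      congrArg (homStar α) ((free.{u} .O i).c_eq i (freeGen .O i))
  psiU_psiU i α := by
    simpa only [← homAct_star, map_add, map_sub, map_neg, map_nsmul, map_zero, homStar_gen] using
      congrArg (homStar α) ((free.{u} .U i).psiU_psiU i (freeGen .U i))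
  psiT_psiT i α := by
    simpa only [← homAct_star, map_add, map_sub, map_neg, map_nsmul, map_zero, homStar_gen] using
      congrArg (homStar α) ((free.{u} .T i).psiT_psiT i (freeGen .T i))
  psiT_eps i α := by
    simpa only [← homAct_star, map_add, map_sub, map_neg, map_nsmul, map_zero, homStar_gen] using
      congrArg (homStar α) ((free.{u} .O i).psiT_eps i (freeGen .O i))
  zeta_gamma i α := by
    simpa only [← homAct_star, map_add, map_sub, map_neg, map_nsmul, map_zero, homStar_gen] using
      congrArg (homStar α) ((free.{u} .U i).zeta_gamma i (freeGen .U i))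
  psiU_zeta i α := by
    simpa only [← homAct_star, map_add, map_sub, map_neg, map_nsmul, map_zero, homStar_gen] using
      congrArg (homStar α) ((free.{u} .T i).psiU_zeta i (freeGen .T i))
  psiU_betaU i α := by
    simpa only [← homAct_star, map_add, map_sub, map_neg, map_nsmul, map_zero, homStar_gen] using
      congrArg (homStar α) ((free.{u} .U i).psiU_betaU i (freeGen .U i))
  psiT_betaT i α := by
    simpa only [← homAct_star, map_add, map_sub, map_neg, map_nsmul, map_zero, homStar_gen] using
      congrArg (homStar α) ((free.{u} .T i).psiT_betaT i (freeGen .T i))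
  eps_betaO i α := by
    simpa only [← homAct_star, map_add, map_sub, map_neg, map_nsmul, map_zero, homStar_gen] using
      congrArg (homStar α) ((free.{u} .O i).eps_betaO i (freeGen .O i))
  zeta_betaT i α := by
    simpa only [← homAct_star, map_add, map_sub, map_neg, map_nsmul, map_zero, homStar_gen] using
      congrArg (homStar α) ((free.{u} .T i).zeta_betaT i (freeGen .T i))
  gamma_betaU i α := by
    simpa only [← homAct_star, map_add, map_sub, map_neg, map_nsmul, map_zero, homStar_gen] using
      congrArg (homStar α) ((free.{u} .U i).gamma_betaU i (freeGen .U i))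
  tau_betaT i α := by
    simpa only [← homAct_star, map_add, map_sub, map_neg, map_nsmul, map_zero, homStar_gen] using
      congrArg (homStar α) ((free.{u} .T i).tau_betaT i (freeGen .T i))
  gamma_psiU i α := by
    simpa only [← homAct_star, map_add, map_sub, map_neg, map_nsmul, map_zero, homStar_gen] using
      congrArg (homStar α) ((free.{u} .U i).gamma_psiU i (freeGen .U i))
  betaT_eps_tau i α := by
    simpa only [← homAct_star, map_add, map_sub, map_neg, map_nsmul, map_zero, homStar_gen] using
      congrArg (homStar α) ((free.{u} .T i).betaT_eps_tau i (freeGen .T i))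
  eps_r_zeta i α := by
    simpa only [← homAct_star, map_add, map_sub, map_neg, map_nsmul, map_zero, homStar_gen] using
      congrArg (homStar α) ((free.{u} .T i).eps_r_zeta i (freeGen .T i))
  gamma_c_tau i α := by
    simpa only [← homAct_star, map_add, map_sub, map_neg, map_nsmul, map_zero, homStar_gen] using
      congrArg (homStar α) ((free.{u} .T i).gamma_c_tau i (freeGen .T i))
  tau_psiT i α := by
    simpa only [← homAct_star, map_add, map_sub, map_neg, map_nsmul, map_zero, homStar_gen] using
      congrArg (homStar α) ((free.{u} .T i).tau_psiT i (freeGen .T i))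
  tau_betaT_eps i α := by
    simpa only [← homAct_star, map_add, map_sub, map_neg, map_nsmul, map_zero, homStar_gen] using
      congrArg (homStar α) ((free.{u} .O i).tau_betaT_eps i (freeGen .O i))
  eps_xi i α := by
    simpa only [← homAct_star, map_add, map_sub, map_neg, map_nsmul, map_zero, homStar_gen] using
      congrArg (homStar α) ((free.{u} .O i).eps_xi i (freeGen .O i))
  xi_tau i α := by
    simpa only [← homAct_star, map_add, map_sub, map_neg, map_nsmul, map_zero, homStar_gen] using
      congrArg (homStar α) ((free.{u} .T i).xi_tau i (freeGen .T i))

/-! Each part of `CRTHom M N` is a group of homomorphisms into `N` from a CRT-module built out of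
`M`. The operations come from homomorphisms between these source CRT-modules. Mapping into an
injective object turns exactness among the sources, which is where the acyclicity of `M` enters,
into exactness of the three sequences.

The first half of the proof replaces `F(b, i, X) ⊗ M`, a quotient of formal words, by explicit data.
Under a pairing of `L` with `M`, an element `l` of `L` acts on `M` as follows. A real `l` gives a
homomorphism of degree `|l|`, formed by the products with `l`, `c l`, `ε l`. A complex `l` gives a
`K_*(ℂ)`-linear map of complex parts. A self-conjugate `l` gives the products with `l`, `ζ l` and `c
τ l`; the product with `ε τ l` is then determined by the formula for `ε τ (l · m)`. The
corresponding data form a CRT-module `internalHom M P`. Evaluation is a pairing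
(`isPairing_evalDot`), and every pairing curries to a homomorphism `L ⟶ internalHom M P`
(`IsPairing.curry`). For free `L` this shows that `homComparison` is bijective, so `internalHom M N`
may be studied instead of `CRTHom M N`.

For exactness, real elements of `internalHom M N` are homomorphisms out of `M` itself, complex ones
extend over `complexInduced M`, and self-conjugate ones over `selfConjInduced M`. Each of these
sources carries a universal element: `gradedId` or `gen`. Suppose that `f` is annihilated by one
arrow of a sequence and is to be shown to lie in the image of the preceding arrow `θ`. Let `a` be
`θ` of the universal element. The acyclicity of `M` and the vanishing hypothesis on `f` show that
the kernel of the extension of `a` lies in the kernel of the extension of `f`. Injectivity of `N`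
then gives `g` with `g ∘ a = f` (`exists_comp_eq_of_injective`, and its graded form
`exists_realHom_comp_eq`). Composition with `g` commutes with the operations up to sign
(`isRealHom_postcompFam`), so `f` is `± θ` of `g ∘` the universal element.

When the arrow in question is `r β_U⁻¹` or `τ β_T⁻¹`, the same argument is applied to `β_U f` or
`β_T f`. The nine lemmas from `exists_etaO_eq` to `exists_sub_psiU_eq` carry this out. The
composites of consecutive arrows vanish in every CRT-module. -/

namespace CRTModule

/-! ### The CRT-relations at arbitrary indices -/

section relations

variable {M : CRTModule.{u}}

-- The axioms fix the degrees as `i`, `i + 8` and so on. Here and below each degree is a variable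
-- tied by an equation, so the relations can be rewritten with whatever expressions the degrees
-- happen to be.
@[simp] theorem betaO_betaOInv {i j : ℤ} (h : j = i + 8) (h' : i = j - 8) (x : M.obj .O j) :
    M.act (.betaO i j h) (M.act (.betaOInv j i h') x) = x := by
  subst h'; exact M.betaO_inv j x

@[simp] theorem betaOInv_betaO {i j : ℤ} (h : j = i + 8) (h' : i = j - 8) (x : M.obj .O i) :
    M.act (.betaOInv j i h') (M.act (.betaO i j h) x) = x := by
  subst h; exact M.inv_betaO i x

@[simp] theorem betaU_betaUInv {i j : ℤ} (h : j = i + 2) (h' : i = j - 2) (x : M.obj .U j) :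
    M.act (.betaU i j h) (M.act (.betaUInv j i h') x) = x := by
  subst h'; exact M.betaU_inv j x

@[simp] theorem betaUInv_betaU {i j : ℤ} (h : j = i + 2) (h' : i = j - 2) (x : M.obj .U i) :
    M.act (.betaUInv j i h') (M.act (.betaU i j h) x) = x := by
  subst h; exact M.inv_betaU i x

@[simp] theorem betaT_betaTInv {i j : ℤ} (h : j = i + 4) (h' : i = j - 4) (x : M.obj .T j) :
    M.act (.betaT i j h) (M.act (.betaTInv j i h') x) = x := by
  subst h'; exact M.betaT_inv j x

@[simp] theorem betaTInv_betaT {i j : ℤ} (h : j = i + 4) (h' : i = j - 4) (x : M.obj .T i) :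
    M.act (.betaTInv j i h') (M.act (.betaT i j h) x) = x := by
  subst h; exact M.inv_betaT i x

variable (M) in
theorem betaO_bijective (i j : ℤ) (h : j = i + 8) :
    Function.Bijective (M.act (.betaO i j h)) :=
  ⟨Function.LeftInverse.injective (betaOInv_betaO h (by omega)),
    Function.RightInverse.surjective (betaO_betaOInv h (by omega))⟩

variable (M) in
theorem betaU_bijective (i j : ℤ) (h : j = i + 2) :
    Function.Bijective (M.act (.betaU i j h)) :=
  ⟨Function.LeftInverse.injective (betaUInv_betaU h (by omega)),
    Function.RightInverse.surjective (betaU_betaUInv h (by omega))⟩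

variable (M) in
theorem betaT_bijective (i j : ℤ) (h : j = i + 4) :
    Function.Bijective (M.act (.betaT i j h)) :=
  ⟨Function.LeftInverse.injective (betaTInv_betaT h (by omega)),
    Function.RightInverse.surjective (betaT_betaTInv h (by omega))⟩

@[simp] theorem zeta_eps {i : ℤ} (x : M.obj .O i) :
    M.act (.zeta i) (M.act (.eps i) x) = M.act (.c i) x := (M.c_eq i x).symm

@[simp] theorem tau_gamma {i a : ℤ} (h : a = i - 1) (h' : i = a + 1) (x : M.obj .U i) :
    M.act (.tau a i h') (M.act (.gamma i a h) x) = M.act (.r i) x := by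
  subst h; exact (M.r_eq i x).symm

@[simp] theorem zeta_gamma' {i a : ℤ} (h : a = i - 1) (x : M.obj .U i) :
    M.act (.zeta a) (M.act (.gamma i a h) x) = 0 := by
  subst h; exact M.zeta_gamma i x

@[simp] theorem psiU_zeta' {i : ℤ} (x : M.obj .T i) :
    M.act (.psiU i) (M.act (.zeta i) x) = M.act (.zeta i) x := (M.psiU_zeta i x).symm

@[simp] theorem psiU_c {i : ℤ} (x : M.obj .O i) :
    M.act (.psiU i) (M.act (.c i) x) = M.act (.c i) x := by
  rw [← zeta_eps, psiU_zeta']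

@[simp] theorem gamma_psiU' {i a : ℤ} (h : a = i - 1) (x : M.obj .U i) :
    M.act (.gamma i a h) (M.act (.psiU i) x) = M.act (.gamma i a h) x := by
  subst h; exact (M.gamma_psiU i x).symm

@[simp] theorem c_r' {i : ℤ} (x : M.obj .U i) :
    M.act (.c i) (M.act (.r i) x) = x + M.act (.psiU i) x := M.c_r i x

@[simp] theorem psiU_psiU' {i : ℤ} (x : M.obj .U i) :
    M.act (.psiU i) (M.act (.psiU i) x) = x := M.psiU_psiU i x

theorem psiT_eq {i : ℤ} (x : M.obj .T i) :
    M.act (.psiT i) x = M.act (.eps i) (M.act (.r i) (M.act (.zeta i) x)) - x := by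
  rw [M.eps_r_zeta]; abel

@[simp] theorem zeta_psiT {i : ℤ} (x : M.obj .T i) :
    M.act (.zeta i) (M.act (.psiT i) x) = M.act (.zeta i) x := by
  rw [psiT_eq, map_sub, zeta_eps, c_r', psiU_zeta']; abel

@[simp] theorem gamma_c_tau' {i a : ℤ} (h : a = i + 1) (h' : i = a - 1) (x : M.obj .T i) :
    M.act (.gamma a i h') (M.act (.c a) (M.act (.tau i a h) x)) = x - M.act (.psiT i) x := by
  subst h; exact M.gamma_c_tau i x

-- Evaluate `γ c τ = 1 - ψ_T` at `γ x`: the left side is `γ c r x = γ (x + ψ_U x) = 2 γ x`.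
@[simp] theorem psiT_gamma {i a : ℤ} (h : a = i - 1) (x : M.obj .U i) :
    M.act (.psiT a) (M.act (.gamma i a h) x) = - M.act (.gamma i a h) x := by
  have := gamma_c_tau' (by omega) h (M.act (.gamma i a h) x)
  rw [tau_gamma, c_r', map_add, gamma_psiU'] at this
  rw [eq_neg_iff_add_eq_zero, ← sub_eq_zero]
  rw [eq_sub_iff_add_eq] at this
  rw [sub_zero, add_comm]
  simpa [add_assoc] using this

@[simp] theorem tau_psiT' {i j : ℤ} (h : j = i + 1) (x : M.obj .T i) :
    M.act (.tau i j h) (M.act (.psiT i) x) = - M.act (.tau i j h) x := by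
  subst h
  rw [eq_comm, neg_eq_iff_eq_neg]; exact M.tau_psiT i x

theorem psiU_betaU' {i j : ℤ} (h : j = i + 2) (x : M.obj .U i) :
    M.act (.psiU j) (M.act (.betaU i j h) x) = - M.act (.betaU i j h) (M.act (.psiU i) x) := by
  subst h; exact M.psiU_betaU i x

theorem eps_betaO' {i a j : ℤ} (h : j = i + 8) (h₁ : a = i + 4) (h₂ : j = a + 4)
    (x : M.obj .O i) : M.act (.eps j) (M.act (.betaO i j h) x) =
      M.act (.betaT a j h₂) (M.act (.betaT i a h₁) (M.act (.eps i) x)) := by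
  subst h h₁; exact M.eps_betaO i x

theorem zeta_betaT' {i a j : ℤ} (h : j = i + 4) (h₁ : a = i + 2) (h₂ : j = a + 2)
    (x : M.obj .T i) : M.act (.zeta j) (M.act (.betaT i j h) x) =
      M.act (.betaU a j h₂) (M.act (.betaU i a h₁) (M.act (.zeta i) x)) := by
  subst h h₁; exact M.zeta_betaT i x

theorem gamma_betaU' {i a j b k : ℤ} (h₁ : a = i + 2) (h₂ : j = a + 2) (h₃ : k = j - 1)
    (h₄ : b = i - 1) (h₅ : k = b + 4) (x : M.obj .U i) :
    M.act (.gamma j k h₃) (M.act (.betaU a j h₂) (M.act (.betaU i a h₁) x)) =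
      M.act (.betaT b k h₅) (M.act (.gamma i b h₄) x) := by
  obtain rfl : k = i + 3 := by omega
  obtain rfl : j = i + 4 := by omega
  subst h₁ h₄; exact M.gamma_betaU i x

theorem tau_betaT' {i a j b k : ℤ} (h₁ : a = i + 4) (h₂ : j = a + 4) (h₃ : k = j + 1)
    (h₄ : b = i + 1) (h₅ : k = b + 8) (x : M.obj .T i) :
    M.act (.tau j k h₃) (M.act (.betaT a j h₂) (M.act (.betaT i a h₁) x)) =
      M.act (.betaO b k h₅) (M.act (.tau i b h₄) x) := by
  obtain rfl : k = i + 9 := by omega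
  obtain rfl : j = i + 8 := by omega
  subst h₁ h₄; exact M.tau_betaT i x

@[simp] theorem tau_betaT_eps' {i a j : ℤ} (h : a = i + 4) (h' : j = a + 1) (x : M.obj .O i) :
    M.act (.tau a j h') (M.act (.betaT i a h) (M.act (.eps i) x)) = 0 := by
  obtain rfl : j = i + 5 := by omega
  subst h; exact M.tau_betaT_eps i x

variable (M) in
/-- `η_T = γ β_U ζ` -/
def etaT (i j : ℤ) (h : j = i + 1 := by omega) : M.obj .T i →+ M.obj .T j :=
  ((M.act (.gamma (i + 2) j)).comp (M.act (.betaU i (i + 2)))).comp (M.act (.zeta i))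

theorem etaT_apply {i a j : ℤ} (h : j = i + 1) (h₁ : a = i + 2) (h₂ : j = a - 1)
    (x : M.obj .T i) : M.etaT i j h x =
      M.act (.gamma a j h₂) (M.act (.betaU i a h₁) (M.act (.zeta i) x)) := by
  subst h₁; rfl

theorem betaT_eps_tau' {i a j b : ℤ} (h₁ : a = i + 1) (h₂ : j = a + 4) (h₃ : b = i + 4)
    (h₄ : j = b + 1) (x : M.obj .T i) :
    M.act (.betaT a j h₂) (M.act (.eps a) (M.act (.tau i a h₁) x)) =
      M.act (.eps j) (M.act (.tau b j h₄) (M.act (.betaT i b h₃) x)) +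
        M.etaT b j h₄ (M.act (.betaT i b h₃) x) := by
  obtain rfl : j = i + 5 := by omega
  subst h₁ h₃
  rw [etaT_apply (a := i + 6) (by omega) (by omega) (by omega)]
  exact M.betaT_eps_tau i x

-- `ψ_U` fixes `ζ x`, anticommutes with `β_U`, and is absorbed by `γ`. Hence `η_T` has order two,
-- and signs in front of it can be ignored.
@[simp] theorem neg_etaT {i j : ℤ} (h : j = i + 1) (x : M.obj .T i) :
    - M.etaT i j h x = M.etaT i j h x := by
  rw [etaT_apply (a := i + 2) h rfl (by omega)]
  conv_rhs => rw [← gamma_psiU', psiU_betaU', psiU_zeta', map_neg]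

@[simp] theorem etaT_gamma {i a j : ℤ} (h : a = i - 1) (h' : j = a + 1) (x : M.obj .U i) :
    M.etaT a j h' (M.act (.gamma i a h) x) = 0 := by
  rw [etaT_apply (a := a + 2) h' rfl (by omega), zeta_gamma', map_zero, map_zero]

@[simp] theorem zeta_etaT {i j : ℤ} (h : j = i + 1) (x : M.obj .T i) :
    M.act (.zeta j) (M.etaT i j h x) = 0 := by
  rw [etaT_apply (a := i + 2) h rfl (by omega), zeta_gamma']

@[simp] theorem etaT_etaT {i a j : ℤ} (h : a = i + 1) (h' : j = a + 1) (x : M.obj .T i) :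
    M.etaT a j h' (M.etaT i a h x) = 0 := by
  rw [etaT_apply (a := i + 2) h rfl (by omega), etaT_gamma]

theorem etaT_betaT {i a j b : ℤ} (h₁ : a = i + 1) (h₂ : j = a + 4) (h₃ : b = i + 4)
    (h₄ : j = b + 1) (x : M.obj .T i) :
    M.etaT b j h₄ (M.act (.betaT i b h₃) x) = M.act (.betaT a j h₂) (M.etaT i a h₁ x) := by
  rw [etaT_apply (a := b + 2) h₄ rfl (by omega), etaT_apply (a := i + 2) h₁ rfl (by omega),
    zeta_betaT' (a := i + 2) h₃ rfl (by omega),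
    gamma_betaU' (b := a) (by omega) (by omega) (by omega) (by omega) h₂]

/-- `ε τ ε = η_T ε` -/
@[simp] theorem eps_tau_eps {i j : ℤ} (h : j = i + 1) (x : M.obj .O i) :
    M.act (.eps j) (M.act (.tau i j h) (M.act (.eps i) x)) = M.etaT i j h (M.act (.eps i) x) := by
  -- After multiplication by `β_T` the relation `β_T ε τ = ε τ β_T + η_T β_T` applies at `ε x`, and
  -- its first term dies because `τ β_T ε = 0`.
  apply (M.betaT_bijective j (j + 4) rfl).injective
  rw [betaT_eps_tau' (b := i + 4) h rfl rfl (by omega), tau_betaT_eps', map_zero, zero_add,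
    etaT_betaT h rfl]

theorem eps_r {i a : ℤ} (h : a = i - 1) (h' : i = a + 1) (x : M.obj .U i) :
    M.act (.eps i) (M.act (.r i) x) =
      M.act (.eps i) (M.act (.tau a i h') (M.act (.gamma i a h) x)) := by
  rw [tau_gamma]

/-- `τ ε τ = τ η_T` -/
@[simp] theorem tau_eps_tau {i a j : ℤ} (h : a = i + 1) (h' : j = a + 1) (x : M.obj .T i) :
    M.act (.tau a j h') (M.act (.eps a) (M.act (.tau i a h) x)) =
      M.act (.tau a j h') (M.etaT i a h x) := by
  -- With `x = β_T y`, apply `τ` to the relation for `β_T ε τ y`. The left side vanishes by `τ β_T ε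
  -- = 0`, and the sign of the remaining term is immaterial since `2 η_T = 0`.
  obtain ⟨y, rfl⟩ := (M.betaT_bijective (i - 4) i (by omega)).surjective x
  have := congrArg (M.act (.tau a j h')) (betaT_eps_tau' (a := i - 3) (b := i) (j := a) (by omega)
    (by omega) (by omega) h y)
  rw [tau_betaT_eps', map_add, eq_comm, ← eq_neg_iff_add_eq_zero, ← map_neg, neg_etaT] at this
  exact this

-- `r = τ γ`, and `τ ε τ γ = τ η_T γ` contains `ζ γ = 0`.
@[simp] theorem tau_eps_r {i j : ℤ} (h : j = i + 1) (x : M.obj .U i) :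
    M.act (.tau i j h) (M.act (.eps i) (M.act (.r i) x)) = 0 := by
  rw [eps_r (a := i - 1) rfl (by omega), tau_eps_tau, etaT_gamma, map_zero]

@[simp] theorem c_tau_eps {i j : ℤ} (h : j = i + 1) (x : M.obj .O i) :
    M.act (.c j) (M.act (.tau i j h) (M.act (.eps i) x)) = 0 := by
  rw [← zeta_eps, eps_tau_eps, zeta_etaT]

/-- `ε τ` commutes with `β_T` up to `η_T`, and `ζ` kills `η_T`; then `ζ β_T = β_U² ζ` and `c = ζ ε`.
-/
theorem c_tau_betaT {i a b c j : ℤ} (h₁ : a = i + 1) (h₂ : b = i + 4) (h₃ : j = b + 1)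
    (h₄ : c = a + 2) (h₅ : j = c + 2) (x : M.obj .T i) :
    M.act (.c j) (M.act (.tau b j h₃) (M.act (.betaT i b h₂) x)) =
      M.act (.betaU c j h₅) (M.act (.betaU a c h₄) (M.act (.c a) (M.act (.tau i a h₁) x))) := by
  rw [← zeta_eps, ← zeta_eps, ← zeta_betaT' (j := j) (by omega), betaT_eps_tau' h₁ _ h₂ h₃,
    map_add, zeta_etaT, add_zero]

/-- `ε r = ε τ γ`; the correction term `η_T` for moving `β_T` past `ε τ` vanishes on the image of
`γ`. -/
theorem eps_r_betaU {i a j : ℤ} (h₁ : a = i + 2) (h₂ : j = a + 2) (h₃ : j = i + 4)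
    (x : M.obj .U i) :
    M.act (.eps j) (M.act (.r j) (M.act (.betaU a j h₂) (M.act (.betaU i a h₁) x))) =
      M.act (.betaT i j h₃) (M.act (.eps i) (M.act (.r i) x)) := by
  rw [eps_r (a := j - 1) rfl (by omega), eps_r (a := i - 1) rfl (by omega),
    gamma_betaU' (b := i - 1) h₁ h₂ rfl rfl (by omega),
    betaT_eps_tau' (b := j - 1) (by omega) h₃ (by omega) (by omega),
    etaT_betaT (a := i) (by omega) h₃, etaT_gamma,
    map_zero, add_zero]

theorem c_betaO {i a b c j : ℤ} (h : j = i + 8) (h₁ : a = i + 2) (h₂ : b = a + 2)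
    (h₃ : c = b + 2) (h₄ : j = c + 2) (x : M.obj .O i) :
    M.act (.c j) (M.act (.betaO i j h) x) = M.act (.betaU c j h₄) (M.act (.betaU b c h₃)
      (M.act (.betaU a b h₂) (M.act (.betaU i a h₁) (M.act (.c i) x)))) := by
  rw [← zeta_eps, eps_betaO' (a := b) h (by omega) (by omega), zeta_betaT' (a := c) _ h₃ h₄,
    zeta_betaT' (a := a) _ h₁ h₂, zeta_eps]

theorem psiU_betaU_betaU {i a j : ℤ} (h₁ : a = i + 2) (h₂ : j = a + 2) (x : M.obj .U i) :
    M.act (.psiU j) (M.act (.betaU a j h₂) (M.act (.betaU i a h₁) x)) =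
      M.act (.betaU a j h₂) (M.act (.betaU i a h₁) (M.act (.psiU i) x)) := by
  rw [psiU_betaU', psiU_betaU', map_neg, neg_neg]

end relations

end CRTModule

/-! ### Presenting a CRT-module by its basic operations -/

/-- The part of the structure of a CRT-module which determines the rest: the operations
`ε, ζ, γ, τ, β_O, β_U, β_T`, with relations that imply all the CRT-relations for
`c = ζ ε`, `r = τ γ`, `ψ_U = c r - 1` and `ψ_T = ε r ζ - 1`. -/
structure CRTCore where
  obj : CRTPart → ℤ → Type u
  [grp : ∀ X i, AddCommGroup (obj X i)]
  eps : ∀ i, obj .O i →+ obj .T i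
  zeta : ∀ i, obj .T i →+ obj .U i
  gamma : ∀ i j, j = i - 1 → (obj .U i →+ obj .T j)
  tau : ∀ i j, j = i + 1 → (obj .T i →+ obj .O j)
  betaO : ∀ i j, j = i + 8 → (obj .O i →+ obj .O j)
  betaU : ∀ i j, j = i + 2 → (obj .U i →+ obj .U j)
  betaT : ∀ i j, j = i + 4 → (obj .T i →+ obj .T j)
  betaO_bijective : ∀ i j h, Function.Bijective (betaO i j h)
  betaU_bijective : ∀ i j h, Function.Bijective (betaU i j h)
  betaT_bijective : ∀ i j h, Function.Bijective (betaT i j h)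
  /-- `r c = 2` -/
  r_c : ∀ i a h h' x, tau a i h (gamma i a h' (zeta i (eps i x))) = x + x
  /-- `γ c τ + ε r ζ = 2` -/
  gamma_c_tau : ∀ i a b h h' h₁ h₂ x, gamma a i h' (zeta a (eps a (tau i a h x))) +
    eps i (tau b i h₁ (gamma i b h₂ (zeta i x))) = x + x
  /-- `ζ γ = 0` -/
  zeta_gamma : ∀ i a h x, zeta a (gamma i a h x) = 0
  /-- `c r β_U + β_U c r = 2 β_U` -/
  c_r_betaU : ∀ i j a b h h₁ h₂ h₃ h₄ x,
    zeta j (eps j (tau a j h₁ (gamma j a h₂ (betaU i j h x)))) +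
    betaU i j h (zeta i (eps i (tau b i h₃ (gamma i b h₄ x)))) = betaU i j h x + betaU i j h x
  eps_betaO : ∀ i a j h h₁ h₂ x, eps j (betaO i j h x) = betaT a j h₂ (betaT i a h₁ (eps i x))
  zeta_betaT : ∀ i a j h h₁ h₂ x, zeta j (betaT i j h x) = betaU a j h₂ (betaU i a h₁ (zeta i x))
  gamma_betaU : ∀ i a j b k h₁ h₂ h₃ h₄ h₅ x, gamma j k h₃ (betaU a j h₂ (betaU i a h₁ x)) =
    betaT b k h₅ (gamma i b h₄ x)
  tau_betaT : ∀ i a j b k h₁ h₂ h₃ h₄ h₅ x, tau j k h₃ (betaT a j h₂ (betaT i a h₁ x)) =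
    betaO b k h₅ (tau i b h₄ x)
  betaT_eps_tau : ∀ i a j b c h₁ h₂ h₃ h₄ h₅ h₆ x, betaT a j h₂ (eps a (tau i a h₁ x)) =
    eps j (tau b j h₄ (betaT i b h₃ x)) +
      gamma c j h₆ (betaU b c h₅ (zeta b (betaT i b h₃ x)))
  tau_betaT_eps : ∀ i a j h h' x, tau a j h' (betaT i a h (eps i x)) = 0

namespace CRTCore

attribute [instance] CRTCore.grp

variable (K : CRTCore.{u})

def r (i : ℤ) : K.obj .U i →+ K.obj .O i :=
  (K.tau (i - 1) i (by omega)).comp (K.gamma i (i - 1) rfl)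

def c (i : ℤ) : K.obj .O i →+ K.obj .U i := (K.zeta i).comp (K.eps i)

def psiU (i : ℤ) : K.obj .U i →+ K.obj .U i := (K.c i).comp (K.r i) - AddMonoidHom.id _

def psiT (i : ℤ) : K.obj .T i →+ K.obj .T i :=
  ((K.eps i).comp (K.r i)).comp (K.zeta i) - AddMonoidHom.id _

/-- The operations of the CRT-module. -/
noncomputable def act : ∀ {X : CRTPart} {i : ℤ} {Y : CRTPart} {j : ℤ},
    CRTOp X i Y j → K.obj X i →+ K.obj Y j
  | _, _, _, _, .c i => K.c i
  | _, _, _, _, .r i => K.r i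
  | _, _, _, _, .eps i => K.eps i
  | _, _, _, _, .zeta i => K.zeta i
  | _, _, _, _, .psiU i => K.psiU i
  | _, _, _, _, .psiT i => K.psiT i
  | _, _, _, _, .gamma i j h => K.gamma i j h
  | _, _, _, _, .tau i j h => K.tau i j h
  | _, _, _, _, .betaO i j h => K.betaO i j h
  | _, _, _, _, .betaOInv i j h =>
    (AddEquiv.ofBijective (K.betaO j i (by omega)) (K.betaO_bijective _ _ _)).symm.toAddMonoidHom
  | _, _, _, _, .betaU i j h => K.betaU i j h
  | _, _, _, _, .betaUInv i j h =>
    (AddEquiv.ofBijective (K.betaU j i (by omega)) (K.betaU_bijective _ _ _)).symm.toAddMonoidHom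
  | _, _, _, _, .betaT i j h => K.betaT i j h
  | _, _, _, _, .betaTInv i j h =>
    (AddEquiv.ofBijective (K.betaT j i (by omega)) (K.betaT_bijective _ _ _)).symm.toAddMonoidHom

variable {K}

theorem c_apply {i : ℤ} (x : K.obj .O i) : K.c i x = K.zeta i (K.eps i x) := rfl

theorem tau_gamma {i a : ℤ} (h : i = a + 1) (h' : a = i - 1) (x : K.obj .U i) :
    K.tau a i h (K.gamma i a h' x) = K.r i x := by subst h'; rfl

theorem psiU_apply {i : ℤ} (x : K.obj .U i) : K.psiU i x = K.c i (K.r i x) - x := rfl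

theorem psiT_apply {i : ℤ} (x : K.obj .T i) :
    K.psiT i x = K.eps i (K.r i (K.zeta i x)) - x := rfl

theorem r_c' {i : ℤ} (x : K.obj .O i) : K.r i (K.c i x) = x + x := K.r_c i _ _ _ x

theorem c_r_betaU' {i j : ℤ} (h : j = i + 2) (x : K.obj .U i) :
    K.c j (K.r j (K.betaU i j h x)) + K.betaU i j h (K.c i (K.r i x)) =
      K.betaU i j h x + K.betaU i j h x := K.c_r_betaU i j _ _ h _ _ _ _ x

theorem gamma_c_tau' {i a : ℤ} (h : a = i + 1) (h' : i = a - 1) (x : K.obj .T i) :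
    K.gamma a i h' (K.c a (K.tau i a h x)) = x + x - K.eps i (K.r i (K.zeta i x)) := by
  rw [eq_sub_iff_add_eq]; exact K.gamma_c_tau i a _ h h' _ _ x

/-- This and the next two lemmas exploit the single relation `γ c τ + ε r ζ = 2`: apply `ζ` to it,
evaluate it at `γ x`, or apply `τ` to it. In terms of `ψ_U = c r - 1` and `ψ_T = ε r ζ - 1` they
become `ψ_U ζ = ζ`, `γ ψ_U = γ` and `τ ψ_T = -τ`. -/
theorem zeta_eps_r_zeta {i : ℤ} (x : K.obj .T i) :
    K.c i (K.r i (K.zeta i x)) = K.zeta i x + K.zeta i x := by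
  have := congrArg (K.zeta i) (gamma_c_tau' (a := i + 1) rfl (by omega) x)
  rw [K.zeta_gamma, map_sub, map_add, eq_comm, sub_eq_zero] at this
  exact this.symm

theorem gamma_c_r {i a : ℤ} (h : a = i - 1) (x : K.obj .U i) :
    K.gamma i a h (K.c i (K.r i x)) = K.gamma i a h x + K.gamma i a h x := by
  have := gamma_c_tau' (by omega) h (K.gamma i a h x)
  rwa [tau_gamma, K.zeta_gamma, map_zero, map_zero, sub_zero] at this

theorem tau_eps_r_zeta {i j : ℤ} (h : j = i + 1) (x : K.obj .T i) :
    K.tau i j h (K.eps i (K.r i (K.zeta i x))) = 0 := by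
  have := congrArg (K.tau i j h) (gamma_c_tau' h (by omega) x)
  rwa [map_sub, map_add, tau_gamma, r_c', eq_comm, sub_eq_self] at this

theorem zeta_betaT_eps_tau {i a j b : ℤ} (h₁ : a = i + 1) (h₂ : j = a + 4) (h₃ : b = i + 4)
    (h₄ : j = b + 1) (x : K.obj .T i) : K.zeta j (K.betaT a j h₂ (K.eps a (K.tau i a h₁ x))) =
      K.c j (K.tau b j h₄ (K.betaT i b h₃ x)) := by
  rw [K.betaT_eps_tau i a j b (b + 2) h₁ h₂ h₃ h₄ rfl (by omega), map_add, K.zeta_gamma, add_zero,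
    c_apply]

theorem psiT_betaT {i j : ℤ} (h : j = i + 4) (x : K.obj .T i) :
    K.psiT j (K.betaT i j h x) = K.betaT i j h (K.psiT i x) := by
  -- `ψ_T = 1 - γ c τ`, and `c τ β_T = ζ β_T ε τ = β_U² c τ`, after which `γ β_U² = β_T γ` brings
  -- `β_T` outside.
  have e : ∀ {k : ℤ} (y : K.obj .T k), K.psiT k y =
      y - K.gamma (k + 1) k (by omega) (K.c (k + 1) (K.tau k (k + 1) rfl y)) := fun y => by
    rw [gamma_c_tau', psiT_apply]; abel
  rw [e, e, map_sub, ← zeta_betaT_eps_tau (a := i + 1) rfl (by omega),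
    K.zeta_betaT _ (i + 1 + 2) _ _ rfl (by omega),
    K.gamma_betaU _ _ _ i j rfl (by omega) (by omega) (by omega) h, c_apply]

/-- `β_U² c τ = ζ β_T ε τ = c τ β_T`, and `r c = 2`. -/
theorem xi_tau {i a b c d : ℤ} (h₁ : a = i + 1) (h₂ : b = a + 2) (h₃ : c = b + 2)
    (h₄ : d = i + 4) (h₅ : c = d + 1) (x : K.obj .T i) :
    K.r c (K.betaU b c h₃ (K.betaU a b h₂ (K.c a (K.tau i a h₁ x)))) =
      2 • K.tau d c h₅ (K.betaT i d h₄ x) := by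
  rw [c_apply, ← K.zeta_betaT _ _ _ (by omega), zeta_betaT_eps_tau _ _ h₄ h₅, r_c', two_nsmul]

theorem eps_xi {i b c : ℤ} (h₂ : b = i + 2) (h₃ : c = b + 2) (h₄ : c = i + 4)
    (x : K.obj .O i) :
    K.eps c (K.r c (K.betaU b c h₃ (K.betaU i b h₂ (K.c i x)))) =
      2 • K.betaT i c h₄ (K.eps i x) := by
  -- `ψ_T β_T = β_T ψ_T` evaluated at `ε x`, where `ε r ζ ε x = ε r c x = 2 ε x`.
  have := psiT_betaT h₄ (K.eps i x)
  rw [psiT_apply, psiT_apply, ← c_apply, r_c', K.zeta_betaT _ b _ _ h₂ h₃, map_add,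
    add_sub_cancel_right, sub_eq_iff_eq_add] at this
  rw [c_apply, this, two_nsmul]

variable (K) in
/-- The CRT-module with the given basic operations. -/
noncomputable def toModule : CRTModule.{u} where
  obj := K.obj
  act := K.act
  betaO_inv i x := (AddEquiv.ofBijective _ (K.betaO_bijective (i - 8) i _)).apply_symm_apply x
  inv_betaO i x := (AddEquiv.ofBijective _ (K.betaO_bijective i (i + 8) _)).symm_apply_apply x
  betaU_inv i x := (AddEquiv.ofBijective _ (K.betaU_bijective (i - 2) i _)).apply_symm_apply x
  inv_betaU i x := (AddEquiv.ofBijective _ (K.betaU_bijective i (i + 2) _)).symm_apply_apply x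
  betaT_inv i x := (AddEquiv.ofBijective _ (K.betaT_bijective (i - 4) i _)).apply_symm_apply x
  inv_betaT i x := (AddEquiv.ofBijective _ (K.betaT_bijective i (i + 4) _)).symm_apply_apply x
  r_c i x := (r_c' x).trans (two_nsmul x).symm
  c_r i x := by simp only [act, psiU_apply]; abel
  r_eq i x := rfl
  c_eq i x := rfl
  psiU_psiU i x := by
    simp only [act, psiU_apply, map_sub, r_c', map_add]; abel
  psiT_psiT i x := by
    simp only [act, psiT_apply, map_sub, zeta_eps_r_zeta, map_add, ← c_apply]; abel
  psiT_eps i x := by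
    simp only [act, psiT_apply, r_c', map_add, ← c_apply]; abel
  zeta_gamma i x := K.zeta_gamma i _ _ x
  psiU_zeta i x := by simp only [act, psiU_apply, zeta_eps_r_zeta]; abel
  psiU_betaU i x := by
    simp only [act, psiU_apply, eq_sub_of_add_eq (c_r_betaU' _ _), map_sub]; abel
  psiT_betaT i x := psiT_betaT _ x
  eps_betaO i x := K.eps_betaO _ _ _ _ _ _ x
  zeta_betaT i x := K.zeta_betaT _ _ _ _ _ _ x
  gamma_betaU i x := K.gamma_betaU _ _ _ _ _ _ _ _ _ _ x
  tau_betaT i x := K.tau_betaT _ _ _ _ _ _ _ _ _ _ x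
  gamma_psiU i x := by simp only [act, psiU_apply, map_sub, gamma_c_r]; abel
  betaT_eps_tau i x := K.betaT_eps_tau _ _ _ _ _ _ _ _ _ _ _ x
  eps_r_zeta i x := by simp only [act, psiT_apply]; abel
  gamma_c_tau i x := by simp only [act, psiT_apply, gamma_c_tau']; abel
  tau_psiT i x := by simp only [act, psiT_apply, map_sub, tau_eps_r_zeta]; abel
  tau_betaT_eps i x := K.tau_betaT_eps _ _ _ _ _ x
  eps_xi i x := eps_xi _ _ _ x
  xi_tau i x := xi_tau _ _ _ _ _ x

end CRTCore

/-! ### Homomorphisms from their values on the basic operations -/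

namespace CRTModule

/-- A family of additive maps commuting with the basic operations is a homomorphism. -/
def homOfBasic {M N : CRTModule.{u}} (f : ∀ (X : CRTPart) (i : ℤ), M.obj X i →+ N.obj X i)
    (eps : ∀ i x, f .T i (M.act (.eps i) x) = N.act (.eps i) (f .O i x))
    (zeta : ∀ i x, f .U i (M.act (.zeta i) x) = N.act (.zeta i) (f .T i x))
    (gamma : ∀ i j h x, f .T j (M.act (.gamma i j h) x) = N.act (.gamma i j h) (f .U i x))
    (tau : ∀ i j h x, f .O j (M.act (.tau i j h) x) = N.act (.tau i j h) (f .T i x))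
    (betaO : ∀ i j h x, f .O j (M.act (.betaO i j h) x) = N.act (.betaO i j h) (f .O i x))
    (betaU : ∀ i j h x, f .U j (M.act (.betaU i j h) x) = N.act (.betaU i j h) (f .U i x))
    (betaT : ∀ i j h x, f .T j (M.act (.betaT i j h) x) = N.act (.betaT i j h) (f .T i x)) :
    M ⟶ N :=
  have c : ∀ i x, f .U i (M.act (.c i) x) = N.act (.c i) (f .O i x) := fun i x => by
    rw [← zeta_eps, zeta, eps, zeta_eps]
  have r : ∀ i x, f .O i (M.act (.r i) x) = N.act (.r i) (f .U i x) := fun i x => by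
    rw [M.r_eq, tau, gamma, N.r_eq]
  { app := f
    comm := fun {X i Y j} θ => by
      cases θ with
      | c i => exact c i
      | r i => exact r i
      | eps i => exact eps i
      | zeta i => exact zeta i
      | psiU i =>
        intro x
        rw [eq_sub_of_add_eq' (M.c_r _ x).symm, eq_sub_of_add_eq' (N.c_r _ (f _ _ x)).symm, map_sub,
          c, r]
      | psiT i => intro x; rw [psiT_eq, psiT_eq, map_sub, eps, r, zeta]
      | gamma i j h => exact gamma i j h
      | tau i j h => exact tau i j h
      | betaO i j h => exact betaO i j h
      | betaOInv i j h =>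
        intro x
        apply (N.betaO_bijective j i (by omega)).injective
        rw [← betaO, betaO_betaOInv, betaO_betaOInv]
      | betaU i j h => exact betaU i j h
      | betaUInv i j h =>
        intro x
        apply (N.betaU_bijective j i (by omega)).injective
        rw [← betaU, betaU_betaUInv, betaU_betaUInv]
      | betaT i j h => exact betaT i j h
      | betaTInv i j h =>
        intro x
        apply (N.betaT_bijective j i (by omega)).injective
        rw [← betaT, betaT_betaTInv, betaT_betaTInv] }

end CRTModule

namespace CRTModule

/-! ### Graded homomorphisms of the parts of CRT-modules -/

/-- The sign `(-1)^i`. -/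
def sgn (i : ℤ) : ℤ := (i.negOnePow : ℤ)

theorem sgn_cases (i : ℤ) : sgn i = 1 ∨ sgn i = -1 := by
  rcases Int.even_or_odd i with h | h
  · exact Or.inl (by rw [sgn, Int.negOnePow_even i h, Units.val_one])
  · exact Or.inr (by rw [sgn, Int.negOnePow_odd i h, Units.val_neg, Units.val_one])

theorem sgn_zero : sgn 0 = 1 := by simp [sgn]

theorem sgn_add (i j : ℤ) : sgn (i + j) = sgn i * sgn j := by
  simp [sgn, Int.negOnePow_add]

theorem sgn_one : sgn 1 = -1 := by simp [sgn]

theorem sgn_succ {i j : ℤ} (h : j = i + 1) : sgn j = - sgn i := by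
  rw [h, sgn_add, sgn_one, mul_neg_one]

theorem sgn_pred {i j : ℤ} (h : j = i - 1) : sgn j = - sgn i := by
  rw [sgn_succ (show i = j + 1 by omega), neg_neg]

theorem sgn_of_even {i j : ℤ} (k : ℤ) (h : j = i + (k + k)) : sgn j = sgn i := by
  rw [h, sgn_add, sgn_add]
  rcases sgn_cases k with h | h <;> simp [h]

/-- Families of additive maps of degree `i` between the parts `X` of two CRT-modules. -/
def Fam (M P : CRTModule.{u}) (X : CRTPart) (i : ℤ) : Type u :=
  -- The target degree is a variable `k` with a proof of `i + j = k`, so that no transport along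
  -- equations of degrees is needed.
  ∀ j k : ℤ, i + j = k → (M.obj X j →+ P.obj X k)

instance (M P : CRTModule.{u}) (X : CRTPart) (i : ℤ) : Add (Fam M P X i) :=
  ⟨fun f g j k h => f j k h + g j k h⟩

instance (M P : CRTModule.{u}) (X : CRTPart) (i : ℤ) : Zero (Fam M P X i) := ⟨fun _ _ _ => 0⟩

instance (M P : CRTModule.{u}) (X : CRTPart) (i : ℤ) : Neg (Fam M P X i) :=
  ⟨fun f j k h => - f j k h⟩

instance (M P : CRTModule.{u}) (X : CRTPart) (i : ℤ) : AddCommGroup (Fam M P X i) where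
  add_assoc _ _ _ := by funext j k h; exact add_assoc _ _ _
  zero_add _ := by funext j k h; exact zero_add _
  add_zero _ := by funext j k h; exact add_zero _
  neg_add_cancel _ := by funext j k h; exact neg_add_cancel _
  add_comm _ _ := by funext j k h; exact add_comm _ _
  nsmul := nsmulRec
  zsmul := zsmulRec

section

variable {M P : CRTModule.{u}} {X : CRTPart} {i j k : ℤ} (f g : Fam M P X i) (h : i + j = k)
  (x : M.obj X j)

@[simp] theorem Fam.add_apply : (f + g) j k h x = f j k h x + g j k h x := rfl

@[simp] theorem Fam.zero_apply : (0 : Fam M P X i) j k h x = 0 := rfl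

@[simp] theorem Fam.neg_apply : (-f) j k h x = - f j k h x := rfl

end

section

variable (M P : CRTModule.{u}) (i : ℤ)

/-- Homomorphisms of CRT-modules of degree `i`. -/
structure IsRealHom (f : Fam M P .O i × Fam M P .U i × Fam M P .T i) : Prop where
  betaO : ∀ j k h j' k' h' hj hk x,
    f.1 j' k' h' (M.act (.betaO j j' hj) x) = P.act (.betaO k k' hk) (f.1 j k h x)
  betaU : ∀ j k h j' k' h' hj hk x,
    f.2.1 j' k' h' (M.act (.betaU j j' hj) x) = P.act (.betaU k k' hk) (f.2.1 j k h x)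
  betaT : ∀ j k h j' k' h' hj hk x,
    f.2.2 j' k' h' (M.act (.betaT j j' hj) x) = P.act (.betaT k k' hk) (f.2.2 j k h x)
  eps : ∀ j k h x, f.2.2 j k h (M.act (.eps j) x) = P.act (.eps k) (f.1 j k h x)
  zeta : ∀ j k h x, f.2.1 j k h (M.act (.zeta j) x) = P.act (.zeta k) (f.2.2 j k h x)
  -- `γ` and `τ` have odd degree, so moving a map of degree `i` past either of them costs `(-1)^i`.
  gamma : ∀ j k h j' k' h' hj hk x, f.2.2 j' k' h' (M.act (.gamma j j' hj) x) =
    sgn i • P.act (.gamma k k' hk) (f.2.1 j k h x)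
  tau : ∀ j k h j' k' h' hj hk x, f.1 j' k' h' (M.act (.tau j j' hj) x) =
    sgn i • P.act (.tau k k' hk) (f.2.2 j k h x)

/-- Homomorphisms of the complex parts of degree `i`, linear over `K_*(ℂ)`. -/
def IsComplexHom (f : Fam M P .U i) : Prop :=
  -- No compatibility with `ψ_U` is imposed: `ψ_U` acts on these maps by conjugation, as in
  -- `complexHom_psiU_apply`.
  ∀ j k h j' k' h' hj hk x,
    f j' k' h' (M.act (.betaU j j' hj) x) = P.act (.betaU k k' hk) (f j k h x)

/-- The triples of families of maps `m ↦ b · m`, `u ↦ ζ b · u`, `u ↦ c τ b · u` that arise from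
an element `b` of degree `i` of the self-conjugate part of a CRT-module which is paired with
`M`. -/
structure IsSelfConjHom (f : Fam M P .T i × Fam M P .U i × Fam M P .U (i + 1)) : Prop where
  betaT : ∀ j k h j' k' h' hj hk x,
    f.1 j' k' h' (M.act (.betaT j j' hj) x) = P.act (.betaT k k' hk) (f.1 j k h x)
  betaU : IsComplexHom M P i f.2.1
  betaU' : IsComplexHom M P (i + 1) f.2.2
  zeta : ∀ j k h x, f.2.1 j k h (M.act (.zeta j) x) = P.act (.zeta k) (f.1 j k h x)
  gamma : ∀ j k h j' k' h' hj hk x, f.1 j' k' h' (M.act (.gamma j j' hj) x) =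
    sgn i • P.act (.gamma k k' hk) (f.2.1 j k h x)
  -- `ψ_U` fixes both `ζ b` and `c τ b`, so multiplication by either commutes with `ψ_U`.
  psiU : ∀ j k h x, f.2.1 j k h (M.act (.psiU j) x) = P.act (.psiU k) (f.2.1 j k h x)
  psiU' : ∀ j k h x, f.2.2 j k h (M.act (.psiU j) x) = P.act (.psiU k) (f.2.2 j k h x)
  -- This is `ζ` applied to the formula for `ε τ (b · m)`; the term `η_T (b · m)` is lost because `ζ
  -- γ = 0`.
  zeta' : ∀ j k h k' h' hk j' h'' hj x, f.2.2 j k' h' (M.act (.zeta j) x) =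
    P.act (.c k') (P.act (.tau k k' hk) (f.1 j k h x)) -
      sgn i • f.2.1 j' k' h'' (M.act (.c j') (M.act (.tau j j' hj) x))
  -- This is the formula for `ε τ (b · m)` at `m = γ x`, with `τ γ = r` and each product by `γ x`
  -- rewritten as `± γ` of a product.
  gamma' : ∀ j k h k' h' hk x, f.1 j k h (M.act (.eps j) (M.act (.r j) x)) =
    P.act (.eps k) (P.act (.r k) (f.2.1 j k h x)) + P.act (.gamma k' k hk) (f.2.2 j k' h' x)

/-- The group of homomorphisms of CRT-modules of degree `i`. -/
def realHom : AddSubgroup (Fam M P .O i × Fam M P .U i × Fam M P .T i) where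
  carrier := {f | IsRealHom M P i f}
  zero_mem' := by constructor <;> intros <;> simp
  add_mem' {f g} hf hg := by
    constructor <;> intros <;> simp only [Prod.fst_add, Prod.snd_add, Fam.add_apply]
    · rw [hf.betaO, hg.betaO, map_add]
    · rw [hf.betaU, hg.betaU, map_add]
    · rw [hf.betaT, hg.betaT, map_add]
    · rw [hf.eps, hg.eps, map_add]
    · rw [hf.zeta, hg.zeta, map_add]
    · rw [hf.gamma, hg.gamma, map_add, smul_add]
    · rw [hf.tau, hg.tau, map_add, smul_add]
  neg_mem' {f} hf := by
    constructor <;> intros <;> simp only [Prod.fst_neg, Prod.snd_neg, Fam.neg_apply]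
    · rw [hf.betaO, map_neg]
    · rw [hf.betaU, map_neg]
    · rw [hf.betaT, map_neg]
    · rw [hf.eps, map_neg]
    · rw [hf.zeta, map_neg]
    · rw [hf.gamma, map_neg, smul_neg]
    · rw [hf.tau, map_neg, smul_neg]

theorem IsComplexHom.zero : IsComplexHom M P i 0 := by intro; intros; simp

variable {M P i} in
theorem IsComplexHom.add {f g : Fam M P .U i} (hf : IsComplexHom M P i f)
    (hg : IsComplexHom M P i g) : IsComplexHom M P i (f + g) := by
  intro j k h j' k' h' hj hk x
  dsimp only [Fam.add_apply, Fam.neg_apply]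
  rw [hf j k h, hg j k h, map_add]

variable {M P i} in
theorem IsComplexHom.neg {f : Fam M P .U i} (hf : IsComplexHom M P i f) :
    IsComplexHom M P i (-f) := by
  intro j k h j' k' h' hj hk x
  dsimp only [Fam.add_apply, Fam.neg_apply]
  rw [hf j k h, map_neg]

/-- The group of `K_*(ℂ)`-linear maps of degree `i` of the complex parts. -/
def complexHom : AddSubgroup (Fam M P .U i) where
  carrier := {f | IsComplexHom M P i f}
  zero_mem' := IsComplexHom.zero M P i
  add_mem' := IsComplexHom.add
  neg_mem' := IsComplexHom.neg

/-- The group of the triples which satisfy `IsSelfConjHom`. -/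
def selfConjHom : AddSubgroup (Fam M P .T i × Fam M P .U i × Fam M P .U (i + 1)) where
  carrier := {f | IsSelfConjHom M P i f}
  zero_mem' := by
    constructor
    case betaU => exact IsComplexHom.zero M P i
    case betaU' => exact IsComplexHom.zero M P (i + 1)
    all_goals intros; simp
  add_mem' {f g} hf hg := by
    constructor
    case betaU => exact hf.betaU.add hg.betaU
    case betaU' => exact hf.betaU'.add hg.betaU'
    all_goals simp only [Prod.fst_add, Prod.snd_add, Fam.add_apply]
    · intros; rw [hf.betaT, hg.betaT, map_add]
    · intros; rw [hf.zeta, hg.zeta, map_add]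
    · intros; rw [hf.gamma, hg.gamma, map_add, smul_add]
    · intros; rw [hf.psiU, hg.psiU, map_add]
    · intros; rw [hf.psiU', hg.psiU', map_add]
    · intro j k h k' h' hk j' h'' hj x
      rw [hf.zeta' j k h k' h' hk j' h'' hj, hg.zeta' j k h k' h' hk j' h'' hj]
      simp only [map_add, smul_add]
      abel
    · intro j k h k' h' hk x
      rw [hf.gamma' j k h k' h' hk, hg.gamma' j k h k' h' hk]
      simp only [map_add]
      abel
  neg_mem' {f} hf := by
    constructor
    case betaU => exact hf.betaU.neg
    case betaU' => exact hf.betaU'.neg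
    all_goals simp only [Prod.fst_neg, Prod.snd_neg, Fam.neg_apply]
    · intros; rw [hf.betaT, map_neg]
    · intros; rw [hf.zeta, map_neg]
    · intros; rw [hf.gamma, map_neg, smul_neg]
    · intros; rw [hf.psiU, map_neg]
    · intros; rw [hf.psiU', map_neg]
    · intro j k h k' h' hk j' h'' hj x
      rw [hf.zeta' j k h k' h' hk j' h'' hj]
      simp only [map_neg, smul_neg]
      abel
    · intro j k h k' h' hk x
      rw [hf.gamma' j k h k' h' hk]
      simp only [map_neg]
      abel

end

section derived

variable {M P : CRTModule.{u}} {i : ℤ}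

theorem IsRealHom.c {f} (hf : IsRealHom M P i f) (j k h x) :
    f.2.1 j k h (M.act (.c j) x) = P.act (.c k) (f.1 j k h x) := by
  rw [← zeta_eps, ← zeta_eps, hf.zeta, hf.eps]

theorem IsRealHom.r {f} (hf : IsRealHom M P i f) (j k h x) :
    f.1 j k h (M.act (.r j) x) = P.act (.r k) (f.2.1 j k h x) := by
  rw [← tau_gamma (a := j - 1) rfl (by omega),
    hf.tau (j - 1) (k - 1) (by omega) j k h (by omega) (by omega),
    hf.gamma j k h _ _ _ _ rfl, map_zsmul, tau_gamma]
  rcases sgn_cases i with h | h <;> simp [h]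

theorem IsRealHom.psiU {f} (hf : IsRealHom M P i f) (j k h x) :
    f.2.1 j k h (M.act (.psiU j) x) = P.act (.psiU k) (f.2.1 j k h x) := by
  rw [eq_sub_of_add_eq' (M.c_r _ x).symm, eq_sub_of_add_eq' (P.c_r _ (f.2.1 j k h x)).symm, map_sub,
    hf.c, hf.r]

/-- The sign from passing `γ` disappears because `-η_T = η_T`. -/
theorem IsRealHom.etaT {f} (hf : IsRealHom M P i f) {j k h j' k' h' hj hk x} :
    f.2.2 j' k' h' (M.etaT j j' hj x) = P.etaT k k' hk (f.2.2 j k h x) := by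
  rw [etaT_apply (a := j + 2) hj rfl (by omega), etaT_apply (a := k + 2) hk rfl (by omega),
    hf.gamma (j + 2) (k + 2) (by omega) j' k' h' _ (by omega), hf.betaU j k h _ _ _ _ rfl, hf.zeta,
    ← etaT_apply hk]
  rcases sgn_cases i with h | h <;> simp [h]

theorem IsSelfConjHom.etaT {f} (hf : IsSelfConjHom M P i f) {j k h j' k' h' hj hk x} :
    f.1 j' k' h' (M.etaT j j' hj x) = P.etaT k k' hk (f.1 j k h x) := by
  rw [etaT_apply (a := j + 2) hj rfl (by omega), etaT_apply (a := k + 2) hk rfl (by omega),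
    hf.gamma (j + 2) (k + 2) (by omega) j' k' h' _ (by omega), hf.betaU j k h _ _ _ _ rfl, hf.zeta,
    ← etaT_apply hk]
  rcases sgn_cases i with h | h <;> simp [h]

theorem realHom_ext {f g : realHom M P i}
    (h₁ : ∀ j k (h : i + j = k) x, f.1.1 j k h x = g.1.1 j k h x)
    (h₂ : ∀ j k (h : i + j = k) x, f.1.2.1 j k h x = g.1.2.1 j k h x)
    (h₃ : ∀ j k (h : i + j = k) x, f.1.2.2 j k h x = g.1.2.2 j k h x) : f = g := by
  refine Subtype.ext (Prod.ext ?_ (Prod.ext ?_ ?_)) <;> funext j k h <;> apply AddMonoidHom.ext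
  exacts [h₁ j k h, h₂ j k h, h₃ j k h]

theorem complexHom_ext {f g : complexHom M P i}
    (h₁ : ∀ j k (h : i + j = k) x, f.1 j k h x = g.1 j k h x) :
    f = g := by
  apply Subtype.ext
  funext j k h
  exact AddMonoidHom.ext (h₁ j k h)

theorem selfConjHom_ext {f g : selfConjHom M P i}
    (h₁ : ∀ j k (h : i + j = k) x, f.1.1 j k h x = g.1.1 j k h x)
    (h₂ : ∀ j k (h : i + j = k) x, f.1.2.1 j k h x = g.1.2.1 j k h x)
    (h₃ : ∀ j k (h : i + 1 + j = k) x, f.1.2.2 j k h x = g.1.2.2 j k h x) : f = g := by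
  refine Subtype.ext (Prod.ext ?_ (Prod.ext ?_ ?_)) <;> funext j k h <;> apply AddMonoidHom.ext
  exacts [h₁ j k h, h₂ j k h, h₃ j k h]

end derived

end CRTModule

namespace CRTModule

/-! ### The operations on graded homomorphisms -/

section iterates

variable (M : CRTModule.{u})

/-- `β_U²` -/
def betaU2 (i j : ℤ) (h : j = i + 4 := by omega) : M.obj .U i →+ M.obj .U j :=
  (M.act (.betaU (i + 2) j)).comp (M.act (.betaU i (i + 2)))

/-- `β_U⁴` -/
def betaU4 (i j : ℤ) (h : j = i + 8 := by omega) : M.obj .U i →+ M.obj .U j :=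
  (M.betaU2 (i + 4) j).comp (M.betaU2 i (i + 4))

/-- `β_T²` -/
def betaT2 (i j : ℤ) (h : j = i + 8 := by omega) : M.obj .T i →+ M.obj .T j :=
  (M.act (.betaT (i + 4) j)).comp (M.act (.betaT i (i + 4)))

theorem betaU2_bijective (i j : ℤ) (h : j = i + 4) : Function.Bijective (M.betaU2 i j h) :=
  (M.betaU_bijective _ _ _).comp (M.betaU_bijective _ _ _)

theorem betaU4_bijective (i j : ℤ) (h : j = i + 8) : Function.Bijective (M.betaU4 i j h) :=
  (M.betaU2_bijective (i + 4) j (by omega)).comp (M.betaU2_bijective _ _ _)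

theorem betaT2_bijective (i j : ℤ) (h : j = i + 8) : Function.Bijective (M.betaT2 i j h) :=
  (M.betaT_bijective _ _ _).comp (M.betaT_bijective _ _ _)

variable {M}

theorem betaU2_apply {i a j : ℤ} (h : j = i + 4) (h₁ : a = i + 2) (h₂ : j = a + 2)
    (x : M.obj .U i) :
    M.betaU2 i j h x = M.act (.betaU a j h₂) (M.act (.betaU i a h₁) x) := by
  subst h₁; rfl

theorem betaU4_apply {i a j : ℤ} (h : j = i + 8) (h₁ : a = i + 4) (h₂ : j = a + 4)
    (x : M.obj .U i) : M.betaU4 i j h x = M.betaU2 a j h₂ (M.betaU2 i a h₁ x) := by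
  subst h₁; rfl

theorem betaT2_apply {i a j : ℤ} (h : j = i + 8) (h₁ : a = i + 4) (h₂ : j = a + 4)
    (x : M.obj .T i) :
    M.betaT2 i j h x = M.act (.betaT a j h₂) (M.act (.betaT i a h₁) x) := by
  subst h₁; rfl

theorem zeta_betaT_eq_betaU2 {i j : ℤ} (h : j = i + 4) (x : M.obj .T i) :
    M.act (.zeta j) (M.act (.betaT i j h) x) = M.betaU2 i j h (M.act (.zeta i) x) :=
  zeta_betaT' h rfl (by omega) x

theorem gamma_betaU2 {i j b k : ℤ} (h : j = i + 4) (h₃ : k = j - 1) (h₄ : b = i - 1)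
    (h₅ : k = b + 4) (x : M.obj .U i) : M.act (.gamma j k h₃) (M.betaU2 i j h x) =
      M.act (.betaT b k h₅) (M.act (.gamma i b h₄) x) :=
  gamma_betaU' rfl (by omega) h₃ h₄ h₅ x

theorem psiU_betaU2 {i j : ℤ} (h : j = i + 4) (x : M.obj .U i) :
    M.act (.psiU j) (M.betaU2 i j h x) = M.betaU2 i j h (M.act (.psiU i) x) :=
  psiU_betaU_betaU rfl (by omega) x

theorem betaU_betaU2 {i j a b : ℤ} (h : j = i + 4) (h₁ : b = j + 2) (h₂ : a = i + 2)
    (h₃ : b = a + 4) (x : M.obj .U i) : M.act (.betaU j b h₁) (M.betaU2 i j h x) =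
      M.betaU2 a b h₃ (M.act (.betaU i a h₂) x) := by
  rw [betaU2_apply h h₂ (by omega), betaU2_apply h₃ (a := j) (by omega) h₁]

theorem betaU_betaU4 {i j a b : ℤ} (h : j = i + 8) (h₁ : b = j + 2) (h₂ : a = i + 2)
    (h₃ : b = a + 8) (x : M.obj .U i) : M.act (.betaU j b h₁) (M.betaU4 i j h x) =
      M.betaU4 a b h₃ (M.act (.betaU i a h₂) x) := by
  rw [betaU4_apply h rfl (by omega), betaU4_apply (a := a + 4) h₃ rfl (by omega),
    betaU_betaU2 (a := a + 4) _ _ (by omega) (by omega),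
    betaU_betaU2 (a := a) rfl _ h₂ rfl]

theorem zeta_betaT2 {i j : ℤ} (h : j = i + 8) (x : M.obj .T i) :
    M.act (.zeta j) (M.betaT2 i j h x) = M.betaU4 i j h (M.act (.zeta i) x) := by
  rw [betaT2_apply h rfl (by omega), betaU4_apply h rfl (by omega), zeta_betaT_eq_betaU2,
    zeta_betaT_eq_betaU2]

theorem eps_betaO_eq_betaT2 {i j : ℤ} (h : j = i + 8) (x : M.obj .O i) :
    M.act (.eps j) (M.act (.betaO i j h) x) = M.betaT2 i j h (M.act (.eps i) x) :=
  eps_betaO' h rfl (by omega) x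

theorem gamma_betaU4 {i j b k : ℤ} (h : j = i + 8) (h₃ : k = j - 1) (h₄ : b = i - 1)
    (h₅ : k = b + 8) (x : M.obj .U i) : M.act (.gamma j k h₃) (M.betaU4 i j h x) =
      M.betaT2 b k h₅ (M.act (.gamma i b h₄) x) := by
  rw [betaT2_apply h₅ rfl (by omega), betaU4_apply h rfl (by omega),
    gamma_betaU2 (b := b + 4) _ h₃ (by omega) (by omega), gamma_betaU2 (b := b) _ _ h₄ rfl]

theorem tau_betaT2 {i j b k : ℤ} (h : j = i + 8) (h₃ : k = j + 1) (h₄ : b = i + 1)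
    (h₅ : k = b + 8) (x : M.obj .T i) : M.act (.tau j k h₃) (M.betaT2 i j h x) =
      M.act (.betaO b k h₅) (M.act (.tau i b h₄) x) :=
  tau_betaT' rfl (by omega) h₃ h₄ h₅ x

theorem betaT_betaT2 {i j a b : ℤ} (h : j = i + 8) (h₁ : b = j + 4) (h₂ : a = i + 4)
    (h₃ : b = a + 8) (x : M.obj .T i) : M.act (.betaT j b h₁) (M.betaT2 i j h x) =
      M.betaT2 a b h₃ (M.act (.betaT i a h₂) x) := by
  rw [betaT2_apply h h₂ (by omega), betaT2_apply h₃ (a := j) (by omega) h₁]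

theorem etaT_betaT2 {i j a b : ℤ} (h : j = i + 8) (h₁ : b = j + 1) (h₂ : a = i + 1)
    (h₃ : b = a + 8) (x : M.obj .T i) :
    M.etaT j b h₁ (M.betaT2 i j h x) = M.betaT2 a b h₃ (M.etaT i a h₂ x) := by
  rw [betaT2_apply h rfl (by omega), betaT2_apply h₃ rfl (by omega),
    etaT_betaT (a := a + 4) (by omega) (by omega), etaT_betaT (a := a) _ rfl]

end iterates

section betaO

variable {M P : CRTModule.{u}} {i : ℤ}

/-- Multiplication by `β_O`. -/
def realBetaO (i j : ℤ) (h : j = i + 8) (f : Fam M P .O i × Fam M P .U i × Fam M P .T i) :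
    Fam M P .O j × Fam M P .U j × Fam M P .T j :=
  (fun a k hk => (P.act (.betaO (k - 8) k)).comp (f.1 a (k - 8) (by omega)),
   fun a k hk => (P.betaU4 (k - 8) k).comp (f.2.1 a (k - 8) (by omega)),
   fun a k hk => (P.betaT2 (k - 8) k).comp (f.2.2 a (k - 8) (by omega)))

variable {f : Fam M P .O i × Fam M P .U i × Fam M P .T i} {j a k b : ℤ}

/-- The definition fixes the intermediate degree as `k - 8`; here it is any `b` with `k = b + 8`.
The evaluation lemmas for the other operations play the same role. -/
theorem realBetaO_O (h : j = i + 8) (hk : j + a = k) (hb : i + a = b) (hkb : k = b + 8) (x) :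
    (realBetaO i j h f).1 a k hk x = P.act (.betaO b k hkb) (f.1 a b hb x) := by
  obtain rfl : b = k - 8 := by omega
  rfl

theorem realBetaO_U (h : j = i + 8) (hk : j + a = k) (hb : i + a = b) (hkb : k = b + 8) (x) :
    (realBetaO i j h f).2.1 a k hk x = P.betaU4 b k hkb (f.2.1 a b hb x) := by
  obtain rfl : b = k - 8 := by omega
  rfl

theorem realBetaO_T (h : j = i + 8) (hk : j + a = k) (hb : i + a = b) (hkb : k = b + 8) (x) :
    (realBetaO i j h f).2.2 a k hk x = P.betaT2 b k hkb (f.2.2 a b hb x) := by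
  obtain rfl : b = k - 8 := by omega
  rfl

/-- One direction makes `β_O` an operation on homomorphisms. The other shows that dividing a
homomorphism by `β_O` componentwise gives a homomorphism, hence that the operation is surjective.
The sign does not change, since the degree changes by an even number. -/
theorem isRealHom_betaO_iff (h : j = i + 8) :
    IsRealHom M P j (realBetaO i j h f) ↔ IsRealHom M P i f := by
  have hs : sgn j = sgn i := sgn_of_even 4 h
  constructor
  · intro hf
    constructor
    · intro a k hk a' k' hk' ha hkk x
      subst hkk
      apply (P.betaO_bijective (k + 8) (k + 8 + 8) rfl).injective
      have := hf.betaO a (k + 8) (by omega) a' (k + 8 + 8) (by omega) ha (by omega) x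
      rwa [realBetaO_O h _ hk' rfl, realBetaO_O h _ hk rfl] at this
    · intro a k hk a' k' hk' ha hkk x
      apply (P.betaU4_bijective k' (k' + 8) rfl).injective
      have := hf.betaU a (k + 8) (by omega) a' (k' + 8) (by omega) ha (by omega) x
      rwa [realBetaO_U h _ hk' rfl, realBetaO_U h _ hk rfl, betaU_betaU4 _ _ hkk rfl] at this
    · intro a k hk a' k' hk' ha hkk x
      apply (P.betaT2_bijective k' (k' + 8) rfl).injective
      have := hf.betaT a (k + 8) (by omega) a' (k' + 8) (by omega) ha (by omega) x
      rwa [realBetaO_T h _ hk' rfl, realBetaO_T h _ hk rfl, betaT_betaT2 _ _ hkk rfl] at this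
    · intro a k hk x
      apply (P.betaT2_bijective k (k + 8) rfl).injective
      have := hf.eps a (k + 8) (by omega) x
      rwa [realBetaO_T h _ hk rfl, realBetaO_O h _ hk rfl, eps_betaO_eq_betaT2] at this
    · intro a k hk x
      apply (P.betaU4_bijective k (k + 8) rfl).injective
      have := hf.zeta a (k + 8) (by omega) x
      rwa [realBetaO_U h _ hk rfl, realBetaO_T h _ hk rfl, zeta_betaT2] at this
    · intro a k hk a' k' hk' ha hkk x
      apply (P.betaT2_bijective k' (k' + 8) rfl).injective
      have := hf.gamma a (k + 8) (by omega) a' (k' + 8) (by omega) ha (by omega) x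
      rwa [realBetaO_T h _ hk' rfl, realBetaO_U h _ hk rfl, gamma_betaU4 _ _ hkk rfl, hs,
        ← map_zsmul] at this
    · intro a k hk a' k' hk' ha hkk x
      apply (P.betaO_bijective k' (k' + 8) rfl).injective
      have := hf.tau a (k + 8) (by omega) a' (k' + 8) (by omega) ha (by omega) x
      rwa [realBetaO_O h _ hk' rfl, realBetaO_T h _ hk rfl, tau_betaT2 _ _ hkk rfl, hs,
        ← map_zsmul] at this
  · intro hf
    constructor
    · intro a k hk a' k' hk' ha hkk x
      obtain rfl : k = k' - 8 := by omega
      rw [realBetaO_O (b := k' - 8) h _ (by omega) (by omega),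
        realBetaO_O (b := k' - 8 - 8) h _ (by omega) (by omega),
        hf.betaO a (k' - 8 - 8) (by omega) _ _ _ _ (by omega)]
    · intro a k hk a' k' hk' ha hkk x
      rw [realBetaO_U (b := k' - 8) h _ (by omega) (by omega),
        realBetaO_U (b := k - 8) h _ (by omega) (by omega),
        hf.betaU a (k - 8) (by omega) _ _ _ _ (by omega), betaU_betaU4]
    · intro a k hk a' k' hk' ha hkk x
      rw [realBetaO_T (b := k' - 8) h _ (by omega) (by omega),
        realBetaO_T (b := k - 8) h _ (by omega) (by omega),
        hf.betaT a (k - 8) (by omega) _ _ _ _ (by omega), betaT_betaT2]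
    · intro a k hk x
      rw [realBetaO_T (b := k - 8) h _ (by omega) (by omega),
        realBetaO_O (b := k - 8) h _ (by omega) (by omega), hf.eps, eps_betaO_eq_betaT2]
    · intro a k hk x
      rw [realBetaO_U (b := k - 8) h _ (by omega) (by omega),
        realBetaO_T (b := k - 8) h _ (by omega) (by omega), hf.zeta, zeta_betaT2]
    · intro a k hk a' k' hk' ha hkk x
      rw [realBetaO_T (b := k' - 8) h _ (by omega) (by omega),
        realBetaO_U (b := k - 8) h _ (by omega) (by omega),
        hf.gamma a (k - 8) (by omega) _ _ _ _ (by omega),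
        gamma_betaU4 _ _ (b := k' - 8) (by omega) (by omega), hs, map_zsmul]
    · intro a k hk a' k' hk' ha hkk x
      rw [realBetaO_O (b := k' - 8) h _ (by omega) (by omega),
        realBetaO_T (b := k - 8) h _ (by omega) (by omega),
        hf.tau a (k - 8) (by omega) _ _ _ _ (by omega),
        tau_betaT2 _ _ (b := k' - 8) (by omega) (by omega), hs, map_zsmul]

end betaO

section betaU

variable {M P : CRTModule.{u}} {i : ℤ}

/-- Multiplication by `β_U`. -/
def complexBetaU (i j : ℤ) (h : j = i + 2) (f : Fam M P .U i) : Fam M P .U j :=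
  fun a k hk => (P.act (.betaU (k - 2) k)).comp (f a (k - 2) (by omega))

variable {f : Fam M P .U i} {j a k b : ℤ}

theorem complexBetaU_apply (h : j = i + 2) (hk : j + a = k) (hb : i + a = b) (hkb : k = b + 2)
    (x) : complexBetaU i j h f a k hk x = P.act (.betaU b k hkb) (f a b hb x) := by
  obtain rfl : b = k - 2 := by omega
  rfl

theorem isComplexHom_betaU_iff (h : j = i + 2) :
    IsComplexHom M P j (complexBetaU i j h f) ↔ IsComplexHom M P i f := by
  constructor
  · intro hf a k hk a' k' hk' ha hkk x
    subst hkk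
    apply (P.betaU_bijective (k + 2) (k + 2 + 2) rfl).injective
    have := hf a (k + 2) (by omega) a' (k + 2 + 2) (by omega) ha (by omega) x
    rwa [complexBetaU_apply h _ hk' rfl, complexBetaU_apply h _ hk rfl] at this
  · intro hf a k hk a' k' hk' ha hkk x
    obtain rfl : k = k' - 2 := by omega
    rw [complexBetaU_apply (b := k' - 2) h _ (by omega) (by omega),
      complexBetaU_apply (b := k' - 2 - 2) h _ (by omega) (by omega),
      hf a (k' - 2 - 2) (by omega) _ _ _ _ (by omega)]

end betaU

section betaT

variable {M P : CRTModule.{u}} {i : ℤ}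

/-- Multiplication by `β_U²`. -/
def complexBetaU2 (i j : ℤ) (h : j = i + 4) (f : Fam M P .U i) : Fam M P .U j :=
  fun a k hk => (P.betaU2 (k - 4) k).comp (f a (k - 4) (by omega))

theorem complexBetaU2_apply {f : Fam M P .U i} {j a k b : ℤ} (h : j = i + 4) (hk : j + a = k)
    (hb : i + a = b) (hkb : k = b + 4)
    (x) : complexBetaU2 i j h f a k hk x = P.betaU2 b k hkb (f a b hb x) := by
  obtain rfl : b = k - 4 := by omega
  rfl

theorem isComplexHom_betaU2_iff {f : Fam M P .U i} {j : ℤ} (h : j = i + 4) :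
    IsComplexHom M P j (complexBetaU2 i j h f) ↔ IsComplexHom M P i f := by
  constructor
  · intro hf a k hk a' k' hk' ha hkk x
    apply (P.betaU2_bijective k' (k' + 4) rfl).injective
    have := hf a (k + 4) (by omega) a' (k' + 4) (by omega) ha (by omega) x
    rwa [complexBetaU2_apply h _ hk' rfl, complexBetaU2_apply h _ hk rfl,
      betaU_betaU2 _ _ hkk rfl] at this
  · intro hf a k hk a' k' hk' ha hkk x
    rw [complexBetaU2_apply (b := k' - 4) h _ (by omega) (by omega),
      complexBetaU2_apply (b := k - 4) h _ (by omega) (by omega),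
      hf a (k - 4) (by omega) _ _ _ _ (by omega), betaU_betaU2]

/-- Multiplication by `β_T`. -/
def selfConjBetaT (i j : ℤ) (h : j = i + 4)
    (f : Fam M P .T i × Fam M P .U i × Fam M P .U (i + 1)) :
    Fam M P .T j × Fam M P .U j × Fam M P .U (j + 1) :=
  (fun a k hk => (P.act (.betaT (k - 4) k)).comp (f.1 a (k - 4) (by omega)),
   -- `ζ β_T = β_U² ζ` and `c τ β_T = β_U² c τ`, so both complex components are multiplied by
   -- `β_U²`.
   complexBetaU2 i j h f.2.1, complexBetaU2 (i + 1) (j + 1) (by omega) f.2.2)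

variable {f : Fam M P .T i × Fam M P .U i × Fam M P .U (i + 1)} {j a k b : ℤ}

theorem selfConjBetaT_T (h : j = i + 4) (hk : j + a = k) (hb : i + a = b) (hkb : k = b + 4) (x) :
    (selfConjBetaT i j h f).1 a k hk x = P.act (.betaT b k hkb) (f.1 a b hb x) := by
  obtain rfl : b = k - 4 := by omega
  rfl

theorem selfConjBetaT_U (h : j = i + 4) (hk : j + a = k) (hb : i + a = b) (hkb : k = b + 4) (x) :
    (selfConjBetaT i j h f).2.1 a k hk x = P.betaU2 b k hkb (f.2.1 a b hb x) := by
  obtain rfl : b = k - 4 := by omega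
  rfl

theorem selfConjBetaT_U' (h : j = i + 4) (hk : j + 1 + a = k) (hb : i + 1 + a = b)
    (hkb : k = b + 4) (x) :
    (selfConjBetaT i j h f).2.2 a k hk x = P.betaU2 b k hkb (f.2.2 a b hb x) := by
  obtain rfl : b = k - 4 := by omega
  rfl

theorem c_tau_betaT_eq {M : CRTModule.{u}} {i a b j : ℤ} (h₁ : a = i + 1) (h₂ : b = i + 4)
    (h₃ : j = b + 1) (h₄ : j = a + 4) (x : M.obj .T i) :
    M.act (.c j) (M.act (.tau b j h₃) (M.act (.betaT i b h₂) x)) =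
      M.betaU2 a j h₄ (M.act (.c a) (M.act (.tau i a h₁) x)) :=
  c_tau_betaT h₁ h₂ h₃ rfl (by omega) x

theorem eps_r_betaU2 {M : CRTModule.{u}} {i j : ℤ} (h : j = i + 4) (x : M.obj .U i) :
    M.act (.eps j) (M.act (.r j) (M.betaU2 i j h x)) =
      M.act (.betaT i j h) (M.act (.eps i) (M.act (.r i) x)) :=
  eps_r_betaU rfl (by omega) h x

theorem isSelfConjHom_betaT_iff (h : j = i + 4) :
    IsSelfConjHom M P j (selfConjBetaT i j h f) ↔ IsSelfConjHom M P i f := by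
  have hs : sgn j = sgn i := sgn_of_even 2 h
  constructor
  · intro hf
    constructor
    · intro a k hk a' k' hk' ha hkk x
      subst hkk
      apply (P.betaT_bijective (k + 4) (k + 4 + 4) rfl).injective
      have := hf.betaT a (k + 4) (by omega) a' (k + 4 + 4) (by omega) ha (by omega) x
      rwa [selfConjBetaT_T h _ hk' rfl, selfConjBetaT_T h _ hk rfl] at this
    · exact (isComplexHom_betaU2_iff h).1 hf.betaU
    · exact (isComplexHom_betaU2_iff (by omega)).1 hf.betaU'
    · intro a k hk x
      apply (P.betaU2_bijective k (k + 4) rfl).injective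
      have := hf.zeta a (k + 4) (by omega) x
      rwa [selfConjBetaT_U h _ hk rfl, selfConjBetaT_T h _ hk rfl, zeta_betaT_eq_betaU2] at this
    · intro a k hk a' k' hk' ha hkk x
      apply (P.betaT_bijective k' (k' + 4) rfl).injective
      have := hf.gamma a (k + 4) (by omega) a' (k' + 4) (by omega) ha (by omega) x
      rwa [selfConjBetaT_T h _ hk' rfl, selfConjBetaT_U h _ hk rfl, gamma_betaU2 _ _ hkk rfl, hs,
        ← map_zsmul] at this
    · intro a k hk x
      apply (P.betaU2_bijective k (k + 4) rfl).injective
      have := hf.psiU a (k + 4) (by omega) x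
      rwa [selfConjBetaT_U h _ hk rfl, selfConjBetaT_U h _ hk rfl, psiU_betaU2] at this
    · intro a k hk x
      apply (P.betaU2_bijective k (k + 4) rfl).injective
      have := hf.psiU' a (k + 4) (by omega) x
      rwa [selfConjBetaT_U' h _ hk rfl, selfConjBetaT_U' h _ hk rfl, psiU_betaU2] at this
    · intro a k hk k' hk' hkk a' hk'' ha x
      apply (P.betaU2_bijective k' (k' + 4) rfl).injective
      have := hf.zeta' a (k + 4) (by omega) (k' + 4) (by omega) (by omega) a' (by omega) ha x
      rwa [selfConjBetaT_U' h _ hk' rfl, selfConjBetaT_U h _ hk'' rfl, selfConjBetaT_T h _ hk rfl,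
        c_tau_betaT_eq hkk rfl _ rfl, hs, ← map_zsmul, ← map_sub] at this
    · intro a k hk k' hk' hkk x
      apply (P.betaT_bijective k (k + 4) rfl).injective
      have := hf.gamma' a (k + 4) (by omega) (k' + 4) (by omega) (by omega) x
      rwa [selfConjBetaT_U' h _ hk' rfl, selfConjBetaT_U h _ hk rfl, selfConjBetaT_T h _ hk rfl,
        eps_r_betaU2, gamma_betaU2 _ _ hkk rfl, ← map_add] at this
  · intro hf
    constructor
    · intro a k hk a' k' hk' ha hkk x
      obtain rfl : k = k' - 4 := by omega
      rw [selfConjBetaT_T (b := k' - 4) h _ (by omega) (by omega),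
        selfConjBetaT_T (b := k' - 4 - 4) h _ (by omega) (by omega),
        hf.betaT a (k' - 4 - 4) (by omega) _ _ _ _ (by omega)]
    · exact (isComplexHom_betaU2_iff h).2 hf.betaU
    · exact (isComplexHom_betaU2_iff (by omega)).2 hf.betaU'
    · intro a k hk x
      rw [selfConjBetaT_U (b := k - 4) h _ (by omega) (by omega),
        selfConjBetaT_T (b := k - 4) h _ (by omega) (by omega), hf.zeta, zeta_betaT_eq_betaU2]
    · intro a k hk a' k' hk' ha hkk x
      rw [selfConjBetaT_T (b := k' - 4) h _ (by omega) (by omega),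
        selfConjBetaT_U (b := k - 4) h _ (by omega) (by omega),
        hf.gamma a (k - 4) (by omega) _ _ _ _ (by omega),
        gamma_betaU2 _ _ (b := k' - 4) (by omega) (by omega), hs, map_zsmul]
    · intro a k hk x
      rw [selfConjBetaT_U (b := k - 4) h _ (by omega) (by omega),
        selfConjBetaT_U (b := k - 4) h _ (by omega) (by omega), hf.psiU, psiU_betaU2]
    · intro a k hk x
      rw [selfConjBetaT_U' (b := k - 4) h _ (by omega) (by omega),
        selfConjBetaT_U' (b := k - 4) h _ (by omega) (by omega), hf.psiU', psiU_betaU2]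
    · intro a k hk k' hk' hkk a' hk'' ha x
      rw [selfConjBetaT_U' (b := k' - 4) h _ (by omega) (by omega),
        selfConjBetaT_U (b := k' - 4) h _ (by omega) (by omega),
        selfConjBetaT_T (b := k - 4) h _ (by omega) (by omega),
        c_tau_betaT_eq (a := k' - 4) (by omega) _ _ (by omega), hs,
        hf.zeta' a (k - 4) (by omega) (k' - 4) _ (by omega) a' (by omega) ha, map_sub, map_zsmul]
    · intro a k hk k' hk' hkk x
      rw [selfConjBetaT_U' (b := k' - 4) h _ (by omega) (by omega),
        selfConjBetaT_U (b := k - 4) h _ (by omega) (by omega),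
        selfConjBetaT_T (b := k - 4) h _ (by omega) (by omega),
        eps_r_betaU2, gamma_betaU2 _ _ (b := k - 4) (by omega) (by omega), ← map_add,
        hf.gamma' a (k - 4) (by omega) (k' - 4) (by omega)]

end betaT

end CRTModule

/-! ### The operations ε, γ and τ on graded homomorphisms -/

namespace CRTModule

theorem etaT_add_self {M : CRTModule.{u}} {i j : ℤ} (h : j = i + 1) (x : M.obj .T i) :
    M.etaT i j h x + M.etaT i j h x = 0 := by
  rw [← sub_neg_eq_add, neg_etaT, sub_self]

section

variable {M P : CRTModule.{u}} {i : ℤ}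

/-- The operation `ε` on homomorphisms. -/
def realEps (i : ℤ) (f : Fam M P .O i × Fam M P .U i × Fam M P .T i) :
    -- The complex components are the products with `ζ ε b = c b` and with `c τ ε b = 0`.
    Fam M P .T i × Fam M P .U i × Fam M P .U (i + 1) := (f.2.2, f.2.1, 0)

theorem IsRealHom.isSelfConjHom_eps {f : Fam M P .O i × Fam M P .U i × Fam M P .T i}
    (hf : IsRealHom M P i f) : IsSelfConjHom M P i (realEps i f) := by
  constructor
  · exact hf.betaT
  · exact hf.betaU
  · exact IsComplexHom.zero M P (i + 1)
  · exact hf.zeta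
  · exact hf.gamma
  · exact hf.psiU
  · intros; simp [realEps]
  · intro j k h k' h' hk j' h'' hj x
    simp only [realEps, Fam.zero_apply]
    rw [hf.c, hf.tau j k h _ _ _ _ hk, map_zsmul]
    rcases sgn_cases i with h | h <;> simp [h]
  · intro j k h k' h' hk x
    simp only [realEps, Fam.zero_apply, map_zero, add_zero]
    rw [hf.eps, hf.r]

/-- The operation `γ` on homomorphisms. -/
def complexGamma (i j : ℤ) (h : j = i - 1) (f : Fam M P .U i) :
    Fam M P .T j × Fam M P .U j × Fam M P .U (j + 1) :=
  -- Dictated by `γ b · m = γ (b · ζ m)`, by `ζ γ b = 0`, and by `c τ γ b = c r b = b + ψ_U b` with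
  -- `ψ_U b · u = ψ_U (b · ψ_U u)`.
  (fun a k hk => ((P.act (.gamma (k + 1) k)).comp (f a (k + 1) (by omega))).comp (M.act (.zeta a)),
   0, fun a k hk => f a k (by omega) +
    ((P.act (.psiU k)).comp (f a k (by omega))).comp (M.act (.psiU a)))

theorem complexGamma_T {f : Fam M P .U i} {j a k b : ℤ} (h : j = i - 1) (hk : j + a = k)
    (hb : i + a = b) (hkb : k = b - 1) (x) : (complexGamma i j h f).1 a k hk x =
      P.act (.gamma b k hkb) (f a b hb (M.act (.zeta a) x)) := by
  obtain rfl : b = k + 1 := by omega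
  rfl

theorem complexGamma_U' {f : Fam M P .U i} {j a k : ℤ} (h : j = i - 1) (hk : j + 1 + a = k)
    (hb : i + a = k) (x) : (complexGamma i j h f).2.2 a k hk x =
      f a k hb x + P.act (.psiU k) (f a k hb (M.act (.psiU a) x)) := rfl

theorem IsComplexHom.betaU2 {f : Fam M P .U i} (hf : IsComplexHom M P i f) {a k hk a' k' hk' ha}
    (hkk x) : f a' k' hk' (M.betaU2 a a' ha x) = P.betaU2 k k' hkk (f a k hk x) := by
  rw [betaU2_apply ha rfl (by omega), betaU2_apply hkk rfl (by omega),
    hf (a + 2) (k + 2) (by omega) a' k' hk' _ (by omega), hf a k hk _ _ _ _ rfl]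

theorem IsComplexHom.isSelfConjHom_gamma {f : Fam M P .U i} (hf : IsComplexHom M P i f) {j : ℤ}
    (h : j = i - 1) : IsSelfConjHom M P j (complexGamma i j h f) := by
  constructor
  · intro a k hk a' k' hk' ha hkk x
    rw [complexGamma_T h _ (b := k' + 1) (by omega) (by omega),
      complexGamma_T h _ (b := k + 1) (by omega) (by omega), zeta_betaT_eq_betaU2,
      hf.betaU2 (k := k + 1) (hk := by omega) (by omega), gamma_betaU2]
  · exact IsComplexHom.zero M P j
  · intro a k hk a' k' hk' ha hkk x
    rw [complexGamma_U' h hk' (by omega), complexGamma_U' h hk (by omega), psiU_betaU', map_neg,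
      hf a k (by omega) a' k' _ _ hkk, hf a k (by omega) a' k' _ _ hkk, map_neg, psiU_betaU',
      neg_neg, map_add]
  · intro a k hk x
    rw [complexGamma_T h _ (b := k + 1) (by omega) (by omega), zeta_gamma']
    rfl
  · intro a k hk a' k' hk' ha hkk x
    rw [complexGamma_T h _ (b := k' + 1) (by omega) (by omega), zeta_gamma', map_zero, map_zero]
    simp [complexGamma]
  · intros; simp [complexGamma]
  · intro a k hk x
    rw [complexGamma_U' h hk (by omega), complexGamma_U' h hk (by omega), psiU_psiU', map_add,
      psiU_psiU', add_comm]
  · intro a k hk k' hk' hkk a' hk'' ha x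
    rw [complexGamma_U' h hk' (by omega), complexGamma_T h _ (b := k') (by omega) (by omega),
      tau_gamma, c_r', psiU_zeta']
    simp [complexGamma]
  · intro a k hk k' hk' hkk x
    rw [complexGamma_U' h hk' (by omega), complexGamma_T h _ (b := k') (by omega) (by omega),
      zeta_eps, c_r']
    simp [complexGamma]

/-- The operation `τ` on homomorphisms. -/
def selfConjTau (i j : ℤ) (h : j = i + 1)
    (f : Fam M P .T i × Fam M P .U i × Fam M P .U (i + 1)) :
    Fam M P .O j × Fam M P .U j × Fam M P .T j :=
  -- Dictated by `τ b · m = τ (b · ε m)`; the complex component `c τ b` is already the third member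
  -- of the triple, and `ε τ b · m` is solved for in the formula for `ε τ (b · m)`.
  (fun a k hk => ((P.act (.tau (k - 1) k)).comp (f.1 a (k - 1) (by omega))).comp (M.act (.eps a)),
   fun a k hk => f.2.2 a k (by omega),
   fun a k hk => ((P.act (.eps k)).comp (P.act (.tau (k - 1) k))).comp
      (f.1 a (k - 1) (by omega)) -
    sgn i • ((f.1 (a + 1) k (by omega)).comp (M.act (.eps (a + 1)))).comp
      (M.act (.tau a (a + 1))) - (P.etaT (k - 1) k).comp (f.1 a (k - 1) (by omega)))

variable {f : Fam M P .T i × Fam M P .U i × Fam M P .U (i + 1)}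

theorem selfConjTau_O {j a k b : ℤ} (h : j = i + 1) (hk : j + a = k) (hb : i + a = b)
    (hkb : k = b + 1) (x) : (selfConjTau i j h f).1 a k hk x =
      P.act (.tau b k hkb) (f.1 a b hb (M.act (.eps a) x)) := by
  obtain rfl : b = k - 1 := by omega
  rfl

theorem selfConjTau_U {j a k : ℤ} (h : j = i + 1) (hk : j + a = k) (hb : i + 1 + a = k) (x) :
    (selfConjTau i j h f).2.1 a k hk x = f.2.2 a k hb x := rfl

theorem selfConjTau_T {j a k b a' : ℤ} (h : j = i + 1) (hk : j + a = k) (hb : i + a = b)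
    (hkb : k = b + 1) (ha : a' = a + 1) (hk' : i + a' = k) (x) :
    (selfConjTau i j h f).2.2 a k hk x =
      P.act (.eps k) (P.act (.tau b k hkb) (f.1 a b hb x)) -
        sgn i • f.1 a' k hk' (M.act (.eps a') (M.act (.tau a a' ha) x)) -
        P.etaT b k hkb (f.1 a b hb x) := by
  obtain rfl : b = k - 1 := by omega
  subst ha
  rfl

theorem IsSelfConjHom.isRealHom_tau (hf : IsSelfConjHom M P i f) {j : ℤ} (h : j = i + 1) :
    IsRealHom M P j (selfConjTau i j h f) := by
  constructor
  · intro a k hk a' k' hk' ha hkk x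
    rw [selfConjTau_O h _ (b := k' - 1) (by omega) (by omega),
      selfConjTau_O h _ (b := k - 1) (by omega) (by omega),
      eps_betaO' (a := a + 4) ha rfl (by omega),
      hf.betaT (a + 4) (k + 3) (by omega) _ _ _ _ (by omega),
      hf.betaT a (k - 1) (by omega) _ _ _ _ (by omega), tau_betaT']
  · intro a k hk a' k' hk' ha hkk x
    exact hf.betaU' a k (by omega) a' k' (by omega) ha hkk x
  · intro a k hk a' k' hk' ha hkk x
    rw [selfConjTau_T h _ (b := k' - 1) (a' := a' + 1) (by omega) (by omega) rfl (by omega),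
      selfConjTau_T h _ (b := k - 1) (a' := a + 1) (by omega) (by omega) rfl (by omega),
      hf.betaT a (k - 1) (by omega) _ _ _ _ (by omega),
      etaT_betaT (a := k) (by omega) hkk, map_sub, map_sub, map_zsmul,
      betaT_eps_tau' (b := k' - 1) (by omega) hkk (by omega) (by omega),
      etaT_betaT (a := k) (by omega) hkk,
      eq_sub_of_add_eq (betaT_eps_tau' (M := M) (i := a) (a := a + 1) (b := a') (j := a' + 1) rfl
        (by omega) ha rfl x).symm, map_sub, etaT_betaT (a := a + 1) rfl (by omega),
      hf.betaT (a + 1) k (by omega) _ _ _ _ hkk, hf.betaT (a + 1) k (by omega) _ _ _ _ hkk,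
      hf.etaT (k := k - 1) (h := by omega) (hk := by omega), smul_sub]
    -- With `y = f x`, the two sides now differ by `((-1)^i - 1) β_T η_T y`, which is zero because
    -- `2 η_T = 0`.
    have h₂ := congrArg (P.act (.betaT k k' hkk))
      (etaT_add_self (show k = k - 1 + 1 by omega) (f.1 a (k - 1) (by omega) x))
    rw [map_add, map_zero] at h₂
    rcases sgn_cases i with h | h <;> simp only [h, one_smul, neg_smul]
    · abel
    · rw [← sub_eq_zero, ← neg_eq_zero, ← h₂]; abel
  · intro a k hk x
    rw [selfConjTau_O h _ (b := k - 1) (by omega) (by omega),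
      selfConjTau_T h _ (b := k - 1) (a' := a + 1) (by omega) (by omega) rfl (by omega),
      eps_tau_eps, hf.etaT (k := k - 1) (h := by omega) (hk := by omega)]
    have h₂ := etaT_add_self (show k = k - 1 + 1 by omega)
      (f.1 a (k - 1) (by omega) (M.act (.eps a) x))
    rcases sgn_cases i with h | h <;> simp only [h, one_smul, neg_smul]
    · rw [← sub_eq_zero, ← neg_eq_zero, ← h₂]; abel
    · abel
  · intro a k hk x
    rw [selfConjTau_U h hk (by omega),
      selfConjTau_T h _ (b := k - 1) (a' := a + 1) (by omega) (by omega) rfl (by omega),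
      map_sub, map_sub, map_zsmul, zeta_etaT, sub_zero, zeta_eps, ← hf.zeta, zeta_eps]
    exact hf.zeta' a (k - 1) (by omega) k _ (by omega) (a + 1) (by omega) rfl x
  · intro a k hk a' k' hk' ha hkk x
    rw [selfConjTau_U h hk (by omega),
      selfConjTau_T h _ (b := k' - 1) (a' := a) (by omega) (by omega) (by omega) (by omega),
      tau_gamma, hf.gamma' a k' (by omega) k (by omega) (by omega),
      hf.gamma a k' (by omega) a' (k' - 1) _ _ rfl]
    simp only [map_zsmul, tau_gamma, etaT_gamma, smul_zero, sgn_succ h]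
    rw [smul_add]
    module
  · intro a k hk a' k' hk' ha hkk x
    rw [selfConjTau_O h _ (b := k) (by omega) (by omega),
      selfConjTau_T h _ (b := k - 1) (a' := a') (by omega) (by omega) (by omega) (by omega)]
    simp only [map_zsmul, map_sub, tau_eps_tau, sgn_succ h]
    rcases sgn_cases i with h | h <;> simp [h]

end

end CRTModule

namespace CRTModule

/-! ### The CRT-module of graded homomorphisms -/

section

variable (M P : CRTModule.{u})

def epsHom (i : ℤ) : realHom M P i →+ selfConjHom M P i :=
  AddMonoidHom.mk' (fun f => ⟨realEps i f.1, IsRealHom.isSelfConjHom_eps f.2⟩) fun f g => by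
    apply selfConjHom_ext <;> intros <;> simp [realEps]

def zetaHom (i : ℤ) : selfConjHom M P i →+ complexHom M P i :=
  AddMonoidHom.mk' (fun f => ⟨f.1.2.1, IsSelfConjHom.betaU f.2⟩) fun _ _ => rfl

def gammaHom (i j : ℤ) (h : j = i - 1) : complexHom M P i →+ selfConjHom M P j :=
  AddMonoidHom.mk' (fun f => ⟨complexGamma i j h f.1, IsComplexHom.isSelfConjHom_gamma f.2 h⟩)
    fun f g => by
      apply selfConjHom_ext <;> intro a k hk x
      · exact map_add (P.act (.gamma (k + 1) k)) _ _
      · exact (add_zero 0).symm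
      · change (_ + _) + P.act _ (_ + _) = (_ + P.act _ _) + (_ + P.act _ _)
        rw [map_add]
        abel

def tauHom (i j : ℤ) (h : j = i + 1) : selfConjHom M P i →+ realHom M P j :=
  AddMonoidHom.mk' (fun f => ⟨selfConjTau i j h f.1, IsSelfConjHom.isRealHom_tau f.2 h⟩)
    fun f g => by
      apply realHom_ext <;> intro a k hk x
      · exact map_add (P.act (.tau (k - 1) k)) _ _
      · rfl
      · change P.act _ (P.act _ (_ + _)) - sgn i • (_ + _) - P.etaT (k - 1) k (by omega) (_ + _) =
          (P.act _ (P.act _ _) - sgn i • _ - P.etaT (k - 1) k (by omega) _) +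
            (P.act _ (P.act _ _) - sgn i • _ - P.etaT (k - 1) k (by omega) _)
        simp only [map_add, smul_add, AddMonoidHom.comp_apply]
        abel

def betaOHom (i j : ℤ) (h : j = i + 8) : realHom M P i →+ realHom M P j :=
  AddMonoidHom.mk' (fun f => ⟨realBetaO i j h f.1, (isRealHom_betaO_iff h).2 f.2⟩)
    fun f g => by
      apply realHom_ext <;> intro a k hk x
      · exact map_add (P.act (.betaO (k - 8) k)) _ _
      · exact map_add (P.betaU4 (k - 8) k) _ _
      · exact map_add (P.betaT2 (k - 8) k) _ _

def betaUHom (i j : ℤ) (h : j = i + 2) : complexHom M P i →+ complexHom M P j :=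
  AddMonoidHom.mk' (fun f => ⟨complexBetaU i j h f.1, (isComplexHom_betaU_iff h).2 f.2⟩)
    fun f g => by
      apply complexHom_ext
      intro a k hk x
      exact map_add (P.act (.betaU (k - 2) k)) _ _

def betaTHom (i j : ℤ) (h : j = i + 4) : selfConjHom M P i →+ selfConjHom M P j :=
  AddMonoidHom.mk' (fun f => ⟨selfConjBetaT i j h f.1, (isSelfConjHom_betaT_iff h).2 f.2⟩)
    fun f g => by
      apply selfConjHom_ext <;> intro a k hk x
      · exact map_add (P.act (.betaT (k - 4) k)) _ _
      · exact map_add (P.betaU2 (k - 4) k) _ _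
      · exact map_add (P.betaU2 (k - 4) k) _ _

/-- An inverse of the bijection `b`. -/
noncomputable def invHom {A B : Type u} [AddCommGroup A] [AddCommGroup B] (b : A →+ B)
    (hb : Function.Bijective b) : B →+ A := (AddEquiv.ofBijective b hb).symm.toAddMonoidHom

theorem apply_invHom {A B : Type u} [AddCommGroup A] [AddCommGroup B] (b : A →+ B)
    (hb : Function.Bijective b) (x : B) : b (invHom b hb x) = x :=
  (AddEquiv.ofBijective b hb).apply_symm_apply x

theorem betaOHom_bijective (i j : ℤ) (h : j = i + 8) : Function.Bijective (betaOHom M P i j h) := by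
  constructor
  · intro f g hfg
    apply realHom_ext <;> intro a k hk x
    · apply (P.betaO_bijective k (k + 8) rfl).injective
      rw [← realBetaO_O h (by omega) hk rfl, ← realBetaO_O h (by omega) hk rfl]
      exact congrArg (fun f : realHom M P j => f.1.1 a (k + 8) (by omega) x) hfg
    · apply (P.betaU4_bijective k (k + 8) rfl).injective
      rw [← realBetaO_U h (by omega) hk rfl, ← realBetaO_U h (by omega) hk rfl]
      exact congrArg (fun f : realHom M P j => f.1.2.1 a (k + 8) (by omega) x) hfg
    · apply (P.betaT2_bijective k (k + 8) rfl).injective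
      rw [← realBetaO_T h (by omega) hk rfl, ← realBetaO_T h (by omega) hk rfl]
      exact congrArg (fun f : realHom M P j => f.1.2.2 a (k + 8) (by omega) x) hfg
  · intro g
    let f : Fam M P .O i × Fam M P .U i × Fam M P .T i :=
      (fun a k hk => (invHom _ (P.betaO_bijective k (k + 8) rfl)).comp
          (g.1.1 a (k + 8) (by omega)),
        fun a k hk => (invHom _ (P.betaU4_bijective k (k + 8) rfl)).comp
          (g.1.2.1 a (k + 8) (by omega)),
        fun a k hk => (invHom _ (P.betaT2_bijective k (k + 8) rfl)).comp
          (g.1.2.2 a (k + 8) (by omega)))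
    have hf : realBetaO i j h f = g.1 := by
      refine Prod.ext ?_ (Prod.ext ?_ ?_) <;> funext a k hk <;> apply AddMonoidHom.ext <;> intro x
      all_goals obtain ⟨b, rfl⟩ : ∃ b, k = b + 8 := ⟨k - 8, by omega⟩
      · rw [realBetaO_O h hk (b := b) (by omega) rfl]
        exact apply_invHom _ (P.betaO_bijective b (b + 8) rfl) _
      · rw [realBetaO_U h hk (b := b) (by omega) rfl]
        exact apply_invHom _ (P.betaU4_bijective b (b + 8) rfl) _
      · rw [realBetaO_T h hk (b := b) (by omega) rfl]
        exact apply_invHom _ (P.betaT2_bijective b (b + 8) rfl) _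
    exact ⟨⟨f, (isRealHom_betaO_iff h).1 (hf ▸ g.2)⟩, Subtype.ext hf⟩

theorem betaUHom_bijective (i j : ℤ) (h : j = i + 2) : Function.Bijective (betaUHom M P i j h) := by
  constructor
  · intro f g hfg
    apply complexHom_ext
    intro a k hk x
    apply (P.betaU_bijective k (k + 2) rfl).injective
    rw [← complexBetaU_apply h (by omega) hk rfl, ← complexBetaU_apply h (by omega) hk rfl]
    exact congrArg (fun f : complexHom M P j => f.1 a (k + 2) (by omega) x) hfg
  · intro g
    let f : Fam M P .U i := fun a k hk => (invHom _ (P.betaU_bijective k (k + 2) rfl)).comp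
      (g.1 a (k + 2) (by omega))
    have hf : complexBetaU i j h f = g.1 := by
      funext a k hk
      apply AddMonoidHom.ext
      intro x
      obtain ⟨b, rfl⟩ : ∃ b, k = b + 2 := ⟨k - 2, by omega⟩
      rw [complexBetaU_apply h hk (b := b) (by omega) rfl]
      exact apply_invHom _ (P.betaU_bijective b (b + 2) rfl) _
    exact ⟨⟨f, (isComplexHom_betaU_iff h).1 (hf ▸ g.2)⟩, Subtype.ext hf⟩

theorem betaTHom_bijective (i j : ℤ) (h : j = i + 4) : Function.Bijective (betaTHom M P i j h) := by
  constructor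
  · intro f g hfg
    apply selfConjHom_ext <;> intro a k hk x
    · apply (P.betaT_bijective k (k + 4) rfl).injective
      rw [← selfConjBetaT_T h (by omega) hk rfl, ← selfConjBetaT_T h (by omega) hk rfl]
      exact congrArg (fun f : selfConjHom M P j => f.1.1 a (k + 4) (by omega) x) hfg
    · apply (P.betaU2_bijective k (k + 4) rfl).injective
      rw [← selfConjBetaT_U h (by omega) hk rfl, ← selfConjBetaT_U h (by omega) hk rfl]
      exact congrArg (fun f : selfConjHom M P j => f.1.2.1 a (k + 4) (by omega) x) hfg
    · apply (P.betaU2_bijective k (k + 4) rfl).injective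
      rw [← selfConjBetaT_U' h (by omega) hk rfl, ← selfConjBetaT_U' h (by omega) hk rfl]
      exact congrArg (fun f : selfConjHom M P j => f.1.2.2 a (k + 4) (by omega) x) hfg
  · intro g
    let f : Fam M P .T i × Fam M P .U i × Fam M P .U (i + 1) :=
      (fun a k hk => (invHom _ (P.betaT_bijective k (k + 4) rfl)).comp
          (g.1.1 a (k + 4) (by omega)),
        fun a k hk => (invHom _ (P.betaU2_bijective k (k + 4) rfl)).comp
          (g.1.2.1 a (k + 4) (by omega)),
        fun a k hk => (invHom _ (P.betaU2_bijective k (k + 4) rfl)).comp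
          (g.1.2.2 a (k + 4) (by omega)))
    have hf : selfConjBetaT i j h f = g.1 := by
      refine Prod.ext ?_ (Prod.ext ?_ ?_) <;> funext a k hk <;> apply AddMonoidHom.ext <;> intro x
      all_goals obtain ⟨b, rfl⟩ : ∃ b, k = b + 4 := ⟨k - 4, by omega⟩
      · rw [selfConjBetaT_T h hk (b := b) (by omega) rfl]
        exact apply_invHom _ (P.betaT_bijective b (b + 4) rfl) _
      · rw [selfConjBetaT_U h hk (b := b) (by omega) rfl]
        exact apply_invHom _ (P.betaU2_bijective b (b + 4) rfl) _
      · rw [selfConjBetaT_U' h hk (b := b) (by omega) rfl]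
        exact apply_invHom _ (P.betaU2_bijective b (b + 4) rfl) _
    exact ⟨⟨f, (isSelfConjHom_betaT_iff h).1 (hf ▸ g.2)⟩, Subtype.ext hf⟩

/-- The parts of the CRT-module of graded homomorphisms. -/
def homObj : CRTPart → ℤ → Type u
  | .O, i => realHom M P i
  | .U, i => complexHom M P i
  | .T, i => selfConjHom M P i

instance : ∀ X i, AddCommGroup (homObj M P X i)
  | .O, i => inferInstanceAs (AddCommGroup (realHom M P i))
  | .U, i => inferInstanceAs (AddCommGroup (complexHom M P i))
  | .T, i => inferInstanceAs (AddCommGroup (selfConjHom M P i))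

variable {M P} {i : ℤ}

theorem r_c_hom {a : ℤ} (h : i = a + 1) (h' : a = i - 1) (f : realHom M P i) :
    tauHom M P a i h (gammaHom M P i a h' (zetaHom M P i (epsHom M P i f))) = f + f := by
  have hf : IsRealHom M P i f.1 := f.2
  apply realHom_ext <;> intro j k hk x
  · change (selfConjTau a i h (complexGamma i a h' f.1.2.1)).1 j k hk x =
      f.1.1 j k hk x + f.1.1 j k hk x
    rw [selfConjTau_O h hk (b := k - 1) (by omega) (by omega),
      complexGamma_T h' _ hk (by omega), tau_gamma, zeta_eps, hf.c, P.r_c, two_nsmul]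
  · change (complexGamma i a h' f.1.2.1).2.2 j k (by omega) x = f.1.2.1 j k hk x + f.1.2.1 j k hk x
    rw [complexGamma_U' h' _ hk, hf.psiU, psiU_psiU']
  · change (selfConjTau a i h (complexGamma i a h' f.1.2.1)).2.2 j k hk x =
      f.1.2.2 j k hk x + f.1.2.2 j k hk x
    -- On the self-conjugate component `r c` becomes `ε r ζ + γ c τ` applied to `f x`, which is `(1
    -- + ψ_T) + (1 - ψ_T) = 2`.
    rw [selfConjTau_T h hk (b := k - 1) (a' := j + 1) (by omega) (by omega) rfl (by omega),
      complexGamma_T h' _ hk (by omega), tau_gamma,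
      complexGamma_T h' _ (b := k + 1) (by omega) (by omega), etaT_gamma, zeta_eps, hf.c,
      hf.tau j k hk _ _ _ _ rfl, hf.zeta, P.eps_r_zeta, map_zsmul, map_zsmul, gamma_c_tau',
      sgn_pred h']
    rcases sgn_cases i with h | h <;> simp only [h, one_smul, neg_smul] <;> abel

theorem gamma_c_tau_hom {a b : ℤ} (h : a = i + 1) (h' : i = a - 1) (h₁ : i = b + 1)
    (h₂ : b = i - 1) (f : selfConjHom M P i) :
    gammaHom M P a i h' (zetaHom M P a (epsHom M P a (tauHom M P i a h f))) +
      epsHom M P i (tauHom M P b i h₁ (gammaHom M P i b h₂ (zetaHom M P i f))) = f + f := by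
  have hf : IsSelfConjHom M P i f.1 := f.2
  apply selfConjHom_ext <;> intro j k hk x
  · change (complexGamma a i h' (selfConjTau i a h f.1).2.1).1 j k hk x +
      (selfConjTau b i h₁ (complexGamma i b h₂ f.1.2.1)).2.2 j k hk x =
      f.1.1 j k hk x + f.1.1 j k hk x
    -- The condition `zeta'` splits the first summand into `γ c τ (f x)` and a term in `γ (ζ f · c τ
    -- x)`, which cancels against the same term of the second summand. What remains is `(γ c τ + ε r
    -- ζ) (f x)`.
    rw [complexGamma_T h' _ (b := k + 1) (by omega) (by omega), selfConjTau_U h _ (by omega),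
      hf.zeta' j k hk _ _ rfl (j + 1) (by omega) rfl,
      selfConjTau_T h₁ hk (b := k - 1) (a' := j + 1) (by omega) (by omega) rfl (by omega),
      complexGamma_T h₂ _ hk (by omega), tau_gamma, etaT_gamma,
      complexGamma_T h₂ _ (b := k + 1) (by omega) (by omega), zeta_eps, hf.zeta, P.eps_r_zeta,
      map_sub, gamma_c_tau', sgn_pred h₂, map_zsmul, neg_smul]
    abel
  · change 0 + (complexGamma i b h₂ f.1.2.1).2.2 j k (by omega) x = _
    rw [complexGamma_U' h₂ _ hk, hf.psiU, psiU_psiU', zero_add]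
    rfl
  · change (complexGamma a i h' (selfConjTau i a h f.1).2.1).2.2 j k hk x + 0 =
      f.1.2.2 j k hk x + f.1.2.2 j k hk x
    rw [complexGamma_U' h' _ (by omega), selfConjTau_U h _ hk, selfConjTau_U h _ hk, hf.psiU',
      psiU_psiU', add_zero]

/-- `c r` sends `f` to `f + ψ_U f ψ_U`. Since `ψ_U` anticommutes with `β_U`, the two conjugated
terms cancel. -/
theorem c_r_betaU_hom {j a b : ℤ} (h : j = i + 2) (h₁ : j = a + 1) (h₂ : a = j - 1)
    (h₃ : i = b + 1) (h₄ : b = i - 1) (f : complexHom M P i) :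
    zetaHom M P j (epsHom M P j (tauHom M P a j h₁ (gammaHom M P j a h₂ (betaUHom M P i j h f)))) +
      betaUHom M P i j h
        (zetaHom M P i (epsHom M P i (tauHom M P b i h₃ (gammaHom M P i b h₄ f)))) =
    betaUHom M P i j h f + betaUHom M P i j h f := by
  have hf : IsComplexHom M P i f.1 := f.2
  apply complexHom_ext
  intro m k hk x
  change (complexGamma j a h₂ (complexBetaU i j h f.1)).2.2 m k (by omega) x +
    complexBetaU i j h (selfConjTau b i h₃ (complexGamma i b h₄ f.1)).2.1 m k hk x =
    complexBetaU i j h f.1 m k hk x + complexBetaU i j h f.1 m k hk x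
  rw [complexGamma_U' h₂ _ hk, complexBetaU_apply h hk (b := k - 2) (by omega) (by omega),
    complexBetaU_apply h hk (b := k - 2) (by omega) (by omega),
    complexBetaU_apply h hk (b := k - 2) (by omega) (by omega),
    selfConjTau_U h₃ _ (by omega), complexGamma_U' h₄ _ (by omega), psiU_betaU', map_add]
  abel

theorem gamma_betaU_hom {a j b k : ℤ} (h₁ : a = i + 2) (h₂ : j = a + 2) (h₃ : k = j - 1)
    (h₄ : b = i - 1) (h₅ : k = b + 4) (f : complexHom M P i) :
    gammaHom M P j k h₃ (betaUHom M P a j h₂ (betaUHom M P i a h₁ f)) =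
      betaTHom M P b k h₅ (gammaHom M P i b h₄ f) := by
  apply selfConjHom_ext <;> intro m n hn x
  · change (complexGamma j k h₃ (complexBetaU a j h₂ (complexBetaU i a h₁ f.1))).1 m n hn x =
      (selfConjBetaT b k h₅ (complexGamma i b h₄ f.1)).1 m n hn x
    rw [complexGamma_T h₃ _ (b := n + 1) (by omega) (by omega),
      complexBetaU_apply h₂ _ (b := n - 1) (by omega) (by omega),
      complexBetaU_apply h₁ _ (b := n - 3) (by omega) (by omega),
      selfConjBetaT_T h₅ _ (b := n - 4) (by omega) (by omega),
      complexGamma_T h₄ _ (b := n - 3) (by omega) (by omega), gamma_betaU']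
  · change 0 = (selfConjBetaT b k h₅ (complexGamma i b h₄ f.1)).2.1 m n hn x
    rw [selfConjBetaT_U h₅ _ (b := n - 4) (by omega) (by omega)]
    exact (map_zero _).symm
  · change (complexGamma j k h₃ (complexBetaU a j h₂ (complexBetaU i a h₁ f.1))).2.2 m n hn x =
      (selfConjBetaT b k h₅ (complexGamma i b h₄ f.1)).2.2 m n hn x
    rw [complexGamma_U' h₃ _ (by omega),
      complexBetaU_apply h₂ _ (b := n - 2) (by omega) (by omega),
      complexBetaU_apply h₁ _ (b := n - 4) (by omega) (by omega),
      complexBetaU_apply h₂ _ (b := n - 2) (by omega) (by omega),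
      complexBetaU_apply h₁ _ (b := n - 4) (by omega) (by omega),
      selfConjBetaT_U' h₅ _ (b := n - 4) (by omega) (by omega),
      complexGamma_U' h₄ _ (by omega), psiU_betaU_betaU,
      betaU2_apply _ (a := n - 2) (by omega) (by omega), map_add, map_add]

theorem tau_betaT_hom {a j b k : ℤ} (h₁ : a = i + 4) (h₂ : j = a + 4) (h₃ : k = j + 1)
    (h₄ : b = i + 1) (h₅ : k = b + 8) (f : selfConjHom M P i) :
    tauHom M P j k h₃ (betaTHom M P a j h₂ (betaTHom M P i a h₁ f)) =
      betaOHom M P b k h₅ (tauHom M P i b h₄ f) := by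
  have hs : sgn j = sgn i := sgn_of_even 4 (by omega)
  apply realHom_ext <;> intro m n hn x
  · change (selfConjTau j k h₃ (selfConjBetaT a j h₂ (selfConjBetaT i a h₁ f.1))).1 m n hn x =
      (realBetaO b k h₅ (selfConjTau i b h₄ f.1)).1 m n hn x
    rw [selfConjTau_O h₃ _ (b := n - 1) (by omega) (by omega),
      selfConjBetaT_T h₂ _ (b := n - 5) (by omega) (by omega),
      selfConjBetaT_T h₁ _ (b := n - 9) (by omega) (by omega),
      realBetaO_O h₅ _ (b := n - 8) (by omega) (by omega),
      selfConjTau_O h₄ _ (b := n - 9) (by omega) (by omega), tau_betaT']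
  · change (selfConjBetaT a j h₂ (selfConjBetaT i a h₁ f.1)).2.2 m n (by omega) x =
      (realBetaO b k h₅ (selfConjTau i b h₄ f.1)).2.1 m n hn x
    rw [selfConjBetaT_U' h₂ _ (b := n - 4) (by omega) (by omega),
      selfConjBetaT_U' h₁ _ (b := n - 8) (by omega) (by omega),
      realBetaO_U h₅ _ (b := n - 8) (by omega) (by omega),
      selfConjTau_U h₄ _ (by omega), betaU4_apply _ (a := n - 4) (by omega) (by omega)]
  · change (selfConjTau j k h₃ (selfConjBetaT a j h₂ (selfConjBetaT i a h₁ f.1))).2.2 m n hn x =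
      (realBetaO b k h₅ (selfConjTau i b h₄ f.1)).2.2 m n hn x
    rw [selfConjTau_T h₃ _ (b := n - 1) (a' := m + 1) (by omega) (by omega) rfl (by omega),
      selfConjBetaT_T h₂ _ (b := n - 5) (by omega) (by omega),
      selfConjBetaT_T h₁ _ (b := n - 9) (by omega) (by omega),
      selfConjBetaT_T h₂ _ (b := n - 4) (by omega) (by omega),
      selfConjBetaT_T h₁ _ (b := n - 8) (by omega) (by omega),
      realBetaO_T h₅ _ (b := n - 8) (by omega) (by omega),
      selfConjTau_T h₄ _ (b := n - 9) (a' := m + 1) (by omega) (by omega) rfl (by omega),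
      tau_betaT' (b := n - 8) _ _ _ (by omega) (by omega), eps_betaO_eq_betaT2,
      ← betaT2_apply (by omega), ← betaT2_apply (by omega),
      etaT_betaT2 (a := n - 8) _ _ (by omega) (by omega), map_sub, map_sub, map_zsmul, hs]

theorem betaT_eps_tau_hom {a j b c : ℤ} (h₁ : a = i + 1) (h₂ : j = a + 4) (h₃ : b = i + 4)
    (h₄ : j = b + 1) (h₅ : c = b + 2) (h₆ : j = c - 1) (f : selfConjHom M P i) :
    betaTHom M P a j h₂ (epsHom M P a (tauHom M P i a h₁ f)) =
      epsHom M P j (tauHom M P b j h₄ (betaTHom M P i b h₃ f)) + gammaHom M P c j h₆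
        (betaUHom M P b c h₅ (zetaHom M P b (betaTHom M P i b h₃ f))) := by
  have hf : IsSelfConjHom M P i f.1 := f.2
  have hs : sgn b = sgn i := sgn_of_even 2 h₃
  apply selfConjHom_ext <;> intro m n hn x
  · change (selfConjBetaT a j h₂ (realEps a (selfConjTau i a h₁ f.1))).1 m n hn x =
      (selfConjTau b j h₄ (selfConjBetaT i b h₃ f.1)).2.2 m n hn x + (complexGamma c j h₆
        (complexBetaU b c h₅ (selfConjBetaT i b h₃ f.1).2.1)).1 m n hn x
    rw [selfConjBetaT_T h₂ _ (b := n - 4) (by omega) (by omega),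
      show (realEps a (selfConjTau i a h₁ f.1)).1 = (selfConjTau i a h₁ f.1).2.2 from rfl,
      selfConjTau_T h₁ _ (b := n - 5) (a' := m + 1) (by omega) (by omega) rfl (by omega),
      selfConjTau_T h₄ _ (b := n - 1) (a' := m + 1) (by omega) (by omega) rfl (by omega),
      selfConjBetaT_T h₃ _ (b := n - 5) (by omega) (by omega),
      selfConjBetaT_T h₃ _ (b := n - 4) (by omega) (by omega),
      complexGamma_T h₆ _ (b := n + 1) (by omega) (by omega),
      complexBetaU_apply h₅ _ (b := n - 1) (by omega) (by omega),
      selfConjBetaT_U h₃ _ (b := n - 5) (by omega) (by omega), hf.zeta,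
      ← zeta_betaT_eq_betaU2, ← etaT_apply (by omega), map_sub, map_sub, map_zsmul, hs,
      betaT_eps_tau' (b := n - 1) (by omega) (by omega) (by omega) (by omega),
      etaT_betaT (a := n - 4) (by omega) (by omega)]
    abel
  · change (selfConjBetaT a j h₂ (realEps a (selfConjTau i a h₁ f.1))).2.1 m n hn x =
      (selfConjBetaT i b h₃ f.1).2.2 m n (by omega) x + 0
    rw [selfConjBetaT_U h₂ _ (b := n - 4) (by omega) (by omega),
      selfConjBetaT_U' h₃ _ (b := n - 4) (by omega) (by omega), add_zero]
    rfl
  · change (selfConjBetaT a j h₂ (realEps a (selfConjTau i a h₁ f.1))).2.2 m n hn x =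
      0 + (complexGamma c j h₆
        (complexBetaU b c h₅ (selfConjBetaT i b h₃ f.1).2.1)).2.2 m n hn x
    -- The last component is `β_U F + ψ_U β_U F ψ_U`, for the complex component `F` of `β_T f`. It
    -- vanishes because `F` commutes with `ψ_U` while `β_U` anticommutes with it.
    rw [selfConjBetaT_U' h₂ _ (b := n - 4) (by omega) (by omega),
      complexGamma_U' h₆ _ (by omega), complexBetaU_apply h₅ _ (b := n - 2) (by omega) (by omega),
      complexBetaU_apply h₅ _ (b := n - 2) (by omega) (by omega),
      selfConjBetaT_U h₃ _ (b := n - 6) (by omega) (by omega),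
      selfConjBetaT_U h₃ _ (b := n - 6) (by omega) (by omega), hf.psiU, psiU_betaU', psiU_betaU2,
      psiU_psiU', add_neg_cancel, add_zero]
    exact map_zero _

theorem tau_betaT_eps_hom {a j : ℤ} (h : a = i + 4) (h' : j = a + 1) (f : realHom M P i) :
    tauHom M P a j h' (betaTHom M P i a h (epsHom M P i f)) = 0 := by
  have hf : IsRealHom M P i f.1 := f.2
  have hs : sgn a = sgn i := sgn_of_even 2 h
  apply realHom_ext <;> intro m n hn x
  · change (selfConjTau a j h' (selfConjBetaT i a h (realEps i f.1))).1 m n hn x = 0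
    rw [selfConjTau_O h' _ (b := n - 1) (by omega) (by omega),
      selfConjBetaT_T h _ (b := n - 5) (by omega) (by omega)]
    change P.act _ (P.act _ (f.1.2.2 _ _ _ _)) = 0
    rw [hf.eps, tau_betaT_eps']
  · change (selfConjBetaT i a h (realEps i f.1)).2.2 m n (by omega) x = 0
    rw [selfConjBetaT_U' h _ (b := n - 4) (by omega) (by omega)]
    exact map_zero _
  · change (selfConjTau a j h' (selfConjBetaT i a h (realEps i f.1))).2.2 m n hn x = 0
    rw [selfConjTau_T h' _ (b := n - 1) (a' := m + 1) (by omega) (by omega) rfl (by omega),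
      selfConjBetaT_T h _ (b := n - 5) (by omega) (by omega),
      selfConjBetaT_T h _ (b := n - 4) (by omega) (by omega)]
    change _ - _ • P.act _ (f.1.2.2 _ _ _ _) - _ = 0
    rw [hf.eps, hf.tau m (n - 5) (by omega) _ _ _ _ (by omega), map_zsmul, map_zsmul,
      betaT_eps_tau' (b := n - 1) (by omega) (by omega) (by omega) (by omega), hs]
    -- The two signs multiply to `1`, and what is left is `-2 η_T β_T y` with `y` the value of the
    -- self-conjugate component at `x`.
    have h₂ := etaT_add_self (show n = n - 1 + 1 by omega)
      (P.act (.betaT (n - 5) (n - 1) (by omega)) (f.1.2.2 m (n - 5) (by omega) x))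
    change _ - _ - P.etaT _ _ _ (P.act _ (f.1.2.2 _ _ _ _)) = 0
    rcases sgn_cases i with h | h <;> simp only [h, one_smul, neg_smul, neg_neg] <;>
      rw [← neg_eq_zero, ← h₂] <;> change - (P.act _ (P.act _ (P.act _ (f.1.2.2 _ _ _ _))) - _ - _)
        = _ <;> abel

variable (M P) in
/-- The operations on graded homomorphisms. -/
def internalHomCore : CRTCore.{u} where
  obj := homObj M P
  eps := epsHom M P
  zeta := zetaHom M P
  gamma := gammaHom M P
  tau := tauHom M P
  betaO := betaOHom M P
  betaU := betaUHom M P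
  betaT := betaTHom M P
  betaO_bijective := betaOHom_bijective M P
  betaU_bijective := betaUHom_bijective M P
  betaT_bijective := betaTHom_bijective M P
  r_c i a h h' f := r_c_hom h h' f
  gamma_c_tau i a b h h' h₁ h₂ f := gamma_c_tau_hom h h' h₁ h₂ f
  zeta_gamma i a h f := rfl
  c_r_betaU i j a b h h₁ h₂ h₃ h₄ f := c_r_betaU_hom h h₁ h₂ h₃ h₄ f
  eps_betaO i a j h h₁ h₂ f := by
    apply selfConjHom_ext <;> intro m n hn x
    · change (realBetaO i j h f.1).2.2 m n hn x =
        (selfConjBetaT a j h₂ (selfConjBetaT i a h₁ (realEps i f.1))).1 m n hn x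
      rw [realBetaO_T h _ (b := n - 8) (by omega) (by omega),
        selfConjBetaT_T h₂ _ (b := n - 4) (by omega) (by omega),
        selfConjBetaT_T h₁ _ (b := n - 8) (by omega) (by omega),
        betaT2_apply _ (a := n - 4) (by omega) (by omega)]
      rfl
    · change (realBetaO i j h f.1).2.1 m n hn x =
        (selfConjBetaT a j h₂ (selfConjBetaT i a h₁ (realEps i f.1))).2.1 m n hn x
      rw [realBetaO_U h _ (b := n - 8) (by omega) (by omega),
        selfConjBetaT_U h₂ _ (b := n - 4) (by omega) (by omega),
        selfConjBetaT_U h₁ _ (b := n - 8) (by omega) (by omega),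
        betaU4_apply _ (a := n - 4) (by omega) (by omega)]
      rfl
    · change 0 = (selfConjBetaT a j h₂ (selfConjBetaT i a h₁ (realEps i f.1))).2.2 m n hn x
      rw [selfConjBetaT_U' h₂ _ (b := n - 4) (by omega) (by omega),
        selfConjBetaT_U' h₁ _ (b := n - 8) (by omega) (by omega)]
      simp [realEps]
  zeta_betaT i a j h h₁ h₂ f := by
    apply complexHom_ext
    intro m n hn x
    change (selfConjBetaT i j h f.1).2.1 m n hn x =
      complexBetaU a j h₂ (complexBetaU i a h₁ f.1.2.1) m n hn x
    rw [selfConjBetaT_U h _ (b := n - 4) (by omega) (by omega),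
      complexBetaU_apply h₂ _ (b := n - 2) (by omega) (by omega),
      complexBetaU_apply h₁ _ (b := n - 4) (by omega) (by omega),
      betaU2_apply _ (a := n - 2) (by omega) (by omega)]
  gamma_betaU i a j b k h₁ h₂ h₃ h₄ h₅ f := gamma_betaU_hom h₁ h₂ h₃ h₄ h₅ f
  tau_betaT i a j b k h₁ h₂ h₃ h₄ h₅ f := tau_betaT_hom h₁ h₂ h₃ h₄ h₅ f
  betaT_eps_tau i a j b c h₁ h₂ h₃ h₄ h₅ h₆ f := betaT_eps_tau_hom h₁ h₂ h₃ h₄ h₅ h₆ f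
  tau_betaT_eps i a j h h' f := tau_betaT_eps_hom h h' f

end

end CRTModule

/-! ### The evaluation pairing and the currying of pairings -/

namespace CRTModule

section

variable (M P : CRTModule.{u})

/-- The CRT-module of graded homomorphisms from `M` to `P`. -/
noncomputable def internalHom : CRTModule.{u} := (internalHomCore M P).toModule

variable {M P}

/-- The evaluation of graded homomorphisms. -/
def evalDot : ∀ {X : CRTPart} {i j k : ℤ}, i + j = k → (internalHom M P).obj X i → M.obj X j →
    P.obj X k
  | .O, _, j, k, h, f, m => Subtype.val (p := (· ∈ realHom M P _)) f |>.1 j k h m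
  | .U, _, j, k, h, f, m => Subtype.val (p := (· ∈ complexHom M P _)) f j k h m
  | .T, _, j, k, h, f, m => Subtype.val (p := (· ∈ selfConjHom M P _)) f |>.1 j k h m

theorem smul_sgn_smul {A : Type*} [AddCommGroup A] (i : ℤ) (x : A) : sgn i • sgn i • x = x := by
  rcases sgn_cases i with h | h <;> simp [h]

/-- The operations and conditions on graded homomorphisms were read off from the axioms of a
pairing. Compatibility on the left variable is therefore mostly the definition of an operation, and
on the right variable mostly a condition in `IsRealHom`, `IsComplexHom` or `IsSelfConjHom`. -/
theorem isPairing_evalDot : IsPairing (internalHom M P) M P evalDot where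
  add_left := by rintro (_ | _ | _) i j k h l l' m <;> rfl
  add_right := by rintro (_ | _ | _) i j k h l m m' <;> exact map_add _ _ _
  betaO_left h l m := (realBetaO_O rfl _ h rfl m).symm
  betaO_right {i j k} h l m := by
    have hl : IsRealHom M P i (Subtype.val (p := (· ∈ realHom M P _)) l) := l.2
    exact (hl.betaO j k h _ _ _ _ rfl m).symm
  betaU_left {i j k} h l m :=
    (complexBetaU_apply (f := Subtype.val (p := (· ∈ complexHom M P _)) l) rfl (by omega) h rfl
      m).symm
  betaU_right {i j k} h l m := by
    have hl : IsComplexHom M P i (Subtype.val (p := (· ∈ complexHom M P _)) l) := l.2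
    exact (hl j k h _ _ _ _ rfl m).symm
  betaT_left h l m := (selfConjBetaT_T rfl _ h rfl m).symm
  betaT_right {i j k} h l m := by
    have hl : IsSelfConjHom M P i (Subtype.val (p := (· ∈ selfConjHom M P _)) l) := l.2
    exact (hl.betaT j k h _ _ _ _ rfl m).symm
  c_dot {i j k} h l m := by
    have hl : IsRealHom M P i (Subtype.val (p := (· ∈ realHom M P _)) l) := l.2
    exact (hl.c j k h m).symm
  r_left {i j k} h l m := by
    have hl : IsRealHom M P i (Subtype.val (p := (· ∈ realHom M P _)) l) := l.2
    exact (hl.r j k h m).symm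
  r_right {i j k} h l m := by
    let f : complexHom M P i := l
    change P.act (.r k) (f.1 j k h (M.act (.c j) m)) =
      (selfConjTau (i - 1) i (by omega) (complexGamma i (i - 1) rfl f.1)).1 j k h m
    rw [selfConjTau_O _ h (b := k - 1) (by omega) (by omega), complexGamma_T _ _ h rfl, tau_gamma,
      zeta_eps]
  eps_dot {i j k} h l m := by
    have hl : IsRealHom M P i (Subtype.val (p := (· ∈ realHom M P _)) l) := l.2
    exact (hl.eps j k h m).symm
  zeta_dot {i j k} h l m := by
    have hl : IsSelfConjHom M P i (Subtype.val (p := (· ∈ selfConjHom M P _)) l) := l.2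
    exact (hl.zeta j k h m).symm
  psiU_dot {i j k} h l m := by
    let f : complexHom M P i := l
    change P.act (.psiU k) (f.1 j k h m) =
      (complexGamma i (i - 1) rfl f.1).2.2 j k (by omega) (M.act (.psiU j) m) +
        - f.1 j k h (M.act (.psiU j) m)
    rw [complexGamma_U' _ _ h, psiU_psiU']
    abel
  psiT_dot {i j k} h l m := by
    let f : selfConjHom M P i := l
    have hf : IsSelfConjHom M P i f.1 := f.2
    change P.act (.psiT k) (f.1.1 j k h m) =
      (selfConjTau (i - 1) i (by omega) (complexGamma i (i - 1) rfl f.1.2.1)).2.2 j k h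
        (M.act (.psiT j) m) + - f.1.1 j k h (M.act (.psiT j) m)
    rw [selfConjTau_T _ h (b := k - 1) (a' := j + 1) (by omega) (by omega) rfl (by omega),
      complexGamma_T _ _ h (by omega), tau_gamma, etaT_gamma,
      complexGamma_T _ _ (b := k + 1) (by omega) (by omega), zeta_psiT, zeta_eps, hf.zeta,
      tau_psiT', map_neg, map_neg, map_neg, sgn_pred (rfl : i - 1 = i - 1), smul_neg, neg_smul,
      neg_neg, sub_zero, ← hf.gamma (j + 1) (k + 1) (by omega) j k h (by omega) (by omega),
      gamma_c_tau', map_sub, P.eps_r_zeta]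
    abel
  gamma_right {i j k} h l m := (complexGamma_T rfl _ h rfl m).symm
  gamma_left {i j k} h l m := by
    let f : selfConjHom M P i := l
    have hf : IsSelfConjHom M P i f.1 := f.2
    change P.act (.gamma k (k - 1)) (f.1.2.1 j k h m) =
      sgn i • f.1.1 (j - 1) (k - 1) (by omega) (M.act (.gamma j (j - 1)) m)
    rw [hf.gamma j k h _ _ _ _ rfl, smul_sgn_smul]
  tau_right h l m := (selfConjTau_O rfl _ h rfl m).symm
  tau_left {i j k} h l m := by
    let f : realHom M P i := l
    have hf : IsRealHom M P i f.1 := f.2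
    change P.act (.tau k (k + 1)) (f.1.2.2 j k h m) =
      sgn i • f.1.1 (j + 1) (k + 1) (by omega) (M.act (.tau j (j + 1)) m)
    rw [hf.tau j k h _ _ _ _ rfl, smul_sgn_smul]
  eps_tau_dot {i j k} h l m := by
    let f : selfConjHom M P i := l
    change P.act (.eps (k + 1)) (P.act (.tau k (k + 1)) (f.1.1 j k h m)) =
      (selfConjTau i (i + 1) rfl f.1).2.2 j (k + 1) (by omega) m +
      sgn i • f.1.1 (j + 1) (k + 1) (by omega)
        (M.act (.eps (j + 1)) (M.act (.tau j (j + 1)) m)) + P.etaT k (k + 1) rfl (f.1.1 j k h m)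
    rw [selfConjTau_T _ _ h rfl rfl (by omega)]
    abel

end

section curry

variable {L M P : CRTModule.{u}}
  {dot : ∀ {X : CRTPart} {i j k : ℤ}, i + j = k → L.obj X i → M.obj X j → P.obj X k}

namespace IsPairing

/-- The family of maps `m ↦ l · m`. -/
def fam (hd : IsPairing L M P dot) {X : CRTPart} {i : ℤ} (l : L.obj X i) : Fam M P X i :=
  fun _ _ h => AddMonoidHom.mk' (fun m => dot h l m) (hd.add_right h l)

theorem fam_apply (hd : IsPairing L M P dot) {X : CRTPart} {i j k : ℤ} (l : L.obj X i)
    (h : i + j = k) (m : M.obj X j) :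
    hd.fam l j k h m = dot h l m := rfl

theorem fam_add (hd : IsPairing L M P dot) {X : CRTPart} {i : ℤ} (l l' : L.obj X i) :
    hd.fam (l + l') = hd.fam l + hd.fam l' := by
  funext j k h
  exact AddMonoidHom.ext fun m => hd.add_left h l l' m

theorem fam_zero (hd : IsPairing L M P dot) {X : CRTPart} {i : ℤ} : hd.fam (0 : L.obj X i) = 0 := by
  have := hd.fam_add (0 : L.obj X i) 0
  rwa [add_zero, left_eq_add] at this

theorem zero_left (hd : IsPairing L M P dot) {X : CRTPart} {i j k : ℤ} (h : i + j = k)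
    (m : M.obj X j) :
    dot h (0 : L.obj X i) m = 0 :=
  congrArg (fun f : Fam M P X i => f j k h m) hd.fam_zero

theorem gamma_left' (hd : IsPairing L M P dot) {i j k j' k' : ℤ} (h : i + j = k) (hj : j' = j - 1)
    (hk : k' = k - 1)
    (h' : i + j' = k') (l : L.obj .T i) (m : M.obj .U j) :
    P.act (.gamma k k' hk) (dot h (L.act (.zeta i) l) m) =
      sgn i • dot h' l (M.act (.gamma j j' hj) m) := by
  subst hj hk; exact hd.gamma_left h l m

theorem eps_tau_dot' (hd : IsPairing L M P dot) {i j k i' j' k' : ℤ} (h : i + j = k)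
    (hi : i' = i + 1) (hj : j' = j + 1)
    (hk : k' = k + 1) (h₁ : i' + j = k') (h₂ : i + j' = k') (l : L.obj .T i) (m : M.obj .T j) :
    P.act (.eps k') (P.act (.tau k k' hk) (dot h l m)) =
      dot h₁ (L.act (.eps i') (L.act (.tau i i' hi) l)) m +
      sgn i • dot h₂ l (M.act (.eps j') (M.act (.tau j j' hj) m)) + P.etaT k k' hk (dot h l m) := by
  subst hi hj hk; exact hd.eps_tau_dot h l m

theorem isRealHom (hd : IsPairing L M P dot) {i : ℤ} (l : L.obj .O i) :
    IsRealHom M P i (hd.fam l, hd.fam (L.act (.c i) l), hd.fam (L.act (.eps i) l)) := by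
  constructor
  · rintro j k h _ _ h' rfl rfl x
    exact (hd.betaO_right h l x).symm
  · rintro j k h _ _ h' rfl rfl x
    exact (hd.betaU_right h _ x).symm
  · rintro j k h _ _ h' rfl rfl x
    exact (hd.betaT_right h _ x).symm
  · intro j k h x
    exact (hd.eps_dot h l x).symm
  · intro j k h x
    have := hd.zeta_dot h (L.act (.eps i) l) x
    rw [zeta_eps] at this
    exact this.symm
  · rintro j k h _ _ h' rfl rfl x
    have := hd.gamma_left h (L.act (.eps i) l) x
    rw [zeta_eps] at this
    change dot _ _ _ = _ • P.act _ (dot _ _ _)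
    rw [this]
    exact (smul_sgn_smul _ _).symm
  · rintro j k h _ _ h' rfl rfl x
    have := hd.tau_left h l x
    change dot _ _ _ = _ • P.act _ (dot _ _ _)
    rw [this]
    exact (smul_sgn_smul _ _).symm

theorem isComplexHom (hd : IsPairing L M P dot) {i : ℤ} (l : L.obj .U i) :
    IsComplexHom M P i (hd.fam l) := by
  rintro j k h _ _ h' rfl rfl x
  exact (hd.betaU_right h _ x).symm

theorem isSelfConjHom (hd : IsPairing L M P dot) {i : ℤ} (l : L.obj .T i) :
    IsSelfConjHom M P i (hd.fam l,
    hd.fam (L.act (.zeta i) l), hd.fam (L.act (.c (i + 1)) (L.act (.tau i (i + 1)) l))) := by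
  constructor
  · rintro j k h _ _ h' rfl rfl x
    exact (hd.betaT_right h _ x).symm
  · exact hd.isComplexHom _
  · exact hd.isComplexHom _
  · intro j k h x
    exact (hd.zeta_dot h _ x).symm
  · rintro j k h _ _ h' rfl rfl x
    have := hd.gamma_left h l x
    change dot _ _ _ = _ • P.act _ (dot _ _ _)
    rw [this]
    exact (smul_sgn_smul _ _).symm
  · intro j k h x
    have := hd.psiU_dot h (L.act (.zeta i) l) x
    rw [psiU_zeta'] at this
    exact this.symm
  · intro j k h x
    have := hd.psiU_dot h (L.act (.c (i + 1)) (L.act (.tau i (i + 1)) l)) x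
    rw [psiU_c] at this
    exact this.symm
  · rintro j k h _ h' rfl _ h'' rfl x
    -- `ζ` removes the `η_T` term, leaving an equation between `c τ (l · x)` and products of complex
    -- elements.
    have h₁ := congrArg (P.act (.zeta (k + 1))) (hd.eps_tau_dot h l x)
    rw [map_add, map_add, zeta_gamma', add_zero, zeta_eps, map_zsmul, hd.zeta_dot, hd.zeta_dot,
      zeta_eps, zeta_eps] at h₁
    exact eq_sub_of_add_eq h₁.symm
  · rintro j k h k' h' hk x
    obtain ⟨b, hb⟩ : ∃ b, b = j - 1 := ⟨_, rfl⟩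
    obtain ⟨c, hc⟩ : ∃ c, c = k - 1 := ⟨_, rfl⟩
    -- The formula for `ε τ` of a product is taken at `γ x`. By `h₂` and `h₃`, `l · γ x = (-1)^i γ
    -- (ζ l · x)` and `ε τ l · γ x = -(-1)^i γ (c τ l · x)`, and `η_T` vanishes on the first.
    have h₁ := hd.eps_tau_dot' (show i + b = c by omega) rfl (show j = b + 1 by omega)
      (show k = c + 1 by omega) (show i + 1 + b = k by omega) h l (M.act (.gamma j b hb) x)
    have h₂ := hd.gamma_left' h hb hc (by omega) l x
    have h₃ := hd.gamma_left' h' hb hk (by omega) (L.act (.eps (i + 1))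
      (L.act (.tau i (i + 1)) l)) x
    rw [zeta_eps, sgn_succ (show i + 1 = i + 1 from rfl)] at h₃
    rw [tau_gamma, ← smul_sgn_smul i (dot (show i + b = c by omega) l _), ← h₂, map_zsmul,
      map_zsmul, map_zsmul, tau_gamma, etaT_gamma, smul_zero, add_zero] at h₁
    change dot _ _ _ = P.act _ (P.act _ (dot _ _ _)) + P.act _ (dot _ _ _)
    rw [h₃, ← smul_sgn_smul i (P.act _ (P.act _ (dot _ _ _))), h₁, smul_add, smul_sgn_smul,
      neg_smul]
    abel

end IsPairing

end curry

end CRTModule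

namespace CRTModule

section curry

variable {L M P : CRTModule.{u}}
  {dot : ∀ {X : CRTPart} {i j k : ℤ}, i + j = k → L.obj X i → M.obj X j → P.obj X k}

namespace IsPairing

/-- The additive maps from the parts of `L` to the groups of graded homomorphisms given by a
pairing. -/
noncomputable def curryFun (hd : IsPairing L M P dot) : ∀ (X : CRTPart) (i : ℤ),
    L.obj X i →+ (internalHom M P).obj X i
  | .O, i => AddMonoidHom.mk' (fun l => (⟨_, hd.isRealHom l⟩ : realHom M P i)) fun l l' =>
      Subtype.ext (by simp only [map_add, hd.fam_add]; rfl)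
  | .U, i => AddMonoidHom.mk' (fun l => (⟨_, hd.isComplexHom l⟩ : complexHom M P i)) fun l l' =>
      Subtype.ext (by simp only [hd.fam_add]; rfl)
  | .T, i => AddMonoidHom.mk' (fun l => (⟨_, hd.isSelfConjHom l⟩ : selfConjHom M P i)) fun l l' =>
      Subtype.ext (by simp only [map_add, hd.fam_add]; rfl)

theorem gamma_right' (hd : IsPairing L M P dot) {i j k i' k' : ℤ} (h : i + j = k) (hi : i' = i - 1)
    (hk : k' = k - 1)
    (h' : i' + j = k') (l : L.obj .U i) (m : M.obj .T j) :
    P.act (.gamma k k' hk) (dot h l (M.act (.zeta j) m)) =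
      dot h' (L.act (.gamma i i' hi) l) m := by
  subst hi hk; exact hd.gamma_right h l m

theorem tau_right' (hd : IsPairing L M P dot) {i j k i' k' : ℤ} (h : i + j = k) (hi : i' = i + 1)
    (hk : k' = k + 1)
    (h' : i' + j = k') (l : L.obj .T i) (m : M.obj .O j) :
    P.act (.tau k k' hk) (dot h l (M.act (.eps j) m)) =
      dot h' (L.act (.tau i i' hi) l) m := by
  subst hi hk; exact hd.tau_right h l m

theorem betaO_left' (hd : IsPairing L M P dot) {i j k i' k' : ℤ} (h : i + j = k) (hi : i' = i + 8)
    (hk : k' = k + 8)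
    (h' : i' + j = k') (l : L.obj .O i) (m : M.obj .O j) :
    P.act (.betaO k k' hk) (dot h l m) = dot h' (L.act (.betaO i i' hi) l) m := by
  subst hi hk; exact hd.betaO_left h l m

theorem betaU_left' (hd : IsPairing L M P dot) {i j k i' k' : ℤ} (h : i + j = k) (hi : i' = i + 2)
    (hk : k' = k + 2)
    (h' : i' + j = k') (l : L.obj .U i) (m : M.obj .U j) :
    P.act (.betaU k k' hk) (dot h l m) = dot h' (L.act (.betaU i i' hi) l) m := by
  subst hi hk; exact hd.betaU_left h l m

theorem betaT_left' (hd : IsPairing L M P dot) {i j k i' k' : ℤ} (h : i + j = k) (hi : i' = i + 4)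
    (hk : k' = k + 4)
    (h' : i' + j = k') (l : L.obj .T i) (m : M.obj .T j) :
    P.act (.betaT k k' hk) (dot h l m) = dot h' (L.act (.betaT i i' hi) l) m := by
  subst hi hk; exact hd.betaT_left h l m

theorem betaU2_left (hd : IsPairing L M P dot) {i j k i' k' : ℤ} (h : i + j = k) (hi : i' = i + 4)
    (hk : k' = k + 4)
    (h' : i' + j = k') (l : L.obj .U i) (m : M.obj .U j) :
    P.betaU2 k k' hk (dot h l m) = dot h' (L.betaU2 i i' hi l) m := by
  rw [betaU2_apply (a := k + 2) _ rfl (by omega), betaU2_apply (a := i + 2) _ rfl (by omega),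
    hd.betaU_left' h rfl rfl (by omega), hd.betaU_left' _ (by omega) (by omega) h']

theorem curryFun_eps (hd : IsPairing L M P dot) (i : ℤ) (l : L.obj .O i) :
    hd.curryFun .T i (L.act (.eps i) l) =
    (internalHom M P).act (.eps i) (hd.curryFun .O i l) := by
  refine selfConjHom_ext (M := M) (P := P) ?_ ?_ ?_ <;> intro j k h x
  · rfl
  · change dot h (L.act _ (L.act _ l)) x = dot h (L.act _ l) x
    rw [zeta_eps]
  · change dot h (L.act _ (L.act _ (L.act _ l))) x = 0
    rw [c_tau_eps, hd.zero_left]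

theorem curryFun_gamma (hd : IsPairing L M P dot) (i a : ℤ) (hi : a = i - 1) (l : L.obj .U i) :
    hd.curryFun .T a (L.act (.gamma i a hi) l) =
      (internalHom M P).act (.gamma i a hi) (hd.curryFun .U i l) := by
  refine selfConjHom_ext (M := M) (P := P) ?_ ?_ ?_ <;> intro j k h x
  · change _ = (complexGamma i a hi (hd.fam l)).1 j k h x
    rw [complexGamma_T hi h (b := k + 1) (by omega) (by omega)]
    exact (hd.gamma_right' (by omega) hi (by omega) h l x).symm
  · change dot h (L.act _ (L.act _ l)) x = 0
    rw [zeta_gamma', hd.zero_left]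
  · change _ = (complexGamma i a hi (hd.fam l)).2.2 j k h x
    obtain rfl : i = a + 1 := by omega
    rw [complexGamma_U' hi h (by omega), fam_apply, fam_apply, hd.psiU_dot, psiU_psiU',
      ← hd.add_left, ← L.c_r, ← tau_gamma hi]
    rfl

theorem curryFun_tau (hd : IsPairing L M P dot) (i a : ℤ) (hi : a = i + 1) (l : L.obj .T i) :
    hd.curryFun .O a (L.act (.tau i a hi) l) =
      (internalHom M P).act (.tau i a hi) (hd.curryFun .T i l) := by
  refine realHom_ext (M := M) (P := P) ?_ ?_ ?_ <;> intro j k h x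
  · change _ = (selfConjTau i a hi (hd.curryFun .T i l).1).1 j k h x
    rw [selfConjTau_O hi h (b := k - 1) (by omega) (by omega)]
    exact (hd.tau_right' (by omega) hi (by omega) h l x).symm
  · subst hi
    rfl
  · change _ = (selfConjTau i a hi (hd.curryFun .T i l).1).2.2 j k h x
    rw [selfConjTau_T hi h (b := k - 1) (a' := j + 1) (by omega) (by omega) rfl (by omega)]
    have := hd.eps_tau_dot' (show i + j = k - 1 by omega) hi (show j + 1 = j + 1 from rfl)
      (show k = k - 1 + 1 by omega) h (by omega) l x
    change dot _ _ _ = P.act _ (P.act _ (dot _ _ _)) - sgn i • dot _ _ _ - P.etaT _ _ _ (dot _ _ _)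
    rw [this]
    abel

theorem curryFun_betaO (hd : IsPairing L M P dot) (i a : ℤ) (hi : a = i + 8) (l : L.obj .O i) :
    hd.curryFun .O a (L.act (.betaO i a hi) l) =
      (internalHom M P).act (.betaO i a hi) (hd.curryFun .O i l) := by
  refine realHom_ext (M := M) (P := P) ?_ ?_ ?_ <;> intro j k h x
  · change _ = (realBetaO i a hi (hd.curryFun .O i l).1).1 j k h x
    rw [realBetaO_O hi h (b := k - 8) (by omega) (by omega)]
    exact (hd.betaO_left' (by omega) hi (by omega) h l x).symm
  · change dot h _ x = (realBetaO i a hi (hd.curryFun .O i l).1).2.1 j k h x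
    rw [realBetaO_U hi h (b := k - 8) (by omega) (by omega),
      betaU4_apply (a := k - 4) _ (by omega) (by omega),
      c_betaO hi (a := i + 2) (b := i + 4) (c := i + 6) rfl (by omega) (by omega) (by omega),
      ← betaU2_apply (by omega), ← betaU2_apply (by omega),
      ← hd.betaU2_left (k := k - 4) (by omega),
      ← hd.betaU2_left (k := k - 8)]
    rfl
  · change dot h _ x = (realBetaO i a hi (hd.curryFun .O i l).1).2.2 j k h x
    rw [realBetaO_T hi h (b := k - 8) (by omega) (by omega),
      betaT2_apply (a := k - 4) _ (by omega) (by omega),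
      eps_betaO' hi (a := i + 4) (by omega) (by omega), ← hd.betaT_left' (k := k - 4) (by omega),
      ← hd.betaT_left' (k := k - 8)]
    rfl

theorem curryFun_betaU (hd : IsPairing L M P dot) (i a : ℤ) (hi : a = i + 2) (l : L.obj .U i) :
    hd.curryFun .U a (L.act (.betaU i a hi) l) =
      (internalHom M P).act (.betaU i a hi) (hd.curryFun .U i l) := by
  refine complexHom_ext (M := M) (P := P) ?_
  intro j k h x
  change dot h _ x = complexBetaU i a hi (hd.fam l) j k h x
  rw [complexBetaU_apply hi h (b := k - 2) (by omega) (by omega)]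
  exact (hd.betaU_left' (by omega) hi (by omega) h l x).symm

theorem curryFun_betaT (hd : IsPairing L M P dot) (i a : ℤ) (hi : a = i + 4) (l : L.obj .T i) :
    hd.curryFun .T a (L.act (.betaT i a hi) l) =
      (internalHom M P).act (.betaT i a hi) (hd.curryFun .T i l) := by
  refine selfConjHom_ext (M := M) (P := P) ?_ ?_ ?_ <;> intro j k h x
  · change dot h _ x = (selfConjBetaT i a hi (hd.curryFun .T i l).1).1 j k h x
    rw [selfConjBetaT_T hi h (b := k - 4) (by omega) (by omega)]
    exact (hd.betaT_left' (by omega) hi (by omega) h l x).symm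
  · change dot h _ x = (selfConjBetaT i a hi (hd.curryFun .T i l).1).2.1 j k h x
    rw [selfConjBetaT_U hi h (b := k - 4) (by omega) (by omega), zeta_betaT_eq_betaU2]
    exact (hd.betaU2_left (by omega) hi (by omega) h _ x).symm
  · change dot h _ x = (selfConjBetaT i a hi (hd.curryFun .T i l).1).2.2 j k h x
    rw [selfConjBetaT_U' hi h (b := k - 4) (by omega) (by omega),
      c_tau_betaT_eq (a := i + 1) rfl _ _ (by omega)]
    exact (hd.betaU2_left (by omega) (by omega) (by omega) h _ x).symm

/-- The homomorphism to the CRT-module of graded homomorphisms given by a pairing. -/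
noncomputable def curry (hd : IsPairing L M P dot) : L ⟶ internalHom M P :=
  homOfBasic hd.curryFun hd.curryFun_eps (fun _ _ => rfl) hd.curryFun_gamma hd.curryFun_tau
    hd.curryFun_betaO hd.curryFun_betaU hd.curryFun_betaT

theorem evalDot_curry (hd : IsPairing L M P dot) {X : CRTPart} {i j k : ℤ} (h : i + j = k)
    (l : L.obj X i) (m : M.obj X j) :
    evalDot h (hd.curry.app X i l) m = dot h l m := by
  cases X <;> rfl

/-- Composing a pairing with a homomorphism. -/
theorem postcomp (hd : IsPairing L M P dot) {Q : CRTModule.{u}} (g : P ⟶ Q) :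
    IsPairing L M Q fun {X _ _ k} h l m => g.app X k (dot h l m) where
  add_left h l l' m := by rw [hd.add_left, map_add]
  add_right h l m m' := by rw [hd.add_right, map_add]
  betaO_left h l m := by rw [← g.comm, hd.betaO_left]
  betaO_right h l m := by rw [← g.comm, hd.betaO_right]
  betaU_left h l m := by rw [← g.comm, hd.betaU_left]
  betaU_right h l m := by rw [← g.comm, hd.betaU_right]
  betaT_left h l m := by rw [← g.comm, hd.betaT_left]
  betaT_right h l m := by rw [← g.comm, hd.betaT_right]
  c_dot h l m := by rw [← g.comm, hd.c_dot]
  r_left h l m := by rw [← g.comm, hd.r_left]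
  r_right h l m := by rw [← g.comm, hd.r_right]
  eps_dot h l m := by rw [← g.comm, hd.eps_dot]
  zeta_dot h l m := by rw [← g.comm, hd.zeta_dot]
  psiU_dot h l m := by rw [← g.comm, hd.psiU_dot]
  psiT_dot h l m := by rw [← g.comm, hd.psiT_dot]
  gamma_right h l m := by rw [← g.comm, hd.gamma_right]
  gamma_left h l m := by rw [← g.comm, hd.gamma_left, map_zsmul]
  tau_right h l m := by rw [← g.comm, hd.tau_right]
  tau_left h l m := by rw [← g.comm, hd.tau_left, map_zsmul]
  eps_tau_dot h l m := by
    rw [← g.comm, ← g.comm, hd.eps_tau_dot, map_add, map_add, map_zsmul, g.comm (.gamma _ _),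
      g.comm (.betaU _ _), g.comm (.zeta _)]

end IsPairing

end curry

/-! ### `Hom_CRT(M, N)` as the CRT-module of graded homomorphisms -/

section

variable {M N : CRTModule.{u}}

/-- The product `α · m = α (b ⊗ m)`. -/
def homDot {X : CRTPart} {i j k : ℤ} (h : i + j = k) (α : (CRTHom M N).obj X i) (m : M.obj X j) :
    N.obj X k := Hom.app (M := tensor (free X i) M) α X k (tmul h (freeGen X i) m)

theorem act_homDot {X : CRTPart} {i : ℤ} {Y : CRTPart} {j k k' : ℤ} (θ : CRTOp X k Y k')
    (h : i + j = k) (α : (CRTHom M N).obj X i) (m : M.obj X j) :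
    N.act θ (homDot h α m) = Hom.app (M := tensor (free X i) M) α Y k'
      ((tensor (free X i) M).act θ (tmul h (freeGen X i) m)) :=
  (Hom.comm (M := tensor (free X i) M) α θ _).symm

theorem homApp_act {X : CRTPart} {i : ℤ} {Y Z : CRTPart} {k k' : ℤ} (θ : CRTOp Y k Z k')
    (α : (CRTHom M N).obj X i) (z : (tensor (free X i) M).obj Y k) :
    Hom.app (M := tensor (free X i) M) α Z k' ((tensor (free X i) M).act θ z) =
      N.act θ (Hom.app (M := tensor (free X i) M) α Y k z) :=
  Hom.comm (M := tensor (free X i) M) α θ z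

/-- Both sides of each axiom are values of `α` on elements of `F(b, i, X) ⊗ M`, where the universal
pairing satisfies the axiom. Since `μ_θ ⊗ 1` carries the generator tensor to `θ b ⊗ m`, the product
of `θ α` with `m` is `α (θ b ⊗ m)` by definition. -/
theorem isPairing_homDot : IsPairing (CRTHom M N) M N homDot where
  add_left h l l' m := rfl
  add_right h l m m' := by
    unfold homDot
    rw [(isPairing_tmul _ _).add_right, map_add]
  betaO_left h l m := by rw [act_homDot, (isPairing_tmul _ _).betaO_left]; rfl
  betaO_right h l m := by rw [act_homDot, (isPairing_tmul _ _).betaO_right]; rfl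
  betaU_left h l m := by rw [act_homDot, (isPairing_tmul _ _).betaU_left]; rfl
  betaU_right h l m := by rw [act_homDot, (isPairing_tmul _ _).betaU_right]; rfl
  betaT_left h l m := by rw [act_homDot, (isPairing_tmul _ _).betaT_left]; rfl
  betaT_right h l m := by rw [act_homDot, (isPairing_tmul _ _).betaT_right]; rfl
  c_dot h l m := by rw [act_homDot, (isPairing_tmul _ _).c_dot]; rfl
  r_left h l m := by
    refine (Hom.comm (M := tensor (free _ _) M) l _ _).symm.trans ?_
    exact congrArg (Hom.app (M := tensor (free _ _) M) l _ _)
      ((isPairing_tmul _ _).r_left h (freeGen .O _) m)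
  r_right h l m := by rw [act_homDot, (isPairing_tmul _ _).r_right]; rfl
  eps_dot h l m := by rw [act_homDot, (isPairing_tmul _ _).eps_dot]; rfl
  zeta_dot h l m := by rw [act_homDot, (isPairing_tmul _ _).zeta_dot]; rfl
  psiU_dot h l m := by rw [act_homDot, (isPairing_tmul _ _).psiU_dot]; rfl
  psiT_dot h l m := by rw [act_homDot, (isPairing_tmul _ _).psiT_dot]; rfl
  gamma_right h l m := by rw [act_homDot, (isPairing_tmul _ _).gamma_right]; rfl
  gamma_left h l m := by
    refine (Hom.comm (M := tensor (free _ _) M) l _ _).symm.trans ?_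
    refine (congrArg (Hom.app (M := tensor (free _ _) M) l _ _)
      ((isPairing_tmul _ _).gamma_left h (freeGen .T _) m)).trans ?_
    exact map_zsmul _ _ _
  tau_right h l m := by rw [act_homDot, (isPairing_tmul _ _).tau_right]; rfl
  tau_left h l m := by
    refine (Hom.comm (M := tensor (free _ _) M) l _ _).symm.trans ?_
    refine (congrArg (Hom.app (M := tensor (free _ _) M) l _ _)
      ((isPairing_tmul _ _).tau_left h (freeGen .O _) m)).trans ?_
    exact map_zsmul _ _ _
  eps_tau_dot {i j k} h l m := by
    have h₁ := congrArg (Hom.app (M := tensor (free _ _) M) l _ _)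
      ((isPairing_tmul _ _).eps_tau_dot h (freeGen .T i) m)
    rw [map_add, map_add, map_zsmul] at h₁
    rw [homApp_act, homApp_act, homApp_act, homApp_act, homApp_act] at h₁
    exact h₁

variable (M N) in
/-- The comparison of `Hom_CRT(M, N)` with the CRT-module of graded homomorphisms. -/
noncomputable def homComparison : CRTHom M N ⟶ internalHom M N := isPairing_homDot.curry

/-- The point of this form is that the curried homomorphism `F(b, i, X) ⟶ internalHom M N` knows all
of `α`, and is itself determined by its value at the generator. -/
theorem homComparison_eq {X : CRTPart} {i : ℤ} (α : (CRTHom M N).obj X i) :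
    (homComparison M N).app X i α =
      ((isPairing_tmul (free X i) M).postcomp (Q := N) α).curry.app X i (freeGen X i) := by
  cases X <;> rfl

theorem homComparison_injective (X : CRTPart) (i : ℤ) :
    Function.Injective ((homComparison M N).app X i) := by
  intro α α' h
  rw [homComparison_eq, homComparison_eq] at h
  -- The curried homomorphisms agree at the generator, hence everywhere; evaluating them recovers
  -- `α` and `α'` on every `l ⊗ m`.
  have := free_ext h
  apply tensor_ext
  intro Y a j k hk l m
  rw [← ((isPairing_tmul (free X i) M).postcomp α).evalDot_curry hk, this]
  exact ((isPairing_tmul (free X i) M).postcomp α').evalDot_curry hk l m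

theorem homComparison_surjective (X : CRTPart) (i : ℤ) :
    Function.Surjective ((homComparison M N).app X i) := by
  intro f
  -- The preimage is evaluation, pulled back along the homomorphism from the free CRT-module that
  -- carries the generator to `f`.
  refine ⟨tensorLift (isPairing_evalDot.precomp (freeLift f)), ?_⟩
  cases X <;> rfl

end

end CRTModule

namespace CRTModule

/-! ### Extending graded homomorphisms into an injective CRT-module -/

theorem mono_of_injective {M N : CRTModule.{u}} (f : M ⟶ N)
    (hf : ∀ X i, Function.Injective (f.app X i)) : Mono f :=
  ⟨fun g h e => hom_ext fun X i x => hf X i <| by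
    rw [← comp_app, ← comp_app, e]⟩

/-! ### Factorization through the coimage -/

section coimage

variable {M N : CRTModule.{u}} (f : M ⟶ N)

/-- The quotient of a CRT-module by the kernel of a homomorphism. -/
def coimage : CRTModule.{u} where
  obj X i := M.obj X i ⧸ (f.app X i).ker
  act θ := QuotientAddGroup.map _ _ (M.act θ) fun x hx => by
    rw [AddSubgroup.mem_comap, AddMonoidHom.mem_ker, f.comm, AddMonoidHom.mem_ker.mp hx, map_zero]
  betaO_inv := by rintro i ⟨x⟩; exact congrArg _ (M.betaO_inv i x)
  inv_betaO := by rintro i ⟨x⟩; exact congrArg _ (M.inv_betaO i x)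
  betaU_inv := by rintro i ⟨x⟩; exact congrArg _ (M.betaU_inv i x)
  inv_betaU := by rintro i ⟨x⟩; exact congrArg _ (M.inv_betaU i x)
  betaT_inv := by rintro i ⟨x⟩; exact congrArg _ (M.betaT_inv i x)
  inv_betaT := by rintro i ⟨x⟩; exact congrArg _ (M.inv_betaT i x)
  r_c := by rintro i ⟨x⟩; exact congrArg _ (M.r_c i x)
  c_r := by rintro i ⟨x⟩; exact congrArg _ (M.c_r i x)
  r_eq := by rintro i ⟨x⟩; exact congrArg _ (M.r_eq i x)
  c_eq := by rintro i ⟨x⟩; exact congrArg _ (M.c_eq i x)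
  psiU_psiU := by rintro i ⟨x⟩; exact congrArg _ (M.psiU_psiU i x)
  psiT_psiT := by rintro i ⟨x⟩; exact congrArg _ (M.psiT_psiT i x)
  psiT_eps := by rintro i ⟨x⟩; exact congrArg _ (M.psiT_eps i x)
  zeta_gamma := by rintro i ⟨x⟩; exact congrArg _ (M.zeta_gamma i x)
  psiU_zeta := by rintro i ⟨x⟩; exact congrArg _ (M.psiU_zeta i x)
  psiU_betaU := by rintro i ⟨x⟩; exact congrArg _ (M.psiU_betaU i x)
  psiT_betaT := by rintro i ⟨x⟩; exact congrArg _ (M.psiT_betaT i x)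
  eps_betaO := by rintro i ⟨x⟩; exact congrArg _ (M.eps_betaO i x)
  zeta_betaT := by rintro i ⟨x⟩; exact congrArg _ (M.zeta_betaT i x)
  gamma_betaU := by rintro i ⟨x⟩; exact congrArg _ (M.gamma_betaU i x)
  tau_betaT := by rintro i ⟨x⟩; exact congrArg _ (M.tau_betaT i x)
  gamma_psiU := by rintro i ⟨x⟩; exact congrArg QuotientAddGroup.mk (M.gamma_psiU i x)
  betaT_eps_tau := by rintro i ⟨x⟩; exact congrArg _ (M.betaT_eps_tau i x)
  eps_r_zeta := by rintro i ⟨x⟩; exact congrArg _ (M.eps_r_zeta i x)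
  gamma_c_tau := by rintro i ⟨x⟩; exact congrArg _ (M.gamma_c_tau i x)
  tau_psiT := by rintro i ⟨x⟩; exact congrArg _ (M.tau_psiT i x)
  tau_betaT_eps := by rintro i ⟨x⟩; exact congrArg _ (M.tau_betaT_eps i x)
  eps_xi := by rintro i ⟨x⟩; exact congrArg _ (M.eps_xi i x)
  xi_tau := by rintro i ⟨x⟩; exact congrArg _ (M.xi_tau i x)

/-- A homomorphism which vanishes on the kernel of `f` descends to the coimage of `f`. -/
def coimageLift {P : CRTModule.{u}} (g : M ⟶ P)
    (hg : ∀ X i x, f.app X i x = 0 → g.app X i x = 0) : coimage f ⟶ P where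
  app X i := QuotientAddGroup.lift _ (g.app X i) fun x hx => hg X i x hx
  comm := by rintro X i Y j θ ⟨x⟩; exact g.comm θ x

instance : Mono (coimageLift f f fun _ _ _ h => h) :=
  mono_of_injective _ fun X i => QuotientAddGroup.kerLift_injective (f.app X i)

/-- Homomorphisms to an injective CRT-module extend along homomorphisms with a smaller kernel. -/
theorem exists_comp_eq_of_injective {P : CRTModule.{u}} [Injective P] (g : M ⟶ P)
    (hg : ∀ X i x, f.app X i x = 0 → g.app X i x = 0) : ∃ h : N ⟶ P, f ≫ h = g := by
  -- `g` descends to the quotient of `M` by the kernel of `f`, and this quotient embeds in `N`;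
  -- injectivity of `P` extends the descended map over `N`.
  obtain ⟨h, hh⟩ := Injective.factors (coimageLift f g hg) (coimageLift f f fun _ _ _ h => h)
  exact ⟨h, hom_ext fun X i x =>
    congrArg (fun k : coimage f ⟶ P => k.app X i (QuotientAddGroup.mk x)) hh⟩

end coimage

/-! ### Shifts, which reduce homomorphisms of degree d to degree 0 -/

section shift

variable (M : CRTModule.{u}) (d : ℤ)

/-- The shift of a CRT-module, by its basic operations. -/
def shiftCore : CRTCore.{u} where
  obj X k := M.obj X (k - d)
  eps i := M.act (.eps (i - d))
  zeta i := M.act (.zeta (i - d))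
  -- The odd operations are twisted by `(-1)^d`. This absorbs the sign in `IsRealHom`, so that
  -- homomorphisms of degree `d` out of `M` are honest homomorphisms out of the shift.
  gamma i j h := sgn d • M.act (.gamma (i - d) (j - d))
  tau i j h := sgn d • M.act (.tau (i - d) (j - d))
  betaO i j h := M.act (.betaO (i - d) (j - d))
  betaU i j h := M.act (.betaU (i - d) (j - d))
  betaT i j h := M.act (.betaT (i - d) (j - d))
  betaO_bijective _ _ _ := M.betaO_bijective _ _ _
  betaU_bijective _ _ _ := M.betaU_bijective _ _ _
  betaT_bijective _ _ _ := M.betaT_bijective _ _ _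
  r_c i a h h' x := by
    simp only [AddMonoidHom.coe_smul, Pi.smul_apply, map_zsmul, smul_sgn_smul, tau_gamma, zeta_eps,
      M.r_c, two_nsmul]
  gamma_c_tau i a b h h' h₁ h₂ x := by
    simp only [AddMonoidHom.coe_smul, Pi.smul_apply, map_zsmul, smul_sgn_smul, tau_gamma, zeta_eps,
      gamma_c_tau', M.eps_r_zeta]
    abel
  zeta_gamma i a h x := by
    simp only [AddMonoidHom.coe_smul, Pi.smul_apply, map_zsmul, zeta_gamma', smul_zero]
  c_r_betaU i j a b h h₁ h₂ h₃ h₄ x := by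
    simp only [AddMonoidHom.coe_smul, Pi.smul_apply, map_zsmul, smul_sgn_smul, tau_gamma, zeta_eps,
      c_r', map_add, psiU_betaU']
    abel
  eps_betaO i a j h h₁ h₂ x := eps_betaO' _ _ _ x
  zeta_betaT i a j h h₁ h₂ x := zeta_betaT' _ _ _ x
  gamma_betaU i a j b k h₁ h₂ h₃ h₄ h₅ x := by
    simp only [AddMonoidHom.coe_smul, Pi.smul_apply, map_zsmul]
    rw [gamma_betaU']
  tau_betaT i a j b k h₁ h₂ h₃ h₄ h₅ x := by
    simp only [AddMonoidHom.coe_smul, Pi.smul_apply, map_zsmul]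
    rw [tau_betaT']
  betaT_eps_tau i a j b c h₁ h₂ h₃ h₄ h₅ h₆ x := by
    simp only [AddMonoidHom.coe_smul, Pi.smul_apply, map_zsmul]
    rw [betaT_eps_tau' (b := b - d) _ _ (by omega) (by omega), smul_add,
      etaT_apply (a := c - d) _ (by omega) (by omega)]
  tau_betaT_eps i a j h h' x := by
    simp only [AddMonoidHom.coe_smul, Pi.smul_apply, tau_betaT_eps', smul_zero]

/-- The shift of a CRT-module, whose part of degree `k` is the part of degree `k - d`. -/
noncomputable def shift : CRTModule.{u} := (M.shiftCore d).toModule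

variable {M d} {N : CRTModule.{u}}

/-- The homomorphism of degree `0` given by a homomorphism of degree `d`. -/
noncomputable def ofRealHom {f : Fam M N .O d × Fam M N .U d × Fam M N .T d}
    (hf : IsRealHom M N d f) : M.shift d ⟶ N :=
  homOfBasic
    (fun X k => match X with
      | .O => f.1 (k - d) k (by omega)
      | .U => f.2.1 (k - d) k (by omega)
      | .T => f.2.2 (k - d) k (by omega))
    (fun i x => hf.eps _ _ _ x) (fun i x => hf.zeta _ _ _ x)
    (fun i j h x => ((f.2.2 _ _ _).map_zsmul _ _).trans <|
      (congrArg (sgn d • ·) (hf.gamma (i - d) i (by omega) _ _ _ (by omega) h x)).trans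
        (smul_sgn_smul d _))
    (fun i j h x => ((f.1 _ _ _).map_zsmul _ _).trans <|
      (congrArg (sgn d • ·) (hf.tau (i - d) i (by omega) _ _ _ (by omega) h x)).trans
        (smul_sgn_smul d _))
    (fun i j h x => hf.betaO _ _ _ _ _ _ _ _ x) (fun i j h x => hf.betaU _ _ _ _ _ _ _ _ x)
    (fun i j h x => hf.betaT _ _ _ _ _ _ _ _ x)

theorem smul_sgn_smul_eq {A : Type*} [AddCommGroup A] {d e i : ℤ} (h : e + d = i) (x : A) :
    sgn i • sgn d • x = sgn e • x := by
  rw [← h, sgn_add, mul_smul, smul_sgn_smul]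

/-- The homomorphism of degree `0` between shifts given by a homomorphism of degree `d`. -/
noncomputable def shiftRealHom {f : Fam M N .O d × Fam M N .U d × Fam M N .T d}
    (hf : IsRealHom M N d f) (i e : ℤ) (h : e + d = i) : M.shift i ⟶ N.shift e :=
  homOfBasic
    (fun X k => match X with
      | .O => f.1 (k - i) (k - e) (by omega)
      | .U => f.2.1 (k - i) (k - e) (by omega)
      | .T => f.2.2 (k - i) (k - e) (by omega))
    (fun _ x => hf.eps _ _ _ x) (fun _ x => hf.zeta _ _ _ x)
    (fun a j h₁ x => ((f.2.2 _ _ _).map_zsmul _ _).trans <|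
      (congrArg (sgn i • ·) (hf.gamma (a - i) (a - e) (by omega) _ _ _ (by omega)
        (by omega) x)).trans
        (smul_sgn_smul_eq h _))
    (fun a j h₁ x => ((f.1 _ _ _).map_zsmul _ _).trans <|
      (congrArg (sgn i • ·) (hf.tau (a - i) (a - e) (by omega) _ _ _ (by omega) (by omega) x)).trans
        (smul_sgn_smul_eq h _))
    (fun _ j h x => hf.betaO _ _ _ _ _ _ _ _ x) (fun _ j h x => hf.betaU _ _ _ _ _ _ _ _ x)
    (fun _ j h x => hf.betaT _ _ _ _ _ _ _ _ x)

/-- Transport along an equality of degrees. -/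
def castHom {X : CRTPart} {i j : ℤ} (h : i = j) : M.obj X i →+ M.obj X j :=
  h ▸ AddMonoidHom.id _

/-- The families of maps of degree `d` given by a homomorphism of degree `0` on the shift. -/
noncomputable def unshift (g : M.shift d ⟶ N) (X : CRTPart) : Fam M N X d :=
  fun j k h => AddMonoidHom.comp (show M.obj X (k - d) →+ N.obj X k from g.app X k)
    (castHom (show j = k - d by omega))

theorem isRealHom_unshift (g : M.shift d ⟶ N) :
    IsRealHom M N d (unshift g .O, unshift g .U, unshift g .T) := by
  constructor
  · intro j k h j' k' h' hj hk x
    obtain rfl : j = k - d := by omega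
    obtain rfl : j' = k' - d := by omega
    exact g.comm (.betaO k k' hk) x
  · intro j k h j' k' h' hj hk x
    obtain rfl : j = k - d := by omega
    obtain rfl : j' = k' - d := by omega
    exact g.comm (.betaU k k' hk) x
  · intro j k h j' k' h' hj hk x
    obtain rfl : j = k - d := by omega
    obtain rfl : j' = k' - d := by omega
    exact g.comm (.betaT k k' hk) x
  · intro j k h x
    obtain rfl : j = k - d := by omega
    exact g.comm (.eps k) x
  · intro j k h x
    obtain rfl : j = k - d := by omega
    exact g.comm (.zeta k) x
  · intro j k h j' k' h' hj hk x
    obtain rfl : j = k - d := by omega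
    obtain rfl : j' = k' - d := by omega
    have h₁ := congrArg (sgn d • ·) (g.comm (.gamma k k' hk) x)
    refine Eq.trans ?_ h₁
    refine Eq.trans ?_ ((g.app .T k').map_zsmul _ _)
    exact congrArg (g.app .T k') (smul_sgn_smul d (M.act (.gamma (k - d) (k' - d) hj) x)).symm
  · intro j k h j' k' h' hj hk x
    obtain rfl : j = k - d := by omega
    obtain rfl : j' = k' - d := by omega
    have h₁ := congrArg (sgn d • ·) (g.comm (.tau k k' hk) x)
    refine Eq.trans ?_ h₁
    refine Eq.trans ?_ ((g.app .O k').map_zsmul _ _)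
    exact congrArg (g.app .O k') (smul_sgn_smul d (M.act (.tau (k - d) (k' - d) hj) x)).symm

end shift

/-- Homomorphisms of degree `i` to an injective CRT-module extend along homomorphisms with a
smaller kernel. -/
theorem exists_realHom_comp_eq {A B N : CRTModule.{u}} [Injective N] {d e i : ℤ} (h : e + d = i)
    {p : Fam A B .O d × Fam A B .U d × Fam A B .T d} (hp : IsRealHom A B d p)
    {f : Fam A N .O i × Fam A N .U i × Fam A N .T i} (hf : IsRealHom A N i f)
    (hO : ∀ j k hk k' hk' x, p.1 j k hk x = 0 → f.1 j k' hk' x = 0)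
    (hU : ∀ j k hk k' hk' x, p.2.1 j k hk x = 0 → f.2.1 j k' hk' x = 0)
    (hT : ∀ j k hk k' hk' x, p.2.2 j k hk x = 0 → f.2.2 j k' hk' x = 0) :
    ∃ g : realHom B N e,
      (∀ j k hk k' hk' hkk x, f.1 j k' hk' x = g.1.1 k k' hkk (p.1 j k hk x)) ∧
      (∀ j k hk k' hk' hkk x, f.2.1 j k' hk' x = g.1.2.1 k k' hkk (p.2.1 j k hk x)) ∧
      (∀ j k hk k' hk' hkk x, f.2.2 j k' hk' x = g.1.2.2 k k' hkk (p.2.2 j k hk x)) := by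
  -- Shifting `A` by `i` and `B` by `e` makes `f` and `p` homomorphisms of degree `0`, as `e + d =
  -- i`; the factorization obtained is then unshifted to degree `e`.
  obtain ⟨g, hg⟩ := exists_comp_eq_of_injective (shiftRealHom hp i e h) (ofRealHom hf) (by
    rintro (_ | _ | _) k x hx
    · exact hO _ _ _ _ _ x hx
    · exact hU _ _ _ _ _ x hx
    · exact hT _ _ _ _ _ x hx)
  have hg' : ∀ X k (x : A.obj X (k - i)), g.app X k ((shiftRealHom hp i e h).app X k x) =
    (ofRealHom hf).app X k x := fun X k x =>
      congrArg (fun a : A.shift i ⟶ N => a.app X k x) hg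
  refine ⟨⟨_, isRealHom_unshift g⟩, ?_, ?_, ?_⟩ <;>
  · intro j k hk k' hk' hkk x
    obtain rfl : j = k' - i := by omega
    obtain rfl : k = k' - e := by omega
    exact (hg' _ k' x).symm

end CRTModule

namespace CRTModule

/-! ### The CRT-modules representing the complex and the self-conjugate graded homomorphisms -/

@[simp] theorem castHom_rfl {M : CRTModule.{u}} {X : CRTPart} {i : ℤ} (h : i = i)
    (x : M.obj X i) : castHom h x = x := rfl

theorem sub_etaT {M : CRTModule.{u}} {i j : ℤ} (h : j = i + 1) (x : M.obj .T i) (y : M.obj .T j) :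
    y - M.etaT i j h x = y + M.etaT i j h x := by
  rw [sub_eq_add_neg, neg_etaT]

/-- `γ β_U c τ + ε r β_U ζ = 0` -/
theorem gamma_betaU_c_tau {M : CRTModule.{u}} {i a b e : ℤ} (h : a = i + 1) (h₁ : b = a + 2)
    (h₂ : e = b - 1) (h₃ : e = i + 2) (x : M.obj .T i) :
    M.act (.gamma b e h₂) (M.act (.betaU a b h₁) (M.act (.c a) (M.act (.tau i a h) x))) +
      M.act (.eps e) (M.act (.r e) (M.act (.betaU i e h₃) (M.act (.zeta i) x))) = 0 := by
  -- Both summands equal `η_T ε τ x`: the first by `c = ζ ε`, the second as `ε τ η_T x = ε τ ε τ x`.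
  -- Their sum vanishes since `2 η_T = 0`.
  rw [← zeta_eps, ← etaT_apply (show e = a + 1 by omega), ← tau_gamma (a := a) (by omega)
    (by omega),
    ← etaT_apply h, ← tau_eps_tau, eps_tau_eps, etaT_add_self]

section induced

variable (M : CRTModule.{u})

/-- The CRT-module freely generated by the `K_*(ℂ)`-module `M^U`, by its basic operations: its
elements are `r [u]` in the real part, `[u] + ψ [u']` in the complex part, and
`γ [u] + ε r [u']` in the self-conjugate part. -/
def complexInducedCore : CRTCore.{u} where
  obj
    | .O, n => M.obj .U n
    | .U, n => M.obj .U n × M.obj .U n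
    | .T, n => M.obj .U (n + 1) × M.obj .U n
  grp
    | .O, n => inferInstanceAs (AddCommGroup (M.obj .U n))
    | .U, n => inferInstanceAs (AddCommGroup (M.obj .U n × M.obj .U n))
    | .T, n => inferInstanceAs (AddCommGroup (M.obj .U (n + 1) × M.obj .U n))
  -- The formulas are forced by the CRT-relations: `ζ γ = 0` and `ζ ε r = 1 + ψ_U`, `γ ψ_U = γ`, `τ
  -- γ = r` and `τ ε r = 0`. Likewise `β_U ψ_U = -ψ_U β_U` explains the sign in `betaU`, and `β_T`
  -- passes to `β_U²` under `γ` and `ε r`.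
  eps n := AddMonoidHom.mk' (fun u => (0, u)) fun u v => Prod.ext (add_zero 0).symm rfl
  zeta n := AddMonoidHom.mk' (fun x => (x.2, x.2)) fun _ _ => rfl
  gamma i j h := AddMonoidHom.mk' (fun x => (castHom (show i = j + 1 by omega) (x.1 + x.2), 0))
    fun x y => Prod.ext (by
      rw [Prod.fst_add, Prod.snd_add, add_add_add_comm, map_add]; rfl) (add_zero 0).symm
  tau i j h := AddMonoidHom.mk' (fun x => castHom (show i + 1 = j by omega) x.1)
    fun x y => map_add _ _ _
  betaO i j h := M.betaU4 i j h
  betaU i j h := AddMonoidHom.mk' (fun x => (M.act (.betaU i j h) x.1, - M.act (.betaU i j h) x.2))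
    fun x y => Prod.ext (map_add _ _ _) (by
      rw [Prod.snd_add, map_add, neg_add]; rfl)
  betaT i j h := AddMonoidHom.mk'
    (fun x => (M.betaU2 (i + 1) (j + 1) (by omega) x.1, M.betaU2 i j h x.2))
    fun x y => Prod.ext (map_add _ _ _) (map_add _ _ _)
  betaO_bijective i j h := M.betaU4_bijective i j h
  betaU_bijective i j h := Function.Bijective.prodMap (M.betaU_bijective i j h)
    ((Equiv.neg _).bijective.comp (M.betaU_bijective i j h))
  betaT_bijective i j h := Function.Bijective.prodMap
    (M.betaU2_bijective (i + 1) (j + 1) (by omega)) (M.betaU2_bijective i j h)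
  r_c i a h h' x := by
    obtain rfl : i = a + 1 := by omega
    rfl
  gamma_c_tau i a b h h' h₁ h₂ x := by
    subst h
    obtain rfl : i = b + 1 := by omega
    exact Prod.ext (add_zero _) (zero_add _)
  zeta_gamma i a h x := rfl
  c_r_betaU i j a b h h₁ h₂ h₃ h₄ x := by
    obtain rfl : i = b + 1 := by omega
    obtain rfl : j = a + 1 := by omega
    obtain ⟨x, y⟩ := x
    refine Prod.ext ?_ ?_
    · change (M.act (.betaU _ _ h) x + - M.act (.betaU _ _ h) y) + M.act (.betaU _ _ h) (x + y) =
        M.act (.betaU _ _ h) x + M.act (.betaU _ _ h) x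
      rw [map_add]
      abel
    · change (M.act (.betaU _ _ h) x + - M.act (.betaU _ _ h) y) + - M.act (.betaU _ _ h) (x + y) =
        - M.act (.betaU _ _ h) y + - M.act (.betaU _ _ h) y
      rw [map_add]
      abel
  eps_betaO i a j h h₁ h₂ x := by
    refine Prod.ext ?_ (betaU4_apply h h₁ h₂ x)
    change 0 = M.betaU2 _ _ _ (M.betaU2 _ _ _ 0)
    rw [map_zero, map_zero]
  zeta_betaT i a j h h₁ h₂ x := by
    obtain ⟨x, y⟩ := x
    refine Prod.ext (betaU2_apply _ _ _ _) ?_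
    change M.betaU2 _ _ _ y = - M.act (.betaU _ _ _) (- M.act (.betaU _ _ _) y)
    rw [map_neg, neg_neg, betaU2_apply]
  gamma_betaU i a j b k h₁ h₂ h₃ h₄ h₅ x := by
    obtain rfl : i = b + 1 := by omega
    obtain rfl : j = k + 1 := by omega
    obtain ⟨x, y⟩ := x
    refine Prod.ext ?_ (map_zero (M.betaU2 b k h₅)).symm
    change M.act (.betaU _ _ _) (M.act (.betaU _ _ _) x) +
      - M.act (.betaU _ _ _) (- M.act (.betaU _ _ _) y) =
        M.betaU2 (b + 1) (k + 1) (by omega) (x + y)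
    rw [map_neg, neg_neg, betaU2_apply (by omega) h₁ h₂, map_add, map_add]
  tau_betaT i a j b k h₁ h₂ h₃ h₄ h₅ x := by
    subst h₄ h₃
    exact (betaU4_apply _ (by omega) (by omega) x.1).symm
  betaT_eps_tau i a j b c h₁ h₂ h₃ h₄ h₅ h₆ x := by
    subst h₁
    obtain rfl : j = b + 1 := by omega
    obtain rfl : c = b + 1 + 1 := by omega
    obtain ⟨x, y⟩ := x
    refine Prod.ext ?_ (add_zero _).symm
    change M.betaU2 _ _ _ 0 = 0 + (M.act (.betaU _ _ _) (M.betaU2 _ _ _ y) +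
      - M.act (.betaU _ _ _) (M.betaU2 _ _ _ y))
    rw [map_zero, add_neg_cancel, add_zero]
  tau_betaT_eps i a j h h' x := by
    subst h'
    exact map_zero (M.betaU2 (i + 1) (a + 1) (by omega))

/-- The CRT-module freely generated by the `K_*(ℂ)`-module `M^U`. -/
noncomputable def complexInduced : CRTModule.{u} := M.complexInducedCore.toModule

/-- The CRT-module representing the self-conjugate graded homomorphisms, by its basic
operations: its elements are `τ [m]` in the real part, `[u] + {u'}` in the complex part, and
`[m] + ε τ [m']` in the self-conjugate part. -/
def selfConjInducedCore : CRTCore.{u} where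
  obj
    | .O, n => M.obj .T (n - 1)
    | .U, n => M.obj .U n × M.obj .U (n - 1)
    | .T, n => M.obj .T n × M.obj .T (n - 1)
  grp
    | .O, n => inferInstanceAs (AddCommGroup (M.obj .T (n - 1)))
    | .U, n => inferInstanceAs (AddCommGroup (M.obj .U n × M.obj .U (n - 1)))
    | .T, n => inferInstanceAs (AddCommGroup (M.obj .T n × M.obj .T (n - 1)))
  eps n := AddMonoidHom.mk' (fun m => (0, m)) fun _ _ => Prod.ext (add_zero 0).symm rfl
  -- Here `{u}` is the product of `u` with `c τ` of the universal element, so its degree is one more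
  -- than that of `u`. The condition `zeta'` in degree `0` reads `ζ ε τ [m] = c τ [m] = [c τ m] + {ζ
  -- m}`.
  zeta n := AddMonoidHom.mk' (fun x => (M.act (.zeta n) x.1 +
      M.act (.c n) (M.act (.tau (n - 1) n) x.2), M.act (.zeta (n - 1)) x.2))
    fun x y => Prod.ext (by simp only [Prod.fst_add, Prod.snd_add, map_add]; abel) (map_add _ _ _)
  -- The condition `gamma'` solved for `γ {u}` gives `[ε r u] - ε r [u]`, and `ε r [u] = ε τ [γ u]`.
  gamma i j h := AddMonoidHom.mk' (fun x => (M.act (.gamma i j) x.1 +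
      M.act (.eps j) (M.act (.r j) (castHom (show i - 1 = j by omega) x.2)),
      - M.act (.gamma (i - 1) (j - 1)) x.2))
    fun x y => Prod.ext (by simp only [Prod.fst_add, Prod.snd_add, map_add]; abel)
      (by simp only [Prod.snd_add, map_add, neg_add])
  -- `τ ε τ [m] = τ η_T [m] = τ [η_T m]`, whose sign is immaterial.
  tau i j h := AddMonoidHom.mk' (fun x => castHom (show i = j - 1 by omega) x.1 -
      M.etaT (i - 1) (j - 1) (by omega) x.2)
    fun x y => by simp only [Prod.fst_add, Prod.snd_add, map_add]; abel
  betaO i j h := M.betaT2 (i - 1) (j - 1) (by omega)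
  betaU i j h := AddMonoidHom.mk'
    (fun x => (M.act (.betaU i j h) x.1, M.act (.betaU (i - 1) (j - 1)) x.2))
    fun x y => Prod.ext (map_add _ _ _) (map_add _ _ _)
  -- `β_T ε τ [m] = ε τ [β_T m] + [η_T β_T m]`, so `β_T` is triangular with bijective diagonal
  -- entries.
  betaT i j h := AddMonoidHom.mk' (fun x => (M.act (.betaT i j h) x.1 +
      M.etaT (j - 1) j (by omega) (M.act (.betaT (i - 1) (j - 1)) x.2),
      M.act (.betaT (i - 1) (j - 1)) x.2))
    fun x y => Prod.ext (by simp only [Prod.fst_add, Prod.snd_add, map_add]; abel) (map_add _ _ _)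
  betaO_bijective i j h := M.betaT2_bijective _ _ _
  betaU_bijective i j h := Function.Bijective.prodMap (M.betaU_bijective i j h)
    (M.betaU_bijective (i - 1) (j - 1) (by omega))
  betaT_bijective i j h := by
    refine ⟨(injective_iff_map_eq_zero _).mpr ?_, ?_⟩
    · rintro ⟨m, m'⟩ hm
      obtain ⟨h₁, h₂⟩ := Prod.ext_iff.mp hm
      change M.act (.betaT i j h) m + M.etaT _ _ _ (M.act (.betaT _ _ _) m') = 0 at h₁
      have h₃ : m' = 0 := (injective_iff_map_eq_zero _).mp
        (M.betaT_bijective (i - 1) (j - 1) (by omega)).injective m' h₂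
      subst h₃
      rw [map_zero, map_zero, add_zero] at h₁
      exact Prod.ext ((injective_iff_map_eq_zero _).mp (M.betaT_bijective i j h).injective m h₁) rfl
    · rintro ⟨m, m'⟩
      obtain ⟨x', rfl⟩ := (M.betaT_bijective (i - 1) (j - 1) (by omega)).surjective m'
      obtain ⟨x, hx⟩ := (M.betaT_bijective i j h).surjective
        (m - M.etaT (j - 1) j (by omega) (M.act (.betaT (i - 1) (j - 1)) x'))
      refine ⟨(x, x'), Prod.ext ?_ rfl⟩
      change M.act (.betaT i j h) x + M.etaT _ _ _ _ = m
      rw [hx, sub_add_cancel]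
  r_c i a h h' m := by
    subst h'
    simp only [AddMonoidHom.mk'_apply, castHom_rfl]
    simp [M.eps_r_zeta]
  gamma_c_tau i a b h h' h₁ h₂ x := by
    obtain rfl : i = a - 1 := by omega
    subst h₂
    obtain ⟨m, m'⟩ := x
    simp only [AddMonoidHom.mk'_apply, castHom_rfl]
    refine Prod.ext ?_ ?_ <;> simp [M.eps_r_zeta]
    · rw [etaT_apply (a := a) _ (by omega) rfl, psiT_gamma, sub_neg_eq_add,
        ← etaT_apply (by omega), etaT_add_self]
      abel
    · abel
  zeta_gamma i a h x := by
    subst h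
    obtain ⟨m, m'⟩ := x
    simp only [AddMonoidHom.mk'_apply, castHom_rfl]
    exact Prod.ext (by simp) (by simp)
  c_r_betaU i j a b h h₁ h₂ h₃ h₄ x := by
    subst h₂ h₄
    obtain ⟨m, m'⟩ := x
    simp only [AddMonoidHom.mk'_apply, castHom_rfl]
    refine Prod.ext ?_ ?_ <;> simp [psiU_betaU'] <;> abel
  eps_betaO i a j h h₁ h₂ m := by
    refine Prod.ext ?_ ?_ <;> simp
    · rw [← etaT_betaT (b := j - 1) (by omega) h₂ (by omega) (by omega), etaT_add_self]
    · rw [betaT2_apply]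
  zeta_betaT i a j h h₁ h₂ x := by
    obtain ⟨m, m'⟩ := x
    refine Prod.ext ?_ ?_ <;> simp
    · rw [zeta_betaT' h h₁ h₂, c_tau_betaT (a := i) (c := a) (by omega) _ _ h₁ h₂]
    · rw [zeta_betaT']
  gamma_betaU i a j b k h₁ h₂ h₃ h₄ h₅ x := by
    subst h₃ h₄
    obtain ⟨m, m'⟩ := x
    simp only [AddMonoidHom.mk'_apply, castHom_rfl]
    refine Prod.ext ?_ ?_ <;> simp
    · rw [gamma_betaU' h₁ h₂ rfl rfl h₅, eps_r_betaU (by omega) _ h₅,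
        etaT_betaT (a := i - 1) (by omega) h₅, etaT_gamma, map_zero, add_zero]
    · rw [gamma_betaU']
  tau_betaT i a j b k h₁ h₂ h₃ h₄ h₅ x := by
    obtain rfl : i = b - 1 := by omega
    obtain rfl : j = k - 1 := by omega
    obtain ⟨m, m'⟩ := x
    simp only [AddMonoidHom.mk'_apply, castHom_rfl]
    rw [map_add, ← etaT_betaT (b := k - 1 - 1) (by omega) h₂ (by omega) (by omega),
      add_sub_cancel_right, betaT2_apply (a := a) (by omega) h₁ h₂, map_sub, map_sub,
      ← etaT_betaT (b := a - 1) (by omega) h₁ (by omega) (by omega),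
      ← etaT_betaT (b := k - 1 - 1) (by omega) h₂ (by omega) (by omega), sub_etaT]
  betaT_eps_tau i a j b c h₁ h₂ h₃ h₄ h₅ h₆ x := by
    obtain rfl : i = a - 1 := by omega
    obtain rfl : b = j - 1 := by omega
    subst h₆
    obtain ⟨m, m'⟩ := x
    simp only [AddMonoidHom.mk'_apply, castHom_rfl]
    refine Prod.ext ?_ ?_ <;> simp
    · rw [← etaT_betaT (b := c - 1 - 1 - 1) (by omega) _ (by omega) (by omega), etaT_etaT, sub_zero,
        add_assoc, gamma_betaU_c_tau (i := c - 1 - 1 - 1) (a := c - 1 - 1)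
          (by omega) h₅ rfl (by omega), add_zero, ← etaT_apply (by omega)]
    · rw [← etaT_betaT (b := c - 1 - 1 - 1) (by omega) _ (by omega) (by omega), sub_etaT,
        ← etaT_apply (by omega), neg_etaT]
  tau_betaT_eps i a j h h' x := by
    obtain rfl : a = j - 1 := by omega
    simp only [AddMonoidHom.mk'_apply, castHom_rfl]
    simp

/-- The CRT-module representing the self-conjugate graded homomorphisms. -/
noncomputable def selfConjInduced : CRTModule.{u} := M.selfConjInducedCore.toModule

end induced

end CRTModule

namespace CRTModule

/-! ### Composition of graded homomorphisms -/

theorem Fam.zsmul_apply {M P : CRTModule.{u}} {X : CRTPart} {i j k : ℤ} (n : ℤ) (f : Fam M P X i)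
    (h : i + j = k) (x : M.obj X j) : (n • f) j k h x = n • f j k h x :=
  map_zsmul (AddMonoidHom.mk' (fun f : Fam M P X i => f j k h x) fun _ _ => rfl) n f

theorem sgn_smul_etaT {M : CRTModule.{u}} {i j : ℤ} (n : ℤ) (h : j = i + 1) (x : M.obj .T i) :
    sgn n • M.etaT i j h x = M.etaT i j h x := by
  rcases sgn_cases n with hn | hn <;> simp [hn]

section comp

variable {M P Q : CRTModule.{u}} {X : CRTPart} {e i a : ℤ}

/-- The composite of families of maps of degrees `e` and `i`. -/
def Fam.comp (h : e + i = a) (g : Fam P Q X e) (f : Fam M P X i) : Fam M Q X a :=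
  fun j k hk => (g (i + j) k (by omega)).comp (f j (i + j) rfl)

theorem Fam.comp_apply {h : e + i = a} {g : Fam P Q X e} {f : Fam M P X i} {j k hk l}
    (hl : i + j = l) (hk' : e + l = k) (x) :
    Fam.comp h g f j k hk x = g l k hk' (f j l hl x) := by
  subst hl; rfl

/-- The composite of homomorphisms of degrees `e` and `i`. -/
def compReal (h : e + i = a) (g : Fam P Q .O e × Fam P Q .U e × Fam P Q .T e)
    (f : Fam M P .O i × Fam M P .U i × Fam M P .T i) :
    Fam M Q .O a × Fam M Q .U a × Fam M Q .T a :=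
  (Fam.comp h g.1 f.1, Fam.comp h g.2.1 f.2.1, Fam.comp h g.2.2 f.2.2)

/-- The composite of a homomorphism of degree `e` and a self-conjugate homomorphism of
degree `i`. -/
def compSelfConj (h : e + i = a) (g : Fam P Q .O e × Fam P Q .U e × Fam P Q .T e)
    (f : Fam M P .T i × Fam M P .U i × Fam M P .U (i + 1)) :
    Fam M Q .T a × Fam M Q .U a × Fam M Q .U (a + 1) :=
  (Fam.comp h g.2.2 f.1, Fam.comp h g.2.1 f.2.1,
    -- The last member stands for the product with `c τ b`, and moving `g` past `τ` costs `(-1)^e`.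
    sgn e • Fam.comp (show e + (i + 1) = a + 1 by omega) g.2.1 f.2.2)

variable {g : Fam P Q .O e × Fam P Q .U e × Fam P Q .T e}

theorem IsRealHom.comp (hg : IsRealHom P Q e g)
    {f : Fam M P .O i × Fam M P .U i × Fam M P .T i} (hf : IsRealHom M P i f) (h : e + i = a) :
    IsRealHom M Q a (compReal h g f) := by
  constructor <;> dsimp only [compReal]
  · intro j k hk j' k' hk' hj hkk x
    rw [Fam.comp_apply (l := i + j) rfl (by omega), Fam.comp_apply (l := i + j') rfl (by omega),
      hf.betaO j (i + j) rfl _ _ _ _ (by omega), hg.betaO (i + j) k _ _ _ _ _ hkk]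
  · intro j k hk j' k' hk' hj hkk x
    rw [Fam.comp_apply (l := i + j) rfl (by omega), Fam.comp_apply (l := i + j') rfl (by omega),
      hf.betaU j (i + j) rfl _ _ _ _ (by omega), hg.betaU (i + j) k _ _ _ _ _ hkk]
  · intro j k hk j' k' hk' hj hkk x
    rw [Fam.comp_apply (l := i + j) rfl (by omega), Fam.comp_apply (l := i + j') rfl (by omega),
      hf.betaT j (i + j) rfl _ _ _ _ (by omega), hg.betaT (i + j) k _ _ _ _ _ hkk]
  · intro j k hk x
    rw [Fam.comp_apply (l := i + j) rfl (by omega), Fam.comp_apply (l := i + j) rfl (by omega),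
      hf.eps, hg.eps]
  · intro j k hk x
    rw [Fam.comp_apply (l := i + j) rfl (by omega), Fam.comp_apply (l := i + j) rfl (by omega),
      hf.zeta, hg.zeta]
  · intro j k hk j' k' hk' hj hkk x
    rw [Fam.comp_apply (l := i + j) rfl (by omega), Fam.comp_apply (l := i + j') rfl (by omega),
      hf.gamma j (i + j) rfl _ _ _ _ (by omega), map_zsmul, hg.gamma (i + j) k _ _ _ _ _ hkk,
      smul_smul, ← sgn_add, add_comm i e, h]
  · intro j k hk j' k' hk' hj hkk x
    rw [Fam.comp_apply (l := i + j) rfl (by omega), Fam.comp_apply (l := i + j') rfl (by omega),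
      hf.tau j (i + j) rfl _ _ _ _ (by omega), map_zsmul, hg.tau (i + j) k _ _ _ _ _ hkk,
      smul_smul, ← sgn_add, add_comm i e, h]

theorem IsRealHom.comp_complex (hg : IsRealHom P Q e g) {f : Fam M P .U i}
    (hf : IsComplexHom M P i f) (h : e + i = a) : IsComplexHom M Q a (Fam.comp h g.2.1 f) := by
  intro j k hk j' k' hk' hj hkk x
  rw [Fam.comp_apply (l := i + j) rfl (by omega), Fam.comp_apply (l := i + j') rfl (by omega),
    hf j (i + j) rfl _ _ _ _ (by omega), hg.betaU (i + j) k _ _ _ _ _ hkk]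

theorem IsRealHom.comp_selfConj (hg : IsRealHom P Q e g)
    {f : Fam M P .T i × Fam M P .U i × Fam M P .U (i + 1)} (hf : IsSelfConjHom M P i f)
    (h : e + i = a) : IsSelfConjHom M Q a (compSelfConj h g f) := by
  constructor <;> dsimp only [compSelfConj]
  · intro j k hk j' k' hk' hj hkk x
    rw [Fam.comp_apply (l := i + j) rfl (by omega), Fam.comp_apply (l := i + j') rfl (by omega),
      hf.betaT j (i + j) rfl _ _ _ _ (by omega), hg.betaT (i + j) k _ _ _ _ _ hkk]
  · exact hg.comp_complex hf.betaU h
  · exact (complexHom M Q (a + 1)).zsmul_mem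
      (hg.comp_complex hf.betaU' (show e + (i + 1) = a + 1 by omega)) (sgn e)
  · intro j k hk x
    rw [Fam.comp_apply (l := i + j) rfl (by omega), Fam.comp_apply (l := i + j) rfl (by omega),
      hf.zeta, hg.zeta]
  · intro j k hk j' k' hk' hj hkk x
    rw [Fam.comp_apply (l := i + j) rfl (by omega), Fam.comp_apply (l := i + j') rfl (by omega),
      hf.gamma j (i + j) rfl _ _ _ _ (by omega), map_zsmul, hg.gamma (i + j) k _ _ _ _ _ hkk,
      smul_smul, ← sgn_add, add_comm i e, h]
  · intro j k hk x
    rw [Fam.comp_apply (l := i + j) rfl (by omega), Fam.comp_apply (l := i + j) rfl (by omega),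
      hf.psiU, hg.psiU]
  · intro j k hk x
    rw [Fam.zsmul_apply, Fam.zsmul_apply, Fam.comp_apply (l := i + 1 + j) rfl (by omega),
      Fam.comp_apply (l := i + 1 + j) rfl (by omega), hf.psiU', hg.psiU, map_zsmul]
  · intro j k hk k' hk' hkk j' hk'' hj x
    rw [Fam.zsmul_apply, Fam.comp_apply (l := i + 1 + j) rfl (by omega),
      Fam.comp_apply (l := i + j) rfl (by omega),
      Fam.comp_apply (l := i + 1 + j) (by omega) (by omega),
      hf.zeta' j (i + j) rfl _ _ (by omega) j' (by omega) hj, map_sub, hg.c,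
      hg.tau (i + j) k (by omega) _ _ _ _ hkk, smul_sub, map_zsmul, map_zsmul, smul_sgn_smul,
      smul_smul, ← sgn_add, h]
  · intro j k hk k' hk' hkk x
    rw [Fam.zsmul_apply, Fam.comp_apply (l := i + 1 + j) rfl (by omega),
      Fam.comp_apply (l := i + j) rfl (by omega), Fam.comp_apply (l := i + j) rfl (by omega),
      hf.gamma' j (i + j) rfl (i + 1 + j) rfl (by omega), map_add, hg.eps, hg.r,
      hg.gamma (i + 1 + j) k' (by omega) _ _ _ _ hkk, map_zsmul]

/-- Composition with a homomorphism of degree `e`, as a family of maps of degree `e` between the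
CRT-modules of graded homomorphisms. -/
noncomputable def postcompFam (M : CRTModule.{u}) (g : realHom P Q e) :
    ∀ X : CRTPart, Fam (internalHom M P) (internalHom M Q) X e
  | .O, j, k, h => AddMonoidHom.mk' (fun f : realHom M P j =>
      (⟨compReal h g.1 f.1, IsRealHom.comp g.2 f.2 h⟩ : realHom M Q k)) fun f f' =>
        realHom_ext (fun _ _ _ _ => map_add (g.1.1 _ _ _) _ _)
          (fun _ _ _ _ => map_add (g.1.2.1 _ _ _) _ _)
          fun _ _ _ _ => map_add (g.1.2.2 _ _ _) _ _
  | .U, j, k, h => AddMonoidHom.mk' (fun f : complexHom M P j =>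
      (⟨Fam.comp h g.1.2.1 f.1, IsRealHom.comp_complex g.2 f.2 h⟩ : complexHom M Q k)) fun f f' =>
        complexHom_ext (fun _ _ _ _ => map_add (g.1.2.1 _ _ _) _ _)
  | .T, j, k, h => AddMonoidHom.mk' (fun f : selfConjHom M P j =>
      (⟨compSelfConj h g.1 f.1, IsRealHom.comp_selfConj g.2 f.2 h⟩ : selfConjHom M Q k)) fun f f' =>
        selfConjHom_ext (fun _ _ _ _ => map_add (g.1.2.2 _ _ _) _ _)
          (fun _ _ _ _ => map_add (g.1.2.1 _ _ _) _ _)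
          fun _ _ _ _ => by
            change (_ • _ : Fam _ _ _ _) _ _ _ _ = (_ • _ : Fam _ _ _ _) _ _ _ _ +
              (_ • _ : Fam _ _ _ _) _ _ _ _
            rw [Fam.zsmul_apply, Fam.zsmul_apply, Fam.zsmul_apply, ← smul_add]
            exact congrArg _ (map_add (g.1.2.1 _ _ _) _ _)

theorem compSelfConj_U' {h : e + i = a} {f : Fam M P .T i × Fam M P .U i × Fam M P .U (i + 1)}
    {j k hk l} (hl : i + 1 + j = l) (hk' : e + l = k) (x) :
    (compSelfConj h g f).2.2 j k hk x = sgn e • g.2.1 l k hk' (f.2.2 j l hl x) :=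
  (Fam.zsmul_apply _ _ _ _).trans (congrArg _ (Fam.comp_apply hl hk' x))

theorem realHom_zsmul_O (n : ℤ) (f : realHom M P i) (j k h x) :
    (n • f).1.1 j k h x = n • f.1.1 j k h x := Fam.zsmul_apply n f.1.1 h x

theorem realHom_zsmul_U (n : ℤ) (f : realHom M P i) (j k h x) :
    (n • f).1.2.1 j k h x = n • f.1.2.1 j k h x := Fam.zsmul_apply n f.1.2.1 h x

theorem realHom_zsmul_T (n : ℤ) (f : realHom M P i) (j k h x) :
    (n • f).1.2.2 j k h x = n • f.1.2.2 j k h x := Fam.zsmul_apply n f.1.2.2 h x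

theorem selfConjHom_zsmul_T (n : ℤ) (f : selfConjHom M P i) (j k h x) :
    (n • f).1.1 j k h x = n • f.1.1 j k h x := Fam.zsmul_apply n f.1.1 h x

theorem selfConjHom_zsmul_U (n : ℤ) (f : selfConjHom M P i) (j k h x) :
    (n • f).1.2.1 j k h x = n • f.1.2.1 j k h x := Fam.zsmul_apply n f.1.2.1 h x

theorem selfConjHom_zsmul_U' (n : ℤ) (f : selfConjHom M P i) (j k h x) :
    (n • f).1.2.2 j k h x = n • f.1.2.2 j k h x := Fam.zsmul_apply n f.1.2.2 h x

/-- Naturality in the target. It transports an identity `g ∘ θ u = f`, for a universal element `u`,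
into `f = ± θ (g ∘ u)`. -/
theorem isRealHom_postcompFam (M : CRTModule.{u}) (g : realHom P Q e) :
    IsRealHom (internalHom M P) (internalHom M Q) e
      (postcompFam M g .O, postcompFam M g .U, postcompFam M g .T) := by
  have hg : IsRealHom P Q e g.1 := g.2
  constructor <;> dsimp only
  · intro j k hk j' k' hk' hj hkk f
    refine realHom_ext (M := M) (P := Q) ?_ ?_ ?_ <;> intro p q hq x
    · change Fam.comp hk' g.1.1 (realBetaO j j' hj f.1).1 p q hq x =
        (realBetaO k k' hkk (compReal hk g.1 f.1)).1 p q hq x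
      rw [Fam.comp_apply (l := j' + p) rfl (by omega), realBetaO_O hj _ (b := j + p) rfl (by omega),
        realBetaO_O hkk hq (b := k + p) rfl (by omega)]
      dsimp only [compReal]
      rw [Fam.comp_apply (l := j + p) rfl (by omega), hg.betaO (j + p) (k + p)]
    · change Fam.comp hk' g.1.2.1 (realBetaO j j' hj f.1).2.1 p q hq x =
        (realBetaO k k' hkk (compReal hk g.1 f.1)).2.1 p q hq x
      rw [Fam.comp_apply (l := j' + p) rfl (by omega), realBetaO_U hj _ (b := j + p) rfl (by omega),
        realBetaO_U hkk hq (b := k + p) rfl (by omega)]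
      dsimp only [compReal]
      rw [Fam.comp_apply (l := j + p) rfl (by omega),
        betaU4_apply (a := j + p + 4) _ rfl (by omega), betaU4_apply (a := k + p + 4) _ rfl
          (by omega),
        IsComplexHom.betaU2 hg.betaU (k := k + p + 4) (hk := by omega) (by omega),
        IsComplexHom.betaU2 hg.betaU (k := k + p) (hk := by omega) (by omega)]
    · change Fam.comp hk' g.1.2.2 (realBetaO j j' hj f.1).2.2 p q hq x =
        (realBetaO k k' hkk (compReal hk g.1 f.1)).2.2 p q hq x
      rw [Fam.comp_apply (l := j' + p) rfl (by omega), realBetaO_T hj _ (b := j + p) rfl (by omega),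
        realBetaO_T hkk hq (b := k + p) rfl (by omega)]
      dsimp only [compReal]
      rw [Fam.comp_apply (l := j + p) rfl (by omega),
        betaT2_apply (a := j + p + 4) _ rfl (by omega), betaT2_apply (a := k + p + 4) _ rfl
          (by omega),
        hg.betaT (j + p + 4) (k + p + 4) (by omega) _ _ _ _ (by omega),
        hg.betaT (j + p) (k + p) (by omega) _ _ _ _ (by omega)]
  · intro j k hk j' k' hk' hj hkk f
    refine complexHom_ext (M := M) (P := Q) ?_
    intro p q hq x
    change Fam.comp hk' g.1.2.1 (complexBetaU j j' hj (Subtype.val (p := (· ∈ complexHom M P j)) f))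
      p q hq x =
      complexBetaU k k' hkk (Fam.comp hk g.1.2.1 (Subtype.val (p := (· ∈ complexHom M P j)) f)) p q
        hq x
    rw [Fam.comp_apply (l := j' + p) rfl (by omega), complexBetaU_apply hj _ (b := j + p) rfl
      (by omega),
      complexBetaU_apply hkk hq (b := k + p) rfl (by omega),
      Fam.comp_apply (l := j + p) rfl (by omega), hg.betaU (j + p) (k + p)]
  · intro j k hk j' k' hk' hj hkk f
    refine selfConjHom_ext (M := M) (P := Q) ?_ ?_ ?_ <;> intro p q hq x
    · change Fam.comp hk' g.1.2.2 (selfConjBetaT j j' hj f.1).1 p q hq x =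
        (selfConjBetaT k k' hkk (compSelfConj hk g.1 f.1)).1 p q hq x
      rw [Fam.comp_apply (l := j' + p) rfl (by omega), selfConjBetaT_T hj _ (b := j + p) rfl
        (by omega),
        selfConjBetaT_T hkk hq (b := k + p) rfl (by omega)]
      dsimp only [compSelfConj]
      rw [Fam.comp_apply (l := j + p) rfl (by omega), hg.betaT (j + p) (k + p)]
    · change Fam.comp hk' g.1.2.1 (selfConjBetaT j j' hj f.1).2.1 p q hq x =
        (selfConjBetaT k k' hkk (compSelfConj hk g.1 f.1)).2.1 p q hq x
      rw [Fam.comp_apply (l := j' + p) rfl (by omega), selfConjBetaT_U hj _ (b := j + p) rfl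
        (by omega),
        selfConjBetaT_U hkk hq (b := k + p) rfl (by omega)]
      dsimp only [compSelfConj]
      rw [Fam.comp_apply (l := j + p) rfl (by omega),
        IsComplexHom.betaU2 hg.betaU (k := k + p) (hk := by omega) (by omega)]
    · change (compSelfConj hk' g.1 (selfConjBetaT j j' hj f.1)).2.2 p q hq x =
        (selfConjBetaT k k' hkk (compSelfConj hk g.1 f.1)).2.2 p q hq x
      rw [compSelfConj_U' (l := j' + 1 + p) rfl (by omega),
        selfConjBetaT_U' hj _ (b := j + 1 + p) rfl (by omega),
        selfConjBetaT_U' hkk hq (b := k + 1 + p) rfl (by omega),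
        compSelfConj_U' (l := j + 1 + p) rfl (by omega), map_zsmul,
        IsComplexHom.betaU2 hg.betaU (k := k + 1 + p) (hk := by omega) (by omega)]
  · intro j k hk f
    refine selfConjHom_ext (M := M) (P := Q) (fun _ _ _ _ => rfl) (fun _ _ _ _ => rfl) ?_
    intro p q hq x
    change (compSelfConj hk g.1 (realEps j f.1)).2.2 p q hq x = 0
    rw [compSelfConj_U' (l := j + 1 + p) rfl (by omega)]
    simp [realEps]
  · intro j k hk f
    rfl
  · intro j k hk j' k' hk' hj hkk f
    let φ : complexHom M P j := f
    refine selfConjHom_ext (M := M) (P := Q) ?_ ?_ ?_ <;> intro p q hq x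
    · refine Eq.trans ?_ (selfConjHom_zsmul_T _ _ _ _ _ _).symm
      change Fam.comp hk' g.1.2.2 (complexGamma j j' hj φ.1).1 p q hq x =
        sgn e • (complexGamma k k' hkk (Fam.comp hk g.1.2.1 φ.1)).1 p q hq x
      rw [Fam.comp_apply (l := j' + p) rfl (by omega),
        complexGamma_T hj _ (b := j + p) rfl (by omega),
        complexGamma_T hkk _ (b := k + p) rfl (by omega), Fam.comp_apply (l := j + p) rfl
          (by omega),
        hg.gamma (j + p) (k + p)]
    · refine Eq.trans ?_ (selfConjHom_zsmul_U _ _ _ _ _ _).symm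
      change g.1.2.1 _ _ _ 0 = sgn e • 0
      rw [map_zero, smul_zero]
    · refine Eq.trans ?_ (selfConjHom_zsmul_U' _ _ _ _ _ _).symm
      change (compSelfConj hk' g.1 (complexGamma j j' hj φ.1)).2.2 p q hq x =
        sgn e • (complexGamma k k' hkk (Fam.comp hk g.1.2.1 φ.1)).2.2 p q hq x
      rw [compSelfConj_U' (l := j + p) (by omega) (by omega), complexGamma_U' hj _ rfl,
        complexGamma_U' hkk _ (by omega), Fam.comp_apply (l := j + p) rfl (by omega),
        Fam.comp_apply (l := j + p) rfl (by omega), map_add, hg.psiU]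
  · intro j k hk j' k' hk' hj hkk f
    let φ : selfConjHom M P j := f
    refine realHom_ext (M := M) (P := Q) ?_ ?_ ?_ <;> intro p q hq x
    · refine Eq.trans ?_ (realHom_zsmul_O _ _ _ _ _ _).symm
      change Fam.comp hk' g.1.1 (selfConjTau j j' hj φ.1).1 p q hq x =
        sgn e • (selfConjTau k k' hkk (compSelfConj hk g.1 φ.1)).1 p q hq x
      rw [Fam.comp_apply (l := j' + p) rfl (by omega),
        selfConjTau_O hj _ (b := j + p) rfl (by omega),
        selfConjTau_O hkk _ (b := k + p) rfl (by omega),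
        hg.tau (j + p) (k + p)]
      dsimp only [compSelfConj]
      rw [Fam.comp_apply (l := j + p) rfl (by omega)]
    · refine Eq.trans ?_ (realHom_zsmul_U _ _ _ _ _ _).symm
      change Fam.comp hk' g.1.2.1 (selfConjTau j j' hj φ.1).2.1 p q hq x =
        sgn e • (compSelfConj hk g.1 φ.1).2.2 p q (by omega) x
      rw [Fam.comp_apply (l := j' + p) rfl (by omega),
        selfConjTau_U hj _ (by omega), compSelfConj_U' (l := j' + p) (by omega) (by omega),
          smul_sgn_smul]
    · refine Eq.trans ?_ (realHom_zsmul_T _ _ _ _ _ _).symm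
      change Fam.comp hk' g.1.2.2 (selfConjTau j j' hj φ.1).2.2 p q hq x =
        sgn e • (selfConjTau k k' hkk (compSelfConj hk g.1 φ.1)).2.2 p q hq x
      rw [Fam.comp_apply (l := j' + p) rfl (by omega),
        selfConjTau_T hj _ (b := j + p) (a' := p + 1) rfl (by omega) rfl (by omega),
        selfConjTau_T hkk _ (b := k + p) (a' := p + 1) rfl (by omega) rfl (by omega)]
      dsimp only [compSelfConj]
      rw [Fam.comp_apply (l := j + p) rfl (by omega),
        Fam.comp_apply (l := j' + p) (by omega) (by omega), map_sub, map_sub, map_zsmul, hg.eps,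
        hg.tau (j + p) (k + p), hg.etaT (k := k + p) (h := by omega) (hk := by omega), map_zsmul,
        smul_sub, smul_sub, smul_smul, ← sgn_add, sgn_of_even e (show e + k = j + (e + e) by omega),
          sgn_smul_etaT]

end comp

end CRTModule

/-! ### The universal complex homomorphism and its extensions -/

namespace CRTModule

section complexInduced

variable {M : CRTModule.{u}}

/-- The element `r [u]`. -/
def complexInduced.mkO {n : ℤ} (u : M.obj .U n) : M.complexInduced.obj .O n := u

/-- The element `[u] + ψ [u']`. -/
def complexInduced.mkU {n : ℤ} (u u' : M.obj .U n) : M.complexInduced.obj .U n :=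
  ((u, u') : M.obj .U n × M.obj .U n)

/-- The element `γ [u] + ε r [u']`. -/
def complexInduced.mkT {n : ℤ} (u : M.obj .U (n + 1)) (u' : M.obj .U n) :
    M.complexInduced.obj .T n := ((u, u') : M.obj .U (n + 1) × M.obj .U n)

open complexInduced

namespace complexInduced

theorem exists_mkO {n : ℤ} (x : M.complexInduced.obj .O n) : ∃ u, x = mkO u := ⟨x, rfl⟩

theorem exists_mkU {n : ℤ} (x : M.complexInduced.obj .U n) : ∃ u u', x = mkU u u' :=
  ⟨Prod.fst (α := M.obj .U n) (β := M.obj .U n) x,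
    Prod.snd (α := M.obj .U n) (β := M.obj .U n) x, rfl⟩

theorem exists_mkT {n : ℤ} (x : M.complexInduced.obj .T n) : ∃ u u', x = mkT u u' :=
  ⟨Prod.fst (α := M.obj .U (n + 1)) (β := M.obj .U n) x,
    Prod.snd (α := M.obj .U (n + 1)) (β := M.obj .U n) x, rfl⟩

theorem mkU_add {n : ℤ} (u u' v v' : M.obj .U n) : mkU u u' + mkU v v' = mkU (u + v) (u' + v') :=
  rfl

theorem mkT_add {n : ℤ} (u v : M.obj .U (n + 1)) (u' v' : M.obj .U n) :
    mkT u u' + mkT v v' = mkT (u + v) (u' + v') := rfl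

theorem eps_mkO {n : ℤ} (u : M.obj .U n) : M.complexInduced.act (.eps n) (mkO u) = mkT 0 u := rfl

theorem zeta_mkT {n : ℤ} (u : M.obj .U (n + 1)) (u' : M.obj .U n) :
    M.complexInduced.act (.zeta n) (mkT u u') = mkU u' u' := rfl

theorem gamma_mkU {n k : ℤ} (h : k = n - 1) (u u' : M.obj .U n) :
    M.complexInduced.act (.gamma n k h) (mkU u u') =
      mkT (castHom (show n = k + 1 by omega) (u + u')) 0 := rfl

theorem tau_mkT {n k : ℤ} (h : k = n + 1) (u : M.obj .U (n + 1)) (u' : M.obj .U n) :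
    M.complexInduced.act (.tau n k h) (mkT u u') = mkO (castHom (show n + 1 = k by omega) u) := rfl

theorem c_mkO {n : ℤ} (u : M.obj .U n) : M.complexInduced.act (.c n) (mkO u) = mkU u u := rfl

theorem r_mkU {n : ℤ} (u u' : M.obj .U n) :
    M.complexInduced.act (.r n) (mkU u u') = mkO (u + u') := by
  obtain ⟨a, rfl⟩ : ∃ a, n = a + 1 := ⟨n - 1, by omega⟩
  rw [← tau_gamma (a := a) (by omega) rfl, gamma_mkU, tau_mkT, castHom_rfl, castHom_rfl]

theorem psiU_mkU {n : ℤ} (u u' : M.obj .U n) :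
    M.complexInduced.act (.psiU n) (mkU u u') = mkU u' u := by
  rw [eq_sub_of_add_eq' (M.complexInduced.c_r _ (mkU u u')).symm, r_mkU, c_mkO, sub_eq_iff_eq_add,
    mkU_add, add_comm u u']

theorem betaO_mkO {n k : ℤ} (h : k = n + 8) (u : M.obj .U n) :
    M.complexInduced.act (.betaO n k h) (mkO u) = mkO (M.betaU4 n k h u) := rfl

theorem betaU_mkU {n k : ℤ} (h : k = n + 2) (u u' : M.obj .U n) :
    M.complexInduced.act (.betaU n k h) (mkU u u') =
      mkU (M.act (.betaU n k h) u) (- M.act (.betaU n k h) u') := rfl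

theorem betaT_mkT {n k : ℤ} (h : k = n + 4) (u : M.obj .U (n + 1)) (u' : M.obj .U n) :
    M.complexInduced.act (.betaT n k h) (mkT u u') =
      mkT (M.betaU2 (n + 1) (k + 1) (by omega) u) (M.betaU2 n k h u') := rfl

variable (M) in
/-- The universal `K_*(ℂ)`-linear map `u ↦ [u]`. -/
noncomputable def gen : complexHom M M.complexInduced 0 :=
  ⟨fun j k h => AddMonoidHom.mk' (fun u => mkU (castHom (show j = k by omega) u) 0) fun u v => by
      rw [mkU_add, map_add, add_zero], by
    intro j k h j' k' h' hj hk x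
    obtain rfl : k = j := by omega
    obtain rfl : k' = j' := by omega
    simp only [AddMonoidHom.mk'_apply, castHom_rfl, betaU_mkU, map_zero, neg_zero]⟩

theorem gen_apply {j : ℤ} (h : 0 + j = j) (u : M.obj .U j) : (gen M).1 j j h u = mkU u 0 := rfl

end complexInduced

variable {P : CRTModule.{u}} {i : ℤ}

/-- The homomorphism which carries `[u]` to `f u`. -/
noncomputable def complexExtend (f : Fam M P .U i) :
    Fam M.complexInduced P .O i × Fam M.complexInduced P .U i × Fam M.complexInduced P .T i :=
  -- The values on `r [u]`, `ψ_U [u']`, `γ [u]` and `ε r [u']` are forced by compatibility with the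
  -- operations; the sign in the last component comes from passing `γ`.
  (fun j k h => (P.act (.r k)).comp (f j k h),
   fun j k h => AddMonoidHom.coprod (f j k h) ((P.act (.psiU k)).comp (f j k h)),
   fun j k h => AddMonoidHom.coprod
    (sgn i • (P.act (.gamma (k + 1) k)).comp (f (j + 1) (k + 1) (by omega)))
    (((P.act (.eps k)).comp (P.act (.r k))).comp (f j k h)))

variable {f : Fam M P .U i}

theorem complexExtend_O {j k : ℤ} (h : i + j = k) (u : M.obj .U j) :
    (complexExtend f).1 j k h (mkO u) = P.act (.r k) (f j k h u) := rfl

theorem complexExtend_U {j k : ℤ} (h : i + j = k) (u u' : M.obj .U j) :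
    (complexExtend f).2.1 j k h (mkU u u') = f j k h u + P.act (.psiU k) (f j k h u') := rfl

theorem complexExtend_T {j k a : ℤ} (h : i + j = k) (h₁ : k = a - 1) (h₂ : i + (j + 1) = a)
    (u : M.obj .U (j + 1)) (u' : M.obj .U j) : (complexExtend f).2.2 j k h (mkT u u') =
      sgn i • P.act (.gamma a k h₁) (f (j + 1) a h₂ u) +
        P.act (.eps k) (P.act (.r k) (f j k h u')) := by
  obtain rfl : a = k + 1 := by omega
  rfl

/-- The existence half of the universal property of `complexInduced M`: it lets the injectivity of
`N` be applied to maps that are only `K_*(ℂ)`-linear. -/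
theorem IsComplexHom.isRealHom_extend (hf : IsComplexHom M P i f) :
    IsRealHom M.complexInduced P i (complexExtend f) := by
  constructor
  · intro j k h j' k' h' hj hk x
    obtain ⟨u, hu⟩ := exists_mkO x
    rw [hu, betaO_mkO, complexExtend_O, complexExtend_O, betaU4_apply (a := j + 4) _ rfl (by omega),
      hf.betaU2 (k := k + 4) (hk := by omega) (by omega),
      hf.betaU2 (k := k) (hk := by omega) (by omega), ← betaU4_apply hk,
      ← tau_gamma (a := k' - 1) rfl (by omega), gamma_betaU4 hk rfl (b := k - 1) (by omega)
        (by omega),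
      tau_betaT2 _ _ (b := k) (by omega), tau_gamma]
  · intro j k h j' k' h' hj hk x
    obtain ⟨u, u', rfl⟩ := exists_mkU x
    rw [betaU_mkU, complexExtend_U, complexExtend_U, hf j k h, map_neg, hf j k h, map_neg,
      psiU_betaU', neg_neg, map_add]
  · intro j k h j' k' h' hj hk x
    obtain ⟨u, u', rfl⟩ := exists_mkT x
    rw [betaT_mkT, complexExtend_T (a := k' + 1) _ (by omega) (by omega),
      complexExtend_T (a := k + 1) _ (by omega) (by omega),
      hf.betaU2 (k := k + 1) (hk := by omega) (by omega), hf.betaU2 (k := k) (hk := by omega) hk,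
      gamma_betaU2, eps_r_betaU2, map_add, map_zsmul]
  · intro j k h x
    obtain ⟨u, hu⟩ := exists_mkO x
    rw [hu, eps_mkO, complexExtend_O, complexExtend_T (a := k + 1) _ (by omega) (by omega),
      map_zero, map_zero,
      smul_zero, zero_add]
  · intro j k h x
    obtain ⟨u, u', rfl⟩ := exists_mkT x
    rw [zeta_mkT, complexExtend_U, complexExtend_T (a := k + 1) _ (by omega) (by omega), map_add,
      map_zsmul, zeta_gamma', smul_zero, zero_add, zeta_eps, c_r']
  · intro j k h j' k' h' hj hk x
    obtain ⟨u, u', rfl⟩ := exists_mkU x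
    obtain rfl : j = j' + 1 := by omega
    rw [gamma_mkU, castHom_rfl, complexExtend_T (a := k) _ (by omega) (by omega), complexExtend_U,
      map_add, map_add, map_add, gamma_psiU', map_zero, map_zero, map_zero, add_zero]
  · intro j k h j' k' h' hj hk x
    obtain ⟨u, u', rfl⟩ := exists_mkT x
    subst hj
    rw [tau_mkT, castHom_rfl, complexExtend_T (a := k') _ (by omega) (by omega), complexExtend_O,
      map_add, map_zsmul, tau_eps_r, add_zero, tau_gamma, smul_sgn_smul]

end complexInduced

end CRTModule

/-! ### The universal self-conjugate homomorphism and its extensions -/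

namespace CRTModule

section selfConjInduced

variable {M : CRTModule.{u}}

/-- The element `τ [m]`. -/
def selfConjInduced.mkO {n : ℤ} (m : M.obj .T (n - 1)) : M.selfConjInduced.obj .O n := m

/-- The element `[u] + {u'}`. -/
def selfConjInduced.mkU {n : ℤ} (u : M.obj .U n) (u' : M.obj .U (n - 1)) :
    M.selfConjInduced.obj .U n := ((u, u') : M.obj .U n × M.obj .U (n - 1))

/-- The element `[m] + ε τ [m']`. -/
def selfConjInduced.mkT {n : ℤ} (m : M.obj .T n) (m' : M.obj .T (n - 1)) :
    M.selfConjInduced.obj .T n := ((m, m') : M.obj .T n × M.obj .T (n - 1))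

open selfConjInduced

namespace selfConjInduced

theorem exists_mkO {n : ℤ} (x : M.selfConjInduced.obj .O n) : ∃ m, x = mkO m := ⟨x, rfl⟩

theorem exists_mkU {n : ℤ} (x : M.selfConjInduced.obj .U n) : ∃ u u', x = mkU u u' :=
  ⟨Prod.fst (α := M.obj .U n) (β := M.obj .U (n - 1)) x,
    Prod.snd (α := M.obj .U n) (β := M.obj .U (n - 1)) x, rfl⟩

theorem exists_mkT {n : ℤ} (x : M.selfConjInduced.obj .T n) : ∃ m m', x = mkT m m' :=
  ⟨Prod.fst (α := M.obj .T n) (β := M.obj .T (n - 1)) x,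
    Prod.snd (α := M.obj .T n) (β := M.obj .T (n - 1)) x, rfl⟩

theorem mkU_add {n : ℤ} (u v : M.obj .U n) (u' v' : M.obj .U (n - 1)) :
    mkU u u' + mkU v v' = mkU (u + v) (u' + v') := rfl

theorem mkT_add {n : ℤ} (m l : M.obj .T n) (m' l' : M.obj .T (n - 1)) :
    mkT m m' + mkT l l' = mkT (m + l) (m' + l') := rfl

theorem eps_mkO {n : ℤ} (m : M.obj .T (n - 1)) :
    M.selfConjInduced.act (.eps n) (mkO m) = mkT 0 m := rfl

theorem zeta_mkT {n : ℤ} (m : M.obj .T n) (m' : M.obj .T (n - 1)) :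
    M.selfConjInduced.act (.zeta n) (mkT m m') =
      mkU (M.act (.zeta n) m + M.act (.c n) (M.act (.tau (n - 1) n) m'))
        (M.act (.zeta (n - 1)) m') := rfl

theorem gamma_mkU {n k : ℤ} (h : k = n - 1) (u : M.obj .U n) (u' : M.obj .U (n - 1)) :
    M.selfConjInduced.act (.gamma n k h) (mkU u u') =
      mkT (M.act (.gamma n k h) u +
        M.act (.eps k) (M.act (.r k) (castHom (show n - 1 = k by omega) u')))
        (- M.act (.gamma (n - 1) (k - 1)) u') := rfl

theorem tau_mkT {n k : ℤ} (h : k = n + 1) (m : M.obj .T n) (m' : M.obj .T (n - 1)) :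
    M.selfConjInduced.act (.tau n k h) (mkT m m') =
      mkO (castHom (show n = k - 1 by omega) m - M.etaT (n - 1) (k - 1) (by omega) m') := rfl

theorem c_mkO {n : ℤ} (m : M.obj .T (n - 1)) : M.selfConjInduced.act (.c n) (mkO m) =
    mkU (M.act (.c n) (M.act (.tau (n - 1) n) m)) (M.act (.zeta (n - 1)) m) := by
  rw [← zeta_eps, eps_mkO, zeta_mkT, map_zero, zero_add]

theorem r_mkU {n : ℤ} (u : M.obj .U n) (u' : M.obj .U (n - 1)) :
    M.selfConjInduced.act (.r n) (mkU u u') =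
      mkO (M.act (.gamma n (n - 1)) u + M.act (.eps (n - 1)) (M.act (.r (n - 1)) u')) := by
  rw [← tau_gamma (a := n - 1) rfl (by omega), gamma_mkU, tau_mkT, castHom_rfl, castHom_rfl,
    map_neg, etaT_gamma, neg_zero, sub_zero]

theorem psiU_mkU {n : ℤ} (u : M.obj .U n) (u' : M.obj .U (n - 1)) :
    M.selfConjInduced.act (.psiU n) (mkU u u') =
      mkU (M.act (.psiU n) u) (M.act (.psiU (n - 1)) u') := by
  rw [eq_sub_of_add_eq' (M.selfConjInduced.c_r _ (mkU u u')).symm, r_mkU, c_mkO, sub_eq_iff_eq_add,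
    mkU_add]
  congr 1
  · rw [map_add, tau_gamma, tau_eps_r, add_zero, c_r', add_comm]
  · rw [map_add, zeta_gamma', zeta_eps, zero_add, c_r', add_comm]

theorem betaO_mkO {n k : ℤ} (h : k = n + 8) (m : M.obj .T (n - 1)) :
    M.selfConjInduced.act (.betaO n k h) (mkO m) =
      mkO (M.betaT2 (n - 1) (k - 1) (by omega) m) := rfl

theorem betaU_mkU {n k : ℤ} (h : k = n + 2) (u : M.obj .U n) (u' : M.obj .U (n - 1)) :
    M.selfConjInduced.act (.betaU n k h) (mkU u u') =
      mkU (M.act (.betaU n k h) u) (M.act (.betaU (n - 1) (k - 1)) u') := rfl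

theorem betaT_mkT {n k : ℤ} (h : k = n + 4) (m : M.obj .T n) (m' : M.obj .T (n - 1)) :
    M.selfConjInduced.act (.betaT n k h) (mkT m m') =
      mkT (M.act (.betaT n k h) m +
        M.etaT (k - 1) k (by omega) (M.act (.betaT (n - 1) (k - 1)) m'))
        (M.act (.betaT (n - 1) (k - 1)) m') := rfl

variable (M) in
/-- The families of maps `m ↦ [m]`, `u ↦ [u]`, `u ↦ {u}`. -/
noncomputable def genFam : Fam M M.selfConjInduced .T 0 × Fam M M.selfConjInduced .U 0 ×
    Fam M M.selfConjInduced .U (0 + 1) :=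
  (fun j k h => AddMonoidHom.mk' (fun m => mkT (castHom (show j = k by omega) m) 0) fun m l => by
      rw [mkT_add, map_add, add_zero],
   fun j k h => AddMonoidHom.mk' (fun m => mkU (castHom (show j = k by omega) m) 0) fun m l => by
      rw [mkU_add, map_add, add_zero],
   fun j k h => AddMonoidHom.mk' (fun m => mkU 0 (castHom (show j = k - 1 by omega) m)) fun m l => by
      rw [mkU_add, map_add, add_zero])

theorem genFam_T {j : ℤ} (h : 0 + j = j) (m : M.obj .T j) : (genFam M).1 j j h m = mkT m 0 := rfl

theorem genFam_U {j : ℤ} (h : 0 + j = j) (u : M.obj .U j) : (genFam M).2.1 j j h u = mkU u 0 := rfl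

theorem genFam_U' {j k : ℤ} (h : 0 + 1 + j = k) (h' : j = k - 1) (u : M.obj .U j) :
    (genFam M).2.2 j k h u = mkU 0 (castHom h' u) := rfl

-- The operations on `selfConjInduced M` were defined so as to satisfy these conditions: `zeta'` and
-- `gamma'` are what determine `ζ ε τ [m]` and `γ {u}` there.
variable (M) in
theorem isSelfConjHom_genFam : IsSelfConjHom M M.selfConjInduced 0 (genFam M) := by
  constructor
  · intro j k h j' k' h' hj hk x
    obtain rfl : k = j := by omega
    obtain rfl : k' = j' := by omega
    rw [genFam_T, genFam_T, betaT_mkT, map_zero, map_zero, add_zero]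
  · intro j k h j' k' h' hj hk x
    obtain rfl : k = j := by omega
    obtain rfl : k' = j' := by omega
    rw [genFam_U, genFam_U, betaU_mkU, map_zero]
  · intro j k h j' k' h' hj hk x
    obtain rfl : j = k - 1 := by omega
    obtain rfl : j' = k' - 1 := by omega
    rw [genFam_U' _ rfl, genFam_U' _ rfl, betaU_mkU, map_zero, castHom_rfl, castHom_rfl]
  · intro j k h x
    obtain rfl : k = j := by omega
    rw [genFam_U, genFam_T, zeta_mkT, map_zero, map_zero, map_zero, add_zero]
  · intro j k h j' k' h' hj hk x
    obtain rfl : k = j := by omega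
    obtain rfl : k' = j' := by omega
    rw [genFam_U, genFam_T, gamma_mkU, map_zero, map_zero, map_zero, map_zero, add_zero,
      neg_zero, sgn_zero, one_smul]
  · intro j k h x
    obtain rfl : k = j := by omega
    rw [genFam_U, genFam_U, psiU_mkU, map_zero]
  · intro j k h x
    obtain rfl : j = k - 1 := by omega
    rw [genFam_U' _ rfl, genFam_U' _ rfl, psiU_mkU, map_zero, castHom_rfl, castHom_rfl]
  · intro j k h k' h' hk j' h'' hj x
    obtain rfl : k = j := by omega
    obtain rfl : k' = j' := by omega
    obtain rfl : k = k' - 1 := by omega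
    rw [genFam_U' _ rfl, genFam_U, genFam_T, tau_mkT, map_zero, sub_zero, castHom_rfl, castHom_rfl,
      c_mkO, sgn_zero, one_smul, eq_sub_iff_add_eq, mkU_add, zero_add, add_zero]
  · intro j k h k' h' hk x
    obtain rfl : k = j := by omega
    obtain rfl : k = k' - 1 := by omega
    rw [genFam_U' _ rfl, genFam_U, genFam_T, r_mkU, eps_mkO, gamma_mkU, castHom_rfl, castHom_rfl,
      map_zero, map_zero, map_zero, mkT_add, add_zero, zero_add, zero_add, add_neg_cancel]

variable (M) in
/-- The universal self-conjugate homomorphism. -/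
noncomputable def gen : selfConjHom M M.selfConjInduced 0 := ⟨genFam M, isSelfConjHom_genFam M⟩

end selfConjInduced

variable {P : CRTModule.{u}} {i : ℤ}

/-- The homomorphism which carries `[m]` to `f m`. -/
noncomputable def selfConjExtend (f : Fam M P .T i × Fam M P .U i × Fam M P .U (i + 1)) :
    Fam M.selfConjInduced P .O i × Fam M.selfConjInduced P .U i × Fam M.selfConjInduced P .T i :=
  -- `τ [m]`, `{u}` and `ε τ [m]` each involve `τ` of the universal element once, whence the common
  -- sign `(-1)^i`.
  (fun j k h => sgn i • (P.act (.tau (k - 1) k)).comp (f.1 (j - 1) (k - 1) (by omega)),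
   fun j k h => AddMonoidHom.coprod (f.2.1 j k h) (sgn i • f.2.2 (j - 1) k (by omega)),
   fun j k h => AddMonoidHom.coprod (f.1 j k h) (sgn i • ((P.act (.eps k)).comp
    (P.act (.tau (k - 1) k))).comp (f.1 (j - 1) (k - 1) (by omega))))

variable {f : Fam M P .T i × Fam M P .U i × Fam M P .U (i + 1)}

theorem selfConjExtend_O {j k a : ℤ} (h : i + j = k) (h₁ : k = a + 1) (h₂ : i + (j - 1) = a)
    (m : M.obj .T (j - 1)) : (selfConjExtend f).1 j k h (mkO m) =
      sgn i • P.act (.tau a k h₁) (f.1 (j - 1) a h₂ m) := by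
  obtain rfl : a = k - 1 := by omega
  rfl

theorem selfConjExtend_U {j k : ℤ} (h : i + j = k) (h' : i + 1 + (j - 1) = k) (u : M.obj .U j)
    (u' : M.obj .U (j - 1)) : (selfConjExtend f).2.1 j k h (mkU u u') =
      f.2.1 j k h u + sgn i • f.2.2 (j - 1) k h' u' := rfl

theorem selfConjExtend_T {j k a : ℤ} (h : i + j = k) (h₁ : k = a + 1) (h₂ : i + (j - 1) = a)
    (m : M.obj .T j) (m' : M.obj .T (j - 1)) : (selfConjExtend f).2.2 j k h (mkT m m') =
      f.1 j k h m + sgn i • P.act (.eps k) (P.act (.tau a k h₁) (f.1 (j - 1) a h₂ m')) := by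
  obtain rfl : a = k - 1 := by omega
  rfl

/-- The existence half of the universal property of `selfConjInduced M`. The conditions `zeta'` and
`gamma'` are used exactly for compatibility with `ζ` on `ε τ [m]` and with `γ` on `{u}`. -/
theorem IsSelfConjHom.isRealHom_extend (hf : IsSelfConjHom M P i f) :
    IsRealHom M.selfConjInduced P i (selfConjExtend f) := by
  constructor
  · intro j k h j' k' h' hj hk x
    obtain ⟨m, hm⟩ := exists_mkO x
    rw [hm, betaO_mkO, selfConjExtend_O (j := j') (a := k' - 1) _ (by omega) (by omega),
      selfConjExtend_O (j := j) (a := k - 1) _ (by omega) (by omega),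
      betaT2_apply (a := j + 3) _ (by omega) (by omega),
      hf.betaT (j + 3) (k + 3) (by omega) _ _ _ _ (by omega),
      hf.betaT (j - 1) (k - 1) (by omega) _ _ _ _ (by omega),
      tau_betaT' (b := k) _ _ _ (by omega) hk, map_zsmul]
  · intro j k h j' k' h' hj hk x
    obtain ⟨u, u', rfl⟩ := exists_mkU x
    rw [betaU_mkU, selfConjExtend_U _ (by omega), selfConjExtend_U _ (by omega), map_add, map_zsmul,
      hf.betaU j k h _ _ _ _ hk, hf.betaU' (j - 1) k (by omega) _ _ _ _ hk]
  · intro j k h j' k' h' hj hk x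
    obtain ⟨m, m', rfl⟩ := exists_mkT x
    rw [betaT_mkT, selfConjExtend_T (j := j') (a := k' - 1) _ (by omega) (by omega),
      selfConjExtend_T (j := j) (a := k - 1) _ (by omega) (by omega), map_add,
      hf.etaT (k := k' - 1) (h := by omega) (hk := by omega), hf.betaT j k h _ _ _ _ hk,
      hf.betaT (j - 1) (k - 1) (by omega) _ _ _ _ (by omega), map_add, map_zsmul,
      betaT_eps_tau' (b := k' - 1) _ hk (by omega) (by omega), smul_add, sgn_smul_etaT]
    abel
  · intro j k h x
    obtain ⟨m, hm⟩ := exists_mkO x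
    rw [hm, eps_mkO, selfConjExtend_O (a := k - 1) _ (by omega) (by omega),
      selfConjExtend_T (a := k - 1) _ (by omega) (by omega), map_zero, zero_add, map_zsmul]
  · intro j k h x
    obtain ⟨m, m', rfl⟩ := exists_mkT x
    rw [zeta_mkT, selfConjExtend_U _ (by omega),
      selfConjExtend_T (a := k - 1) _ (by omega) (by omega), map_add, map_add, map_zsmul, zeta_eps,
      hf.zeta, hf.zeta' (j - 1) (k - 1) (by omega) k _ (by omega) j h (by omega), smul_sub,
      smul_sgn_smul]
    abel
  · intro j k h j' k' h' hj hk x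
    obtain ⟨u, u', rfl⟩ := exists_mkU x
    subst hj
    rw [gamma_mkU, castHom_rfl, selfConjExtend_U _ (by omega),
      selfConjExtend_T (a := k' - 1) _ (by omega) (by omega), map_add,
      hf.gamma' _ _ _ k (by omega) (by omega), hf.gamma j k h _ _ _ _ hk, map_neg,
      hf.gamma (j - 1) k' (by omega) _ _ _ _ (by omega), map_neg, map_neg, map_zsmul, map_zsmul,
      smul_neg, smul_sgn_smul, tau_gamma, map_add, map_zsmul, smul_add, smul_sgn_smul]
    abel
  · intro j k h j' k' h' hj hk x
    obtain ⟨m, m', rfl⟩ := exists_mkT x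
    obtain rfl : j = j' - 1 := by omega
    rw [tau_mkT, castHom_rfl, selfConjExtend_O (a := k) _ (by omega) (by omega),
      selfConjExtend_T (a := k - 1) _ (by omega) (by omega), map_sub, sub_eq_add_neg, map_add,
      map_add, map_zsmul, tau_eps_tau,
      hf.etaT (k := k - 1) (h := by omega) (hk := by omega), neg_etaT, smul_add, smul_add,
      smul_sgn_smul, ← map_zsmul _ _ (P.etaT _ _ _ _), sgn_smul_etaT]

end selfConjInduced

end CRTModule

namespace CRTModule

/-! ### Kernels in acyclic CRT-modules -/

namespace Acyclic

variable {M : CRTModule.{u}}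

theorem ker_c (hM : M.Acyclic) {i j : ℤ} (h : j = i + 1) (x : M.obj .O j)
    (hx : M.act (.c j) x = 0) :
    ∃ y, x = M.act (.tau i j h) (M.act (.eps i) y) := by
  subst h
  obtain ⟨y, hy⟩ := (hM.ou_eta_c i x).mp hx
  exact ⟨y, hy.symm⟩

theorem ker_r (hM : M.Acyclic) {i j : ℤ} (h : j = i + 2) (x : M.obj .U i)
    (hx : M.act (.r i) x = 0) :
    ∃ y, M.act (.betaU i j h) x = M.act (.c j) y := by
  obtain ⟨n, rfl⟩ : ∃ n, i = n - 1 := ⟨i + 1, by omega⟩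
  obtain rfl : j = n + 1 := by omega
  obtain ⟨y, hy⟩ := (hM.ou_c_r n (M.act (.betaU (n - 1) (n + 1) h) x)).mp (by
    rw [AddMonoidHom.comp_apply, betaUInv_betaU, hx])
  exact ⟨y, hy.symm⟩

theorem ker_etaO (hM : M.Acyclic) {i j : ℤ} (h : j = i + 1) (x : M.obj .O i)
    (hx : M.act (.tau i j h) (M.act (.eps i) x) = 0) : ∃ y, x = M.act (.r i) y := by
  obtain rfl : i = j - 1 := by omega
  obtain ⟨y, hy⟩ := (hM.ou_r_eta j x).mp hx
  exact ⟨_, hy.symm⟩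

theorem ker_eps (hM : M.Acyclic) {i j k : ℤ} (h : j = i + 1) (h' : k = j + 1) (x : M.obj .O k)
    (hx : M.act (.eps k) x = 0) : ∃ y, x =
      M.act (.tau j k h') (M.act (.eps j) (M.act (.tau i j h) (M.act (.eps i) y))) := by
  subst h
  obtain rfl : k = i + 2 := by omega
  obtain ⟨y, hy⟩ := (hM.ot_eta_eps i x).mp hx
  exact ⟨y, hy.symm⟩

theorem ker_tau (hM : M.Acyclic) {i j k : ℤ} (h : j = i + 4) (h' : k = i + 1) (x : M.obj .T i)
    (hx : M.act (.tau i k h') x = 0) : ∃ y, M.act (.betaT i j h) x = M.act (.eps j) y := by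
  obtain ⟨n, rfl⟩ : ∃ n, i = n - 2 := ⟨i + 2, by omega⟩
  obtain rfl : j = n + 2 := by omega
  obtain rfl : k = n - 1 := by omega
  obtain ⟨y, hy⟩ := (hM.ot_eps_tau n (M.act (.betaT (n - 2) (n + 2) h) x)).mp (by
    rw [AddMonoidHom.comp_apply, betaTInv_betaT, hx])
  exact ⟨y, hy.symm⟩

theorem ker_etaO_etaO (hM : M.Acyclic) {i j k l : ℤ} (h : j = i + 1) (h' : k = j + 1)
    (hl : i = l + 1)
    (x : M.obj .O i)
    (hx : M.act (.tau j k h') (M.act (.eps j) (M.act (.tau i j h) (M.act (.eps i) x))) = 0) :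
    ∃ y, x = M.act (.tau l i hl) y := by
  obtain rfl : i = j - 1 := by omega
  obtain rfl : k = j + 1 := by omega
  obtain rfl : l = j - 2 := by omega
  obtain ⟨y, hy⟩ := (hM.ot_tau_eta j x).mp hx
  exact ⟨_, hy.symm⟩

theorem ker_zeta (hM : M.Acyclic) {i j : ℤ} (h : i = j - 1) (x : M.obj .T i)
    (hx : M.act (.zeta i) x = 0) :
    ∃ y, x = M.act (.gamma j i h) y := by
  obtain rfl : j = i + 1 := by omega
  obtain ⟨y, hy⟩ := (hM.ut_gamma_zeta i x).mp hx
  exact ⟨y, hy.symm⟩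

theorem ker_psiU (hM : M.Acyclic) {i : ℤ} (x : M.obj .U i) (hx : M.act (.psiU i) x = x) :
    ∃ y, x = M.act (.zeta i) y := by
  obtain ⟨y, hy⟩ := (hM.ut_zeta_psi i x).mp (sub_eq_zero.mpr hx.symm)
  exact ⟨y, hy.symm⟩

theorem ker_gamma (hM : M.Acyclic) {i j : ℤ} (h : j = i - 1) (x : M.obj .U i)
    (hx : M.act (.gamma i j h) x = 0) :
    ∃ y, x = y - M.act (.psiU i) y := by
  subst h
  obtain ⟨y, hy⟩ := (hM.ut_psi_gamma i x).mp hx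
  exact ⟨y, hy.symm⟩

/-- If `γ β_U ζ x = 0`, then `β_U ζ x` is of the form `w - ψ_U w`. With `w = β_U v` this is `β_U (v
+ ψ_U v)`, so `ζ x = c r v = ζ ε r v`, and `x - ε r v` lies in the kernel of `ζ`, the image of `γ`.
-/
theorem ker_etaT (hM : M.Acyclic) {i j : ℤ} (h : j = i + 1) (x : M.obj .T i)
    (hx : M.etaT i j h x = 0) :
    ∃ u v, x = M.act (.gamma j i (by omega)) u + M.act (.eps i) (M.act (.r i) v) := by
  rw [etaT_apply (a := i + 2) h rfl (by omega)] at hx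
  obtain ⟨w, hw⟩ := hM.ker_gamma _ _ hx
  obtain ⟨v, rfl⟩ := (M.betaU_bijective i (i + 2) rfl).surjective w
  rw [psiU_betaU', sub_neg_eq_add, ← map_add, ← c_r', ← zeta_eps] at hw
  have hv := (M.betaU_bijective i (i + 2) rfl).injective hw
  obtain ⟨u, hu⟩ := hM.ker_zeta (show i = j - 1 by omega) (x - M.act (.eps i) (M.act (.r i) v)) (by
    rw [map_sub, hv, sub_self])
  exact ⟨u, v, sub_eq_iff_eq_add.mp hu⟩

/-- Write `x = γ u`. Then `c τ x = c r u = u + ψ_U u = 0`, so `β_U⁻¹ u` is fixed by `ψ_U` and equals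
some `ζ y`, giving `x = γ β_U ζ y`. -/
theorem ker_zeta_c_tau (hM : M.Acyclic) {i j k : ℤ} (h : i = j + 1) (hk : k = i + 1)
    (x : M.obj .T i)
    (hx : M.act (.zeta i) x = 0) (hx' : M.act (.c k) (M.act (.tau i k hk) x) = 0) :
    ∃ y, x = M.etaT j i h y := by
  obtain ⟨u, rfl⟩ := hM.ker_zeta (show i = k - 1 by omega) x hx
  rw [tau_gamma, c_r'] at hx'
  obtain ⟨v, rfl⟩ := (M.betaU_bijective j k (by omega)).surjective u
  obtain ⟨y, rfl⟩ := hM.ker_psiU v (by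
    apply (M.betaU_bijective j k (by omega)).injective
    rwa [psiU_betaU', add_neg_eq_zero, eq_comm] at hx')
  exact ⟨y, (etaT_apply _ _ _ _).symm⟩

end Acyclic

/-! ### Vanishing composites -/

section composites

variable {M : CRTModule.{u}}

/-- `β_O τ β_T⁻¹ ε = τ β_T² β_T⁻¹ ε = τ β_T ε = 0`, and `β_O` is injective. -/
theorem tau_betaTInv_eps {i j k : ℤ} (h : j = i - 4) (h' : k = j + 1) (x : M.obj .O i) :
    M.act (.tau j k h') (M.act (.betaTInv i j h) (M.act (.eps i) x)) = 0 := by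
  apply (injective_iff_map_eq_zero _).mp (M.betaO_bijective k (k + 8) rfl).injective
  rw [← tau_betaT' (a := i) (j := i + 4) (by omega) rfl (by omega) h', betaT_betaTInv,
    tau_betaT_eps']

theorem r_betaUInv_c {i j : ℤ} (h : j = i - 2) (x : M.obj .O i) :
    M.act (.r j) (M.act (.betaUInv i j h) (M.act (.c i) x)) = 0 := by
  -- `γ β_U⁻¹ c = β_T⁻¹ γ β_U ζ ε = β_T⁻¹ η_T ε = β_T⁻¹ ε τ ε`, which `τ` annihilates by the
  -- previous lemma.
  have h₁ : M.act (.gamma j (j - 1)) (M.act (.betaUInv i j h) (M.act (.c i) x)) =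
      M.act (.betaTInv (i + 1) (j - 1)) (M.act (.eps (i + 1)) (M.act (.tau i (i + 1))
        (M.act (.eps i) x))) := by
    apply (M.betaT_bijective (j - 1) (i + 1) (by omega)).injective
    rw [betaT_betaTInv, ← gamma_betaU' (a := i) (j := i + 2) (by omega) rfl (by omega) rfl,
      betaU_betaUInv, eps_tau_eps, etaT_apply (a := i + 2) _ rfl (by omega), zeta_eps]
  rw [← tau_gamma (a := j - 1) rfl (by omega), h₁, tau_betaTInv_eps]

theorem eps_tau_eps_tau_eps {i j k : ℤ} (h : j = i + 1) (h' : k = j + 1) (x : M.obj .O i) :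
    M.act (.eps k) (M.act (.tau j k h') (M.act (.eps j) (M.act (.tau i j h) (M.act (.eps i) x)))) =
      0 := by
  rw [eps_tau_eps, eps_tau_eps, etaT_etaT]

theorem tau_eps_tau_eps_tau {i j k l : ℤ} (h : j = i + 1) (h' : k = j + 1) (h'' : l = k + 1)
    (x : M.obj .T i) :
    M.act (.tau k l h'') (M.act (.eps k) (M.act (.tau j k h') (M.act (.eps j)
      (M.act (.tau i j h) x)))) = 0 := by
  rw [tau_eps_tau h h', tau_eps_tau h' h'', etaT_etaT, map_zero]

/-- `γ β_U⁻¹ c τ + ε r β_U⁻¹ ζ = 0` -/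
theorem gamma_betaUInv_c_tau {i a b e : ℤ} (h : a = i + 1) (h₁ : b = a - 2)
    (h₂ : e = b - 1) (h₃ : e = i - 2) (x : M.obj .T i) :
    M.act (.gamma b e h₂) (M.act (.betaUInv a b h₁) (M.act (.c a) (M.act (.tau i a h) x))) +
      M.act (.eps e) (M.act (.r e) (M.act (.betaUInv i e h₃) (M.act (.zeta i) x))) = 0 := by
  apply (injective_iff_map_eq_zero _).mp (M.betaT_bijective e (i + 2) (by omega)).injective
  rw [map_add, ← gamma_betaU' (a := a) (j := a + 2) (by omega) rfl (by omega) h₂, betaU_betaUInv,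
    ← eps_r_betaU (a := i) (by omega) rfl (by omega), betaU_betaUInv, gamma_betaU_c_tau]

end composites

/-! ### Formulas for operations on graded homomorphisms -/

section formulas

variable {M P : CRTModule.{u}} {i a j k l : ℤ}

theorem complexR_O {f : Fam M P .U i} (h : a = i - 1) (h' : i = a + 1) (hk : i + j = k) (x) :
    (selfConjTau a i h' (complexGamma i a h f)).1 j k hk x =
      P.act (.r k) (f j k hk (M.act (.c j) x)) := by
  rw [selfConjTau_O _ hk (b := k - 1) (by omega) (by omega), complexGamma_T _ _ hk rfl, tau_gamma,
    zeta_eps]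

theorem complexR_U {f : Fam M P .U i} (h : a = i - 1) (h' : i = a + 1) (hk : i + j = k) (x) :
    (selfConjTau a i h' (complexGamma i a h f)).2.1 j k hk x =
      f j k hk x + P.act (.psiU k) (f j k hk (M.act (.psiU j) x)) := by
  rw [selfConjTau_U _ hk (by omega), complexGamma_U' _ _ hk]

theorem complexR_T {f : Fam M P .U i} (h : a = i - 1) (h' : i = a + 1) (hk : i + j = k)
    (hj : l = j + 1) {k'} (hk' : i + l = k') (hkk : k = k' - 1) (x) :
    (selfConjTau a i h' (complexGamma i a h f)).2.2 j k hk x =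
      P.act (.eps k) (P.act (.r k) (f j k hk (M.act (.zeta j) x))) +
        sgn i • P.act (.gamma k' k hkk) (f l k' hk' (M.act (.c l) (M.act (.tau j l hj) x))) := by
  rw [selfConjTau_T _ hk (b := k - 1) (a' := l) (by omega) (by omega) hj (by omega),
    complexGamma_T _ _ hk (by omega), tau_gamma, etaT_gamma, sub_zero,
    complexGamma_T _ _ (b := k') (by omega) (by omega), zeta_eps, sgn_pred h, neg_smul,
      sub_neg_eq_add]

theorem IsRealHom.etaO_O {f} (hf : IsRealHom M P i f) (h : a = i + 1) (hk : a + j = k)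
    (hb : i + j = l) (hkb : k = l + 1) (x) : (selfConjTau i a h (realEps i f)).1 j k hk x =
      P.act (.tau l k hkb) (P.act (.eps l) (f.1 j l hb x)) := by
  rw [selfConjTau_O h hk hb hkb, ← hf.eps]
  rfl

theorem IsRealHom.etaO_T {f} (hf : IsRealHom M P i f) (h : a = i + 1) (hk : a + j = k)
    (hb : i + j = l) (hkb : k = l + 1) (x) : (selfConjTau i a h (realEps i f)).2.2 j k hk x =
      P.etaT l k hkb (f.2.2 j l hb x) := by
  rw [selfConjTau_T h hk hb hkb (a' := j + 1) rfl (by omega)]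
  dsimp only [realEps]
  -- `f` commutes with `ε τ` up to `(-1)^i`, so the first two terms cancel and only `-η_T f = η_T f`
  -- survives.
  rw [hf.eps, hf.tau j l hb _ _ _ _ hkb, map_zsmul, smul_sgn_smul, sub_self, zero_sub, neg_etaT]

end formulas

/-! ### Extending elements of the CRT-modules of graded homomorphisms -/

section extension

variable {M B N : CRTModule.{u}} [Injective N] {d e i : ℤ}

theorem exists_postcomp_eq_of_real (h : e + d = i) (a : realHom M B d) (f : realHom M N i)
    (hO : ∀ j k hk k' hk' x, a.1.1 j k hk x = 0 → f.1.1 j k' hk' x = 0)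
    (hU : ∀ j k hk k' hk' x, a.1.2.1 j k hk x = 0 → f.1.2.1 j k' hk' x = 0)
    (hT : ∀ j k hk k' hk' x, a.1.2.2 j k hk x = 0 → f.1.2.2 j k' hk' x = 0) :
    ∃ g : realHom B N e, postcompFam M g .O d i h a = f := by
  obtain ⟨g, h₁, h₂, h₃⟩ := exists_realHom_comp_eq h a.2 f.2 hO hU hT
  refine ⟨g, realHom_ext (M := M) (P := N) ?_ ?_ ?_⟩ <;> intro j k hk x
  · exact (h₁ _ _ _ _ _ _ _).symm
  · exact (h₂ _ _ _ _ _ _ _).symm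
  · exact (h₃ _ _ _ _ _ _ _).symm

-- The three hypotheses compare, part by part, the kernels of the extensions of `a` and `f` to
-- `complexInduced M`, on the elements `r [x]`, `[x] + ψ_U [x']` and `γ [x] + ε r [x']`.
open complexInduced in
theorem exists_postcomp_eq_of_complex (h : e + d = i) (a : complexHom M B d) (f : complexHom M N i)
    (hO : ∀ j k hk k' hk' x, B.act (.r k) (a.1 j k hk x) = 0 → N.act (.r k') (f.1 j k' hk' x) = 0)
    (hU : ∀ j k hk k' hk' x x', a.1 j k hk x + B.act (.psiU k) (a.1 j k hk x') = 0 →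
      f.1 j k' hk' x + N.act (.psiU k') (f.1 j k' hk' x') = 0)
    (hT : ∀ j l k m hk hm hkm k' m' hk' hm' hkm' x x', l = j + 1 →
      sgn d • B.act (.gamma m k hkm) (a.1 l m hm x) + B.act (.eps k) (B.act (.r k)
        (a.1 j k hk x')) =
        0 → sgn i • N.act (.gamma m' k' hkm') (f.1 l m' hm' x) +
          N.act (.eps k') (N.act (.r k') (f.1 j k' hk' x')) = 0) :
    ∃ g : realHom B N e, postcompFam M g .U d i h a = f := by
  obtain ⟨g, h₁, h₂, h₃⟩ := exists_realHom_comp_eq h (IsComplexHom.isRealHom_extend a.2)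
    (IsComplexHom.isRealHom_extend f.2) (fun j k hk k' hk' x => hO j k hk k' hk' x)
    (fun j k hk k' hk' x => by
      obtain ⟨u, u', rfl⟩ := exists_mkU x
      exact hU j k hk k' hk' u u')
    (fun j k hk k' hk' x => by
      obtain ⟨u, u', rfl⟩ := exists_mkT x
      rw [complexExtend_T (a := k + 1) _ (by omega) (by omega),
        complexExtend_T (a := k' + 1) _ (by omega) (by omega)]
      exact hT j (j + 1) k (k + 1) hk _ _ k' (k' + 1) hk' _ _ u u' rfl)
  refine ⟨g, complexHom_ext (M := M) (P := N) fun j k hk x => ?_⟩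
  -- At the generators `[x]` the extensions of `a` and `f` return `a` and `f`.
  have := h₂ j (d + j) rfl k hk (by omega) (mkU x 0)
  rw [complexExtend_U, complexExtend_U, map_zero, map_zero, add_zero, map_zero, map_zero,
    add_zero] at this
  exact this.symm

-- The analogue for `selfConjInduced M`: the hypotheses compare kernels on `τ [x]`, on `[x] + {x'}`
-- and on `[x] + ε τ [x']`.
open selfConjInduced in
theorem exists_postcomp_eq_of_selfConj (h : e + d = i) (a : selfConjHom M B d)
    (f : selfConjHom M N i)
    (hO : ∀ j k m hk hm k' m' hk' hm' x, B.act (.tau k m hm) (a.1.1 j k hk x) = 0 →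
      N.act (.tau k' m' hm') (f.1.1 j k' hk' x) = 0)
    (hU : ∀ j l k hk hl k' hk' hl' x x', l = j - 1 →
      a.1.2.1 j k hk x + sgn d • a.1.2.2 l k hl x' = 0 →
      f.1.2.1 j k' hk' x + sgn i • f.1.2.2 l k' hl' x' = 0)
    (hT : ∀ j l k m hk hm hkm k' m' hk' hm' hkm' x x', l = j - 1 →
      a.1.1 j k hk x + sgn d • B.act (.eps k) (B.act (.tau m k hkm) (a.1.1 l m hm x')) = 0 →
      f.1.1 j k' hk' x + sgn i • N.act (.eps k')
        (N.act (.tau m' k' hkm') (f.1.1 l m' hm' x')) = 0) :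
    ∃ g : realHom B N e, postcompFam M g .T d i h a = f := by
  obtain ⟨g, h₁, h₂, h₃⟩ := exists_realHom_comp_eq h (IsSelfConjHom.isRealHom_extend a.2)
    (IsSelfConjHom.isRealHom_extend f.2)
    (fun j k hk k' hk' x hx => by
      obtain ⟨m, hm⟩ := exists_mkO x
      rw [hm, selfConjExtend_O (a := k - 1) _ (by omega) (by omega)] at hx
      rw [hm, selfConjExtend_O (a := k' - 1) _ (by omega) (by omega),
        hO (j - 1) (k - 1) k (by omega) (by omega) _ _ _ _ m, smul_zero]
      rw [← smul_sgn_smul d (B.act _ _), hx, smul_zero])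
    (fun j k hk k' hk' x => by
      obtain ⟨u, u', rfl⟩ := exists_mkU x
      rw [selfConjExtend_U _ (by omega), selfConjExtend_U _ (by omega)]
      exact hU j (j - 1) k hk _ k' hk' _ u u' rfl)
    (fun j k hk k' hk' x => by
      obtain ⟨m, m', rfl⟩ := exists_mkT x
      rw [selfConjExtend_T (a := k - 1) _ (by omega) (by omega),
        selfConjExtend_T (a := k' - 1) _ (by omega) (by omega)]
      exact hT j (j - 1) k (k - 1) hk _ _ k' (k' - 1) hk' _ _ m m' rfl)
  refine ⟨g, selfConjHom_ext (M := M) (P := N) ?_ ?_ ?_⟩ <;> intro j k hk x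
  · have := h₃ j (d + j) rfl k hk (by omega) (mkT x 0)
    rw [selfConjExtend_T (i := i) (j := j) (k := k) (a := k - 1) _ (by omega) (by omega),
      selfConjExtend_T (i := d) (j := j) (k := d + j) (a := d + j - 1) _ (by omega) (by omega),
        map_zero, map_zero, map_zero, smul_zero,
      add_zero, map_zero, map_zero, map_zero, smul_zero, add_zero] at this
    exact this.symm
  · have := h₂ j (d + j) rfl k hk (by omega) (mkU x 0)
    rw [selfConjExtend_U _ (by omega), selfConjExtend_U _ (by omega), map_zero, map_zero, smul_zero,
      add_zero, smul_zero, add_zero] at this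
    exact this.symm
  · obtain ⟨j', rfl⟩ : ∃ j', j = j' - 1 := ⟨j + 1, by omega⟩
    have := h₂ j' (d + j') rfl k (by omega) (by omega) (mkU 0 x)
    rw [selfConjExtend_U _ (by omega), selfConjExtend_U _ (by omega), map_zero, map_zero, zero_add,
      zero_add, map_zsmul] at this
    refine (compSelfConj_U' (l := d + j') (by omega) (by omega) x).trans ?_
    -- The sign `(-1)^e` of `compSelfConj` agrees with the signs `(-1)^i` and `(-1)^d` of the two
    -- extensions because `e + d = i`.
    rw [← smul_sgn_smul i (f.1.2.2 _ _ _ _), this, smul_smul]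
    congr 1
    rw [← h, sgn_add, mul_assoc]
    rcases sgn_cases d with hd | hd <;> rw [hd] <;> simp

end extension

end CRTModule

namespace CRTModule

/-! ### The identity and the operations on composites -/

section operations

variable {M B N : CRTModule.{u}} {e i : ℤ}

variable (M) in
/-- The identity homomorphism, as a homomorphism of degree `0`. -/
noncomputable def gradedId : realHom M M 0 :=
  ⟨(fun _ _ h => castHom (by omega), fun _ _ h => castHom (by omega),
    fun _ _ h => castHom (by omega)), by
    constructor
    case eps | zeta =>
      intro j k h x
      obtain rfl : k = j := by omega
      rfl
    case gamma | tau =>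
      intro j k h j' k' h' hj hk x
      obtain rfl : k = j := by omega
      obtain rfl : k' = j' := by omega
      rw [sgn_zero, one_smul]
      rfl
    all_goals
      intro j k h j' k' h' hj hk x
      obtain rfl : k = j := by omega
      obtain rfl : k' = j' := by omega
      rfl⟩

theorem isRealHom_gradedId : IsRealHom M M 0 (gradedId M).1 := (gradedId M).2

theorem postcompFam_eps (g : realHom B N e) {j k h x} :
    postcompFam M g .T j k h ((internalHom M B).act (.eps j) x) =
      (internalHom M N).act (.eps k) (postcompFam M g .O j k h x) :=
  (isRealHom_postcompFam M g).eps j k h x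

theorem postcompFam_zeta (g : realHom B N e) {j k h x} :
    postcompFam M g .U j k h ((internalHom M B).act (.zeta j) x) =
      (internalHom M N).act (.zeta k) (postcompFam M g .T j k h x) :=
  (isRealHom_postcompFam M g).zeta j k h x

theorem postcompFam_c (g : realHom B N e) {j k h x} :
    postcompFam M g .U j k h ((internalHom M B).act (.c j) x) =
      (internalHom M N).act (.c k) (postcompFam M g .O j k h x) :=
  (isRealHom_postcompFam M g).c j k h x

theorem postcompFam_r (g : realHom B N e) {j k h x} :
    postcompFam M g .O j k h ((internalHom M B).act (.r j) x) =
      (internalHom M N).act (.r k) (postcompFam M g .U j k h x) :=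
  (isRealHom_postcompFam M g).r j k h x

theorem postcompFam_psiU (g : realHom B N e) {j k h x} :
    postcompFam M g .U j k h ((internalHom M B).act (.psiU j) x) =
      (internalHom M N).act (.psiU k) (postcompFam M g .U j k h x) :=
  (isRealHom_postcompFam M g).psiU j k h x

theorem postcompFam_gamma (g : realHom B N e) {j k j' k' h'} (h hj hk) {x} :
    postcompFam M g .T j' k' h' ((internalHom M B).act (.gamma j j' hj) x) =
      sgn e • (internalHom M N).act (.gamma k k' hk) (postcompFam M g .U j k h x) :=
  (isRealHom_postcompFam M g).gamma j k h j' k' h' hj hk x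

theorem postcompFam_tau (g : realHom B N e) {j k j' k' h'} (h hj hk) {x} :
    postcompFam M g .O j' k' h' ((internalHom M B).act (.tau j j' hj) x) =
      sgn e • (internalHom M N).act (.tau k k' hk) (postcompFam M g .T j k h x) :=
  (isRealHom_postcompFam M g).tau j k h j' k' h' hj hk x

theorem postcompFam_etaO (g : realHom B N e) {j k j' k' h'} (h hj hk) {x} :
    postcompFam M g .O j' k' h'
      ((internalHom M B).act (.tau j j' hj) ((internalHom M B).act (.eps j) x)) =
      sgn e • (internalHom M N).act (.tau k k' hk)
        ((internalHom M N).act (.eps k) (postcompFam M g .O j k h x)) := by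
  rw [postcompFam_tau g h hj hk, postcompFam_eps]

/-- `c r` sends `f` to `f + ψ_U f ψ_U`, and `ψ_U = c r - 1`. -/
theorem complexHom_psiU_apply (f : complexHom M N i) {j k} (h : i + j = k) (x) :
    Subtype.val (p := (· ∈ complexHom M N i)) ((internalHom M N).act (.psiU i) f) j k h x =
      N.act (.psiU k) (f.1 j k h (M.act (.psiU j) x)) := by
  change (complexGamma i (i - 1) rfl f.1).2.2 j k (by omega) x + - f.1 j k h x = _
  rw [complexGamma_U' _ _ h]
  abel

end operations

/-! ### Exactness for the CRT-module of graded homomorphisms -/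

section exactness

variable {M N : CRTModule.{u}} [Injective N] {i : ℤ}

/-- `η_O` of the identity is `η_O` on the real part, `0` on the complex part and `η_T` on the
self-conjugate part. In `M` its kernels are the image of `r`, everything, and the sum of the images
of `γ` and `ε r`. All of these are killed by `f`, whose complex component is zero. -/
theorem exists_etaO_eq (hM : M.Acyclic) {n : ℤ} (h : i = n + 1) (f : realHom M N i)
    (hf : (internalHom M N).act (.c i) f = 0) : ∃ y, (internalHom M N).act (.tau n i h)
      ((internalHom M N).act (.eps n) y) = f := by
  have hr : IsRealHom M N i f.1 := f.2
  have hU : ∀ j k hk x, f.1.2.1 j k hk x = 0 := fun j k hk x =>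
    congrArg (fun F : complexHom M N i => F.1 j k hk x) hf
  let a : realHom M M 1 :=
    (internalHom M M).act (.tau 0 1) ((internalHom M M).act (.eps 0) (gradedId M))
  obtain ⟨g, hg⟩ := exists_postcomp_eq_of_real (e := n) (by omega) a f
    (fun j k hk k' hk' x hx => by
      obtain rfl : k = j + 1 := by omega
      obtain ⟨v, rfl⟩ := hM.ker_etaO rfl x
        ((isRealHom_gradedId.etaO_O (zero_add 1).symm hk (zero_add j) rfl x).symm.trans hx)
      rw [hr.r, hU, map_zero])
    (fun _ _ _ _ _ _ _ => hU _ _ _ _)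
    (fun j k hk k' hk' x hx => by
      obtain rfl : k = j + 1 := by omega
      obtain ⟨u, v, rfl⟩ := hM.ker_etaT rfl x
        ((isRealHom_gradedId.etaO_T (zero_add 1).symm hk (zero_add j) rfl x).symm.trans hx)
      rw [map_add, hr.gamma (j + 1) (k' + 1) (by omega) _ _ _ _ (by omega), hU, hr.eps, hr.r, hU,
        map_zero, map_zero, map_zero, smul_zero, add_zero])
  -- The factor `(-1)^n` undoes the sign from moving `g` past `τ`.
  refine ⟨sgn n • postcompFam M g .O 0 n (by omega) (gradedId M), ?_⟩
  rw [map_zsmul, map_zsmul]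
  exact (postcompFam_etaO g _ _ _).symm.trans hg

/-- `c` of the identity extends to the homomorphism `complexInduced M ⟶ M` with `[u] ↦ u`. What has
to be shown is that its kernel is annihilated by the extension of `β_U f`; the three components of
`r f = 0` are `hO`, `hU`, `hT`. -/
theorem exists_c_eq (hM : M.Acyclic) {n : ℤ} (h : n = i + 2) (f : complexHom M N i)
    (hf : (internalHom M N).act (.r i) f = 0) : ∃ y, (internalHom M N).act (.c n) y =
      (internalHom M N).act (.betaU i n h) f := by
  have hc : IsComplexHom M N i f.1 := f.2
  have hO : ∀ j k hk x, N.act (.r k) (f.1 j k hk (M.act (.c j) x)) = 0 := fun j k hk x =>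
    (complexR_O rfl (by omega) hk x).symm.trans
      (congrArg (fun F : realHom M N i => F.1.1 j k hk x) hf)
  have hU : ∀ j k hk x, f.1 j k hk x + N.act (.psiU k) (f.1 j k hk (M.act (.psiU j) x)) = 0 :=
    fun j k hk x => (complexR_U rfl (by omega) hk x).symm.trans
      (congrArg (fun F : realHom M N i => F.1.2.1 j k hk x) hf)
  have hT : ∀ j k l k' hk hk' hj hkk x,
      N.act (.eps k) (N.act (.r k) (f.1 j k hk (M.act (.zeta j) x))) +
        sgn i • N.act (.gamma k' k hkk) (f.1 l k' hk' (M.act (.c l) (M.act (.tau j l hj) x))) = 0 :=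
    fun j k l k' hk hk' hj hkk x => (complexR_T rfl (by omega) hk hj hk' hkk x).symm.trans
      (congrArg (fun F : realHom M N i => F.1.2.2 j k hk x) hf)
  let F : complexHom M N n := (internalHom M N).act (.betaU i n h) f
  have hF : ∀ j k hk j' hj hk' x, F.1 j k hk x = f.1 j' k hk' (M.act (.betaU j j' hj) x) :=
    fun j k hk j' hj hk' x => (complexBetaU_apply h hk (b := k - 2) (by omega) (by omega) x).trans
      (hc _ _ _ _ _ _ _ _ _).symm
  obtain ⟨g, hg⟩ := exists_postcomp_eq_of_complex (e := n) (by omega)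
    ((internalHom M M).act (.c 0) (gradedId M)) F
    (fun j k hk k' hk' x hx => by
      obtain rfl : k = j := by omega
      obtain ⟨y, hy⟩ := hM.ker_r rfl x hx
      rw [hF _ _ _ (k + 2) rfl (by omega), hy, hO])
    (fun j k hk k' hk' x x' hx => by
      obtain rfl : k = j := by omega
      have hx : x = - M.act (.psiU k) x' := eq_neg_of_add_eq_zero_left hx
      rw [hF _ _ _ (k + 2) rfl (by omega), hF _ _ _ (k + 2) rfl (by omega), hx, map_neg,
        ← psiU_betaU', ← psiU_psiU' (M.act (.betaU _ _ _) x')]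
      conv_lhs => enter [1]; rw [psiU_psiU']
      exact hU _ _ _ _)
    (fun j l k m hk hm hkm k' m' hk' hm' hkm' x x' hl hx => by
      obtain rfl : k = j := by omega
      obtain rfl : m = l := by omega
      have hx : M.act (.gamma m k hkm) x + M.act (.eps k) (M.act (.r k) x') = 0 := by
        rw [sgn_zero, one_smul] at hx
        exact hx
      -- Applying `τ` and `ζ` to `γ x + ε r x' = 0` gives `r x = 0` and `x' + ψ_U x' = 0`.
      -- Acyclicity then yields `β_U x = c y` and `β_U x' = ζ t`.
      have hτ := congrArg (M.act (.tau k m hl)) hx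
      rw [map_add, tau_gamma, tau_eps_r, add_zero, map_zero] at hτ
      have hζ := congrArg (M.act (.zeta k)) hx
      rw [map_add, zeta_gamma', zero_add, zeta_eps, c_r', map_zero] at hζ
      obtain ⟨y, hy⟩ := hM.ker_r (j := m + 2) rfl x hτ
      obtain ⟨t, ht⟩ := hM.ker_psiU (M.act (.betaU k (k + 2)) x') (by
        rw [psiU_betaU', ← map_neg, ← eq_neg_of_add_eq_zero_left hζ])
      -- Since `ε r x' = -γ β_U⁻¹ c τ t`, the relation becomes `γ β_U⁻¹ c (y - τ t) = 0`. Hence `c y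
      -- = c τ t + v + ψ_U v` with `v = β_U w`.
      have hxy : M.act (.gamma m k hkm) (M.act (.betaUInv (m + 2) m)
          (M.act (.c (m + 2)) (y - M.act (.tau (k + 2) (m + 2)) t))) = 0 := by
        have h₁ := gamma_betaUInv_c_tau (i := k + 2) (a := m + 2) (b := m) (e := k) (by omega)
          (by omega) hkm (by omega) t
        rw [← ht, betaUInv_betaU] at h₁
        rw [map_sub, map_sub, map_sub, ← hy, betaUInv_betaU, eq_neg_of_add_eq_zero_left h₁,
          sub_neg_eq_add, hx]
      obtain ⟨w, hw⟩ := hM.ker_gamma _ _ hxy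
      have hv := congrArg (M.act (.betaU m (m + 2))) hw
      rw [betaU_betaUInv, map_sub (M.act (.betaU m _ _)), ← neg_eq_iff_eq_neg.mpr
        (psiU_betaU' (j := m + 2) rfl w),
        sub_neg_eq_add, map_sub, sub_eq_iff_eq_add] at hv
      -- `γ f (v + ψ_U v)` is `γ` of the expression in `hU`, because `γ ψ_U = γ`. The terms in `t`
      -- that remain are the expression in `hT`.
      rw [hF _ _ _ (m + 2) rfl (by omega), hF _ _ _ (k + 2) rfl (by omega), hy, ht, hv, map_add,
        map_add, map_add, map_add, ← gamma_psiU' hkm' (f.1 _ _ _ (M.act (.psiU _) _)), ← map_add,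
        hU, map_zero, zero_add, add_comm, sgn_of_even 1 (show n = i + (1 + 1) by omega)]
      exact hT _ _ _ _ _ _ _ _ _)
  exact ⟨postcompFam M g .O 0 n (by omega) (gradedId M), (postcompFam_c g).symm.trans hg⟩

-- `r` of the universal element is the homomorphism `M ⟶ complexInduced M` sending `x` to `r [c x]`,
-- `u` to `[u] + ψ_U [ψ_U u]`, and `m` to `γ [c τ m] + ε r [ζ m]`. Its kernels are the image of
-- `η_O`, zero, and the image of `η_T` by `ker_zeta_c_tau`, and `f` kills them since `η_O f = 0`.
open complexInduced in
theorem exists_r_eq (hM : M.Acyclic) {n : ℤ} (h : n = i + 1) (f : realHom M N i)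
    (hf : (internalHom M N).act (.tau i n h) ((internalHom M N).act (.eps i) f) = 0) :
    ∃ y, (internalHom M N).act (.r i) y = f := by
  have hr : IsRealHom M N i f.1 := f.2
  have hO : ∀ j k l hk hl x, N.act (.tau k l hl) (N.act (.eps k) (f.1.1 j k hk x)) = 0 :=
    fun j k l hk hl x => (hr.etaO_O h (by omega) hk hl x).symm.trans
      (congrArg (fun F : realHom M N n => F.1.1 j l (by omega) x) hf)
  have hT : ∀ j k l hk hl x, N.etaT k l hl (f.1.2.2 j k hk x) = 0 :=
    fun j k l hk hl x => (hr.etaO_T h (by omega) hk hl x).symm.trans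
      (congrArg (fun F : realHom M N n => F.1.2.2 j l (by omega) x) hf)
  obtain ⟨g, hg⟩ := exists_postcomp_eq_of_real (e := i) (by omega)
    ((internalHom M M.complexInduced).act (.r 0) (gen M)) f
    (fun j k hk k' hk' x hx => by
      obtain rfl : k = j := by omega
      have h₁ := (complexR_O (f := (gen M).1) rfl (by omega) hk x).symm.trans hx
      rw [gen_apply, r_mkU, add_zero] at h₁
      obtain ⟨y, rfl⟩ := hM.ker_c (i := k - 1) (by omega) x h₁
      rw [hr.tau (k - 1) (k' - 1) (by omega) _ _ _ _ (by omega), hr.eps, hO, smul_zero])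
    (fun j k hk k' hk' x hx => by
      obtain rfl : k = j := by omega
      have h₁ := (complexR_U (f := (gen M).1) rfl (by omega) hk x).symm.trans hx
      rw [gen_apply, gen_apply, psiU_mkU, mkU_add, add_zero] at h₁
      have h₂ : x = 0 := congrArg (Prod.fst (α := M.obj .U k) (β := M.obj .U k)) h₁
      rw [h₂, map_zero])
    (fun j k hk k' hk' x hx => by
      obtain rfl : k = j := by omega
      have h₁ := (complexR_T (f := (gen M).1) rfl (by omega) hk (l := k + 1) rfl (k' := k + 1)
        (by omega) (by omega) x).symm.trans hx
      rw [gen_apply, gen_apply, r_mkU, eps_mkO, gamma_mkU, add_zero, add_zero, castHom_rfl,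
        sgn_zero, one_smul, mkT_add, add_zero, zero_add] at h₁
      obtain ⟨y, rfl⟩ := hM.ker_zeta_c_tau (j := k - 1) (by omega) rfl x
        (congrArg (Prod.snd (α := M.obj .U (k + 1)) (β := M.obj .U k)) h₁)
        (congrArg (Prod.fst (α := M.obj .U (k + 1)) (β := M.obj .U k)) h₁)
      rw [hr.etaT (k := k' - 1) (h := by omega) (hk := by omega), hT])
  exact ⟨postcompFam M g .U 0 i (by omega) (gen M), (postcompFam_r g).symm.trans hg⟩

/-- `ε f = 0` leaves only the real component of `f`. The kernel of `η_O²` is the image of `τ`, and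
there `f τ` is `± τ` of the vanishing self-conjugate component. -/
theorem exists_etaO_etaO_eq (hM : M.Acyclic) {m n : ℤ} (h : i = m + 1) (h' : m = n + 1)
    (f : realHom M N i) (hf : (internalHom M N).act (.eps i) f = 0) :
    ∃ y, (internalHom M N).act (.tau m i h) ((internalHom M N).act (.eps m)
      ((internalHom M N).act (.tau n m h') ((internalHom M N).act (.eps n) y))) = f := by
  have hr : IsRealHom M N i f.1 := f.2
  have hU : ∀ j k hk x, f.1.2.1 j k hk x = 0 := fun j k hk x =>
    congrArg (fun F : selfConjHom M N i => F.1.2.1 j k hk x) hf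
  have hT : ∀ j k hk x, f.1.2.2 j k hk x = 0 := fun j k hk x =>
    congrArg (fun F : selfConjHom M N i => F.1.1 j k hk x) hf
  let b : realHom M M 1 :=
    (internalHom M M).act (.tau 0 1) ((internalHom M M).act (.eps 0) (gradedId M))
  have hb : IsRealHom M M 1 b.1 := b.2
  obtain ⟨g, hg⟩ := exists_postcomp_eq_of_real (e := n) (d := 2) (by omega)
    ((internalHom M M).act (.tau 1 2) ((internalHom M M).act (.eps 1) b)) f
    (fun j k hk k' hk' x hx => by
      obtain rfl : k = j + 1 + 1 := by omega
      have h₁ := (hb.etaO_O (by omega) hk (by omega) rfl x).symm.trans hx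
      have h₂ : b.1.1 j (j + 1) (by omega) x = _ :=
        isRealHom_gradedId.etaO_O (zero_add 1).symm (by omega) (zero_add j) rfl x
      rw [h₂] at h₁
      obtain ⟨y, rfl⟩ := hM.ker_etaO_etaO (l := j - 1) rfl rfl (by omega) x h₁
      rw [hr.tau (j - 1) (k' - 1) (by omega) _ _ _ _ (by omega), hT, map_zero, smul_zero])
    (fun _ _ _ _ _ _ _ => hU _ _ _ _) (fun _ _ _ _ _ _ _ => hT _ _ _ _)
  refine ⟨postcompFam M g .O 0 n (by omega) (gradedId M), ?_⟩
  have h₁ := postcompFam_etaO (M := M) g (j := 1) (j' := 2) (k := m) (k' := i) (h' := by omega)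
    (by omega) rfl h (x := b)
  have h₂ := postcompFam_etaO (M := M) g (j := 0) (j' := 1) (k := n) (k' := m) (h' := by omega)
    (by omega) rfl h' (x := gradedId M)
  refine Eq.trans ?_ (h₁.symm.trans hg)
  refine Eq.trans ?_ (congrArg (fun F => sgn n • (internalHom M N).act (.tau m i h)
    ((internalHom M N).act (.eps m) F)) h₂).symm
  -- `g` passes `τ` twice, so the signs cancel.
  rw [map_zsmul, map_zsmul, smul_sgn_smul]

/-- `ε` of the identity extends to the homomorphism `selfConjInduced M ⟶ M` with `[m] ↦ m` and `{u}
↦ 0`. On its real kernel `τ m = 0`, so `β_T m = ε y`; in the other parts the kernel condition can be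
solved for the first coordinate. -/
theorem exists_eps_eq (hM : M.Acyclic) {n l : ℤ} (h : n = i + 4) (hl : l = i + 1)
    (f : selfConjHom M N i) (hf : (internalHom M N).act (.tau i l hl) f = 0) :
    ∃ y, (internalHom M N).act (.eps n) y = (internalHom M N).act (.betaT i n h) f := by
  have hs : IsSelfConjHom M N i f.1 := f.2
  have hO : ∀ j k k' hk hk' x, N.act (.tau k k' hk') (f.1.1 j k hk (M.act (.eps j) x)) = 0 :=
    fun j k k' hk hk' x => (selfConjTau_O hl (by omega) hk hk' x).symm.trans
      (congrArg (fun F : realHom M N l => F.1.1 j k' (by omega) x) hf)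
  have hU : ∀ j k hk x, f.1.2.2 j k hk x = 0 := fun j k hk x =>
    congrArg (fun F : realHom M N l => F.1.2.1 j k (by omega) x) hf
  have hT : ∀ j k j' k' hk hk' hj hkk x,
      N.act (.eps k') (N.act (.tau k k' hkk) (f.1.1 j k hk x)) -
        sgn i • f.1.1 j' k' hk' (M.act (.eps j') (M.act (.tau j j' hj) x)) -
        N.etaT k k' hkk (f.1.1 j k hk x) = 0 :=
    fun j k j' k' hk hk' hj hkk x => (selfConjTau_T hl (by omega) hk hkk hj hk' x).symm.trans
      (congrArg (fun F : realHom M N l => F.1.2.2 j k' (by omega) x) hf)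
  let F : selfConjHom M N n := (internalHom M N).act (.betaT i n h) f
  have hF : ∀ j k hk j' hj hk' x, F.1.1 j k hk x = f.1.1 j' k hk' (M.act (.betaT j j' hj) x) :=
    fun j k hk j' hj hk' x => (selfConjBetaT_T h hk (b := k - 4) (by omega) (by omega) x).trans
      (hs.betaT _ _ _ _ _ _ _ _ _).symm
  have hF' : ∀ j k hk x, F.1.2.2 j k hk x = 0 := fun j k hk x => by
    refine (selfConjBetaT_U' h hk (b := k - 4) (by omega) (by omega) x).trans ?_
    rw [hU, map_zero]
  obtain ⟨g, hg⟩ := exists_postcomp_eq_of_selfConj (e := n) (by omega)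
    ((internalHom M M).act (.eps 0) (gradedId M)) F
    (fun j k m hk hm k' m' hk' hm' x hx => by
      obtain rfl : k = j := by omega
      obtain ⟨y, hy⟩ := hM.ker_tau rfl hm x hx
      rw [hF _ _ _ (k + 4) rfl (by omega), hy, hO])
    (fun j l k hk hl k' hk' hl' x x' hj hx => by
      obtain rfl : k = j := by omega
      have hx : x + sgn 0 • (0 : M.obj .U k) = 0 := hx
      rw [smul_zero, add_zero] at hx
      rw [hx, map_zero, hF', smul_zero, add_zero])
    (fun j l k m hk hm hkm k' m' hk' hm' hkm' x x' hl hx => by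
      obtain rfl : k = j := by omega
      obtain rfl : m = l := by omega
      have hx : x + sgn 0 • M.act (.eps k) (M.act (.tau m k hkm) x') = 0 := hx
      rw [sgn_zero, one_smul] at hx
      -- Here `x = -ε τ x'`. Commuting `β_T` past `ε τ` turns the required equation into the
      -- self-conjugate component of `τ f = 0` at `β_T x'`, up to the sign `(-1)^i`.
      have h₁ := hT (m + 4) m' (k + 4) k' (by omega) (by omega) (by omega) hkm'
        (M.act (.betaT m (m + 4)) x')
      rw [hF _ _ _ (k + 4) rfl (by omega), hF _ _ _ (m + 4) rfl (by omega),
        eq_neg_of_add_eq_zero_left hx, map_neg, map_neg,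
        betaT_eps_tau' hkm rfl (b := m + 4) rfl (by omega), map_add,
        hs.etaT (k := m') (h := by omega) (hk := hkm'),
        sgn_of_even 2 (show n = i + (2 + 2) by omega)]
      have h₂ := congrArg (sgn i • ·) h₁
      simp only [smul_sub, smul_sgn_smul, sgn_smul_etaT, smul_zero] at h₂
      rw [← h₂]
      abel)
  exact ⟨postcompFam M g .O 0 n (by omega) (gradedId M), (postcompFam_eps g).symm.trans hg⟩

-- `τ` of the universal element is the degree one homomorphism `M ⟶ selfConjInduced M` with `x ↦ τ
-- [ε x]` on real parts. Its complex and self-conjugate components are injective, as the second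
-- coordinate returns the argument. Its real kernel is the kernel of `ε`, which is the image of
-- `η_O²`, and `f` carries this into `η_O² f = 0` up to sign.
open selfConjInduced in
theorem exists_tau_eq (hM : M.Acyclic) {m n l : ℤ} (h : m = i + 1) (h' : n = m + 1)
    (hl : i = l + 1) (f : realHom M N i)
    (hf : (internalHom M N).act (.tau m n h') ((internalHom M N).act (.eps m)
      ((internalHom M N).act (.tau i m h) ((internalHom M N).act (.eps i) f))) = 0) :
    ∃ y, (internalHom M N).act (.tau l i hl) y = f := by
  have hr : IsRealHom M N i f.1 := f.2
  let b : realHom M N m := (internalHom M N).act (.tau i m h) ((internalHom M N).act (.eps i) f)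
  have hb : IsRealHom M N m b.1 := b.2
  have hO : ∀ j k p q hk hp hq x, N.act (.tau p q hq) (N.act (.eps p) (N.act (.tau k p hp)
      (N.act (.eps k) (f.1.1 j k hk x)))) = 0 := fun j k p q hk hp hq x => by
    have h₁ : b.1.1 j p (by omega) x = _ := hr.etaO_O h (by omega) hk hp x
    rw [← h₁]
    exact (hb.etaO_O h' (by omega) (by omega) hq x).symm.trans
      (congrArg (fun F : realHom M N n => F.1.1 j q (by omega) x) hf)
  obtain ⟨g, hg⟩ := exists_postcomp_eq_of_real (e := l) (d := 1) (by omega)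
    ((internalHom M M.selfConjInduced).act (.tau 0 1) (gen M)) f
    (fun j k hk k' hk' x hx => by
      obtain rfl : j = k - 1 := by omega
      have h₁ := (selfConjTau_O (f := genFam M) (by omega) hk (zero_add (k - 1)) (by omega)
        x).symm.trans hx
      rw [genFam_T, tau_mkT, castHom_rfl, map_zero, sub_zero] at h₁
      obtain ⟨y, rfl⟩ := hM.ker_eps (i := k - 3) (j := k - 2) (by omega) (by omega) x h₁
      rw [hr.tau (k - 2) (k' - 1) (by omega) _ _ _ _ (by omega), hr.eps,
        hr.tau (k - 3) (k' - 2) (by omega) _ _ _ _ (by omega), hr.eps, map_zsmul, map_zsmul, hO,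
        smul_zero, smul_zero])
    (fun j k hk k' hk' x hx => by
      obtain rfl : j = k - 1 := by omega
      have h₁ : mkU (0 : M.obj .U k) x = 0 := hx
      have h₂ : x = 0 := congrArg (Prod.snd (α := M.obj .U k) (β := M.obj .U (k - 1))) h₁
      rw [h₂, map_zero])
    (fun j k hk k' hk' x hx => by
      obtain rfl : j = k - 1 := by omega
      have h₁ := (selfConjTau_T (f := genFam M) (by omega) hk (zero_add (k - 1)) (by omega)
        (a' := k) (by omega) (by omega) x).symm.trans hx
      rw [genFam_T, genFam_T, tau_mkT, castHom_rfl, map_zero, sub_zero, eps_mkO,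
        etaT_apply (a := k + 1) _ (by omega) (by omega), zeta_mkT, map_zero, map_zero, map_zero,
        add_zero, betaU_mkU, map_zero, gamma_mkU, map_zero, map_zero, map_zero, map_zero, neg_zero,
        sgn_zero, one_smul, sub_sub, mkT_add, add_zero, sub_eq_iff_eq_add, zero_add] at h₁
      have h₂ : x = 0 :=
        (congrArg (Prod.snd (α := M.obj .T k) (β := M.obj .T (k - 1))) h₁).trans (add_zero 0)
      rw [h₂, map_zero])
  refine ⟨sgn l • postcompFam M g .T 0 l (by omega) (gen M), ?_⟩
  rw [map_zsmul]
  exact (postcompFam_tau g _ _ _).symm.trans hg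

-- `γ` of the universal element extends to a degree `-1` homomorphism `selfConjInduced M ⟶
-- complexInduced M` with `[m] ↦ γ [ζ m]`, and `{u}` going to `[u] + ψ_U [ψ_U u]` up to sign. Its
-- kernel forces `ζ` of the self-conjugate coordinates and the coordinate in `{u}` to vanish. Since
-- `f` has zero complex component, `f` kills the kernel of `ζ`, the image of `γ`.
open complexInduced in
theorem exists_gamma_eq (hM : M.Acyclic) {n : ℤ} (h : i = n - 1) (f : selfConjHom M N i)
    (hf : (internalHom M N).act (.zeta i) f = 0) :
    ∃ y, (internalHom M N).act (.gamma n i h) y = f := by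
  have hs : IsSelfConjHom M N i f.1 := f.2
  have hU : ∀ j k hk x, f.1.2.1 j k hk x = 0 := fun j k hk x =>
    congrArg (fun F : complexHom M N i => F.1 j k hk x) hf
  have hT : ∀ j k hk x, M.act (.zeta j) x = 0 → f.1.1 j k hk x = 0 := fun j k hk x hx => by
    obtain ⟨u, rfl⟩ := hM.ker_zeta (j := j + 1) (by omega) x hx
    rw [hs.gamma (j + 1) (k + 1) (by omega) _ _ _ _ (by omega), hU, map_zero, smul_zero]
  have hgen : ∀ j k hk (h' : j = k + 1) x, (complexGamma 0 (-1) (by omega) (gen M).1).1 j k hk x =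
      mkT (castHom h' (M.act (.zeta j) x)) 0 := fun j k hk h' x => by
    rw [complexGamma_T _ hk (zero_add j) (by omega), gen_apply, gamma_mkU, add_zero]
  obtain ⟨g, hg⟩ := exists_postcomp_eq_of_selfConj (e := n) (d := -1) (by omega)
    ((internalHom M M.complexInduced).act (.gamma 0 (-1)) (gen M)) f
    (fun j k m hk hm k' m' hk' hm' x hx => by
      obtain rfl : j = k + 1 := by omega
      obtain rfl : m = k + 1 := by omega
      have h₁ := (congrArg (M.complexInduced.act (.tau k (k + 1) hm))
        (hgen (k + 1) k hk rfl x)).symm.trans hx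
      rw [castHom_rfl, tau_mkT, castHom_rfl] at h₁
      rw [hT _ _ _ _ h₁, map_zero])
    (fun j l k hk hl k' hk' hl' x x' hj hx => by
      obtain rfl : k = l := by omega
      have h₁ : (0 : M.complexInduced.obj .U k) + sgn (-1) • (complexGamma 0 (-1) (by omega)
        (gen M).1).2.2 k k hl x' = 0 := hx
      rw [zero_add] at h₁
      have h₂ := congrArg (sgn (-1) • ·) h₁
      rw [smul_sgn_smul, smul_zero, complexGamma_U' _ _ (zero_add k), gen_apply, gen_apply,
        psiU_mkU, mkU_add, add_zero] at h₂
      have h₃ : x' = 0 := congrArg (Prod.fst (α := M.obj .U k) (β := M.obj .U k)) h₂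
      rw [hU, h₃, map_zero, smul_zero, add_zero])
    (fun j l k m hk hm hkm k' m' hk' hm' hkm' x x' hl hx => by
      obtain rfl : j = k + 1 := by omega
      obtain rfl : l = k := by omega
      obtain rfl : l = m + 1 := by omega
      have h₁ := hx
      have e₁ := hgen (m + 1 + 1) (m + 1) hk rfl x
      have e₂ := hgen (m + 1) m hm rfl x'
      change (complexGamma 0 (-1) (by omega) (gen M).1).1 _ _ hk x + sgn (-1) •
        M.complexInduced.act _ (M.complexInduced.act _
          ((complexGamma 0 (-1) (by omega) (gen M).1).1 _ _ hm x')) = 0 at h₁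
      rw [e₁, e₂, castHom_rfl, castHom_rfl, tau_mkT, eps_mkO, castHom_rfl,
        sgn_pred (show -1 = 0 - 1 from rfl), sgn_zero,
        neg_one_smul, ← sub_eq_add_neg, sub_eq_zero] at h₁
      have h₂ : M.act (.zeta (m + 1 + 1)) x = 0 :=
        congrArg (Prod.fst (α := M.obj .U (m + 1 + 1)) (β := M.obj .U (m + 1))) h₁
      have h₃ : 0 = M.act (.zeta (m + 1)) x' :=
        congrArg (Prod.snd (α := M.obj .U (m + 1 + 1)) (β := M.obj .U (m + 1))) h₁
      rw [hT _ _ _ _ h₂, hT _ _ _ _ h₃.symm, map_zero, map_zero, smul_zero, add_zero])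
  refine ⟨sgn n • postcompFam M g .U 0 n (by omega) (gen M), ?_⟩
  rw [map_zsmul]
  exact (postcompFam_gamma g _ _ _).symm.trans hg

-- `ζ` of the universal element extends to `complexInduced M ⟶ selfConjInduced M` with `[u] ↦ [u]`
-- and hence `r [u] ↦ τ [γ u]`. The real and self-conjugate kernels consist of elements killed by
-- `γ`, that is, of differences `w - ψ_U w`; as `f` commutes with `ψ_U`, its values there are killed
-- by `γ`, and so by `r = τ γ`.
open selfConjInduced in
theorem exists_zeta_eq (hM : M.Acyclic) (f : complexHom M N i)
    (hf : (internalHom M N).act (.psiU i) f = f) : ∃ y, (internalHom M N).act (.zeta i) y = f := by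
  have hψ : ∀ j k hk x, f.1 j k hk (M.act (.psiU j) x) = N.act (.psiU k) (f.1 j k hk x) :=
    fun j k hk x => by
      have h₁ := (complexHom_psiU_apply f hk x).symm.trans
        (congrArg (fun F : complexHom M N i => F.1 j k hk x) hf)
      rw [← h₁, psiU_psiU']
  have hγ : ∀ j k k' j' hk hk' hj x, M.act (.gamma j j' hj) x = 0 →
      N.act (.gamma k k' hk') (f.1 j k hk x) = 0 := fun j k k' j' hk hk' hj x hx => by
    obtain ⟨w, rfl⟩ := hM.ker_gamma hj x hx
    rw [map_sub, map_sub, hψ, gamma_psiU', sub_self]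
  have hr : ∀ j k j' hk hj x, M.act (.gamma j j' hj) x = 0 → N.act (.r k) (f.1 j k hk x) = 0 :=
    fun j k j' hk hj x hx => by
      rw [← tau_gamma (a := k - 1) rfl (by omega), hγ j k (k - 1) j' hk _ hj x hx, map_zero]
  have hgen : ∀ k (hk : 0 + k = k) x, (genFam M).2.1 k k hk x = mkU x 0 := fun _ _ _ => rfl
  obtain ⟨g, hg⟩ := exists_postcomp_eq_of_complex (e := i) (by omega)
    ((internalHom M M.selfConjInduced).act (.zeta 0) (gen M)) f
    (fun j k hk k' hk' x hx => by
      obtain rfl : k = j := by omega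
      have h₁ : M.selfConjInduced.act (.r k) (mkU x 0) = 0 := hx
      rw [r_mkU, map_zero, map_zero, add_zero] at h₁
      exact hr _ _ _ _ _ x h₁)
    (fun j k hk k' hk' x x' hx => by
      obtain rfl : k = j := by omega
      have h₁ : mkU x 0 + M.selfConjInduced.act (.psiU k) (mkU x' 0) = 0 := hx
      rw [psiU_mkU, mkU_add] at h₁
      have h₂ : x + M.act (.psiU k) x' = 0 :=
        congrArg (Prod.fst (α := M.obj .U k) (β := M.obj .U (k - 1))) h₁
      rw [eq_neg_of_add_eq_zero_left h₂, map_neg, hψ, neg_add_cancel])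
    (fun j l k m hk hm hkm k' m' hk' hm' hkm' x x' hl hx => by
      obtain rfl : k = j := by omega
      obtain rfl : m = l := by omega
      obtain rfl : k = m - 1 := by omega
      have h₁ : sgn 0 • M.selfConjInduced.act (.gamma m (m - 1) hkm) (mkU x 0) +
        M.selfConjInduced.act (.eps (m - 1)) (M.selfConjInduced.act (.r (m - 1)) (mkU x' 0)) = 0 :=
        hx
      rw [sgn_zero, one_smul, gamma_mkU, r_mkU, eps_mkO, mkT_add, map_zero, map_zero, map_zero,
        map_zero, map_zero, map_zero, add_zero, add_zero, add_zero, neg_zero, zero_add] at h₁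
      have h₂ : M.act (.gamma m (m - 1) hkm) x = 0 :=
        congrArg (Prod.fst (α := M.obj .T (m - 1)) (β := M.obj .T (m - 1 - 1))) h₁
      have h₃ : M.act (.gamma (m - 1) (m - 1 - 1)) x' = 0 :=
        congrArg (Prod.snd (α := M.obj .T (m - 1)) (β := M.obj .T (m - 1 - 1))) h₁
      rw [hγ _ _ _ _ _ _ _ x h₂, hr _ _ _ _ _ x' h₃, smul_zero, map_zero, add_zero])
  exact ⟨postcompFam M g .T 0 i (by omega) (gen M), (postcompFam_zeta g).symm.trans hg⟩

-- `1 - ψ_U` applied to the universal element sends `u` to `[u] - ψ_U [ψ_U u]`. The real and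
-- self-conjugate kernels of its extension consist of elements fixed by `ψ_U`, hence of values of
-- `ζ`, on which `γ f` vanishes by hypothesis. On complex parts the kernel is given by `x = ψ_U x'`,
-- where the last component of `γ f = 0` applies.
open complexInduced in
theorem exists_sub_psiU_eq (hM : M.Acyclic) {n : ℤ} (h : n = i - 1) (f : complexHom M N i)
    (hf : (internalHom M N).act (.gamma i n h) f = 0) :
    ∃ y, y - (internalHom M N).act (.psiU i) y = f := by
  have hζ : ∀ j k k' hk hk' x, N.act (.gamma k k' hk') (f.1 j k hk (M.act (.zeta j) x)) = 0 :=
    fun j k k' hk hk' x => (complexGamma_T h (by omega) hk hk' x).symm.trans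
      (congrArg (fun F : selfConjHom M N n => F.1.1 j k' (by omega) x) hf)
  have hU : ∀ j k hk x, f.1 j k hk x + N.act (.psiU k) (f.1 j k hk (M.act (.psiU j) x)) = 0 :=
    fun j k hk x => (complexGamma_U' h (by omega) hk x).symm.trans
      (congrArg (fun F : selfConjHom M N n => F.1.2.2 j k (by omega) x) hf)
  have hγ : ∀ j k k' hk hk' x, M.act (.psiU j) x = x →
      N.act (.gamma k k' hk') (f.1 j k hk x) = 0 := fun j k k' hk hk' x hx => by
    obtain ⟨m, rfl⟩ := hM.ker_psiU x hx
    exact hζ _ _ _ _ _ _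
  have hr : ∀ j k hk x, M.act (.psiU j) x = x → N.act (.r k) (f.1 j k hk x) = 0 :=
    fun j k hk x hx => by
      rw [← tau_gamma (a := k - 1) rfl (by omega), hγ _ _ _ _ _ x hx, map_zero]
  let a : complexHom M M.complexInduced 0 := HSub.hSub
    (α := (internalHom M M.complexInduced).obj .U 0) (gen M)
    ((internalHom M M.complexInduced).act (.psiU 0) (gen M))
  have ha : ∀ k (hk : 0 + k = k) x, a.1 k k hk x = mkU x (- M.act (.psiU k) x) := fun k hk x => by
    have h₁ : a.1 k k hk x = mkU x 0 + - _ :=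
      congrArg (fun y => (gen M).1 k k hk x + - y) (complexHom_psiU_apply (gen M) hk x)
    rw [h₁, gen_apply, psiU_mkU, ← sub_eq_add_neg, sub_eq_iff_eq_add, mkU_add, add_zero,
      neg_add_cancel]
  obtain ⟨g, hg⟩ := exists_postcomp_eq_of_complex (e := i) (by omega) a f
    (fun j k hk k' hk' x hx => by
      obtain rfl : k = j := by omega
      rw [ha, r_mkU] at hx
      exact hr _ _ _ x (add_neg_eq_zero.mp hx).symm)
    (fun j k hk k' hk' x x' hx => by
      obtain rfl : k = j := by omega
      rw [ha, ha, psiU_mkU, mkU_add] at hx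
      have h₂ : x + - M.act (.psiU k) x' = 0 :=
        congrArg (Prod.fst (α := M.obj .U k) (β := M.obj .U k)) hx
      rw [add_neg_eq_zero.mp h₂, ← hU _ _ hk' (M.act (.psiU k) x'), psiU_psiU'])
    (fun j l k m hk hm hkm k' m' hk' hm' hkm' x x' hl hx => by
      obtain rfl : k = j := by omega
      obtain rfl : m = l := by omega
      obtain rfl : m = k + 1 := by omega
      rw [ha, ha, sgn_zero, one_smul, gamma_mkU, r_mkU, eps_mkO, mkT_add, castHom_rfl, add_zero,
        zero_add] at hx
      have h₂ : x + - M.act (.psiU (k + 1)) x = 0 :=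
        congrArg (Prod.fst (α := M.obj .U (k + 1)) (β := M.obj .U k)) hx
      have h₃ : x' + - M.act (.psiU k) x' = 0 :=
        congrArg (Prod.snd (α := M.obj .U (k + 1)) (β := M.obj .U k)) hx
      rw [hγ _ _ _ _ _ x (add_neg_eq_zero.mp h₂).symm, hr _ _ _ x' (add_neg_eq_zero.mp h₃).symm,
        smul_zero, map_zero, add_zero])
  refine ⟨postcompFam M g .U 0 i (by omega) (gen M), ?_⟩
  exact (congrArg (_ - ·) (postcompFam_psiU g).symm).trans ((map_sub _ _ _).symm.trans hg)

end exactness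

end CRTModule

namespace CRTModule

/-! ### Acyclicity of the CRT-module of graded homomorphisms -/

theorem exact_of_surjective_onto_kernel {A B C : Type*} [AddCommGroup A] [AddCommGroup B]
    [AddCommGroup C] (f : A →+ B) (g : B →+ C) (h : ∀ x, g (f x) = 0)
    (h' : ∀ y, g y = 0 → ∃ x, f x = y) : Function.Exact f g := fun y =>
  ⟨h' y, by rintro ⟨x, rfl⟩; exact h x⟩

/-- A CRT-module is acyclic if the kernels in the three sequences are contained in the images. -/
theorem Acyclic.of_exists {K : CRTModule.{u}}
    (ou_eta_c : ∀ {i n : ℤ} (h : i = n + 1) (x : K.obj .O i), K.act (.c i) x = 0 →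
      ∃ y, K.act (.tau n i h) (K.act (.eps n) y) = x)
    (ou_c_r : ∀ {i n : ℤ} (h : n = i + 2) (x : K.obj .U i), K.act (.r i) x = 0 →
      ∃ y, K.act (.c n) y = K.act (.betaU i n h) x)
    (ou_r_eta : ∀ {i n : ℤ} (h : n = i + 1) (x : K.obj .O i),
      K.act (.tau i n h) (K.act (.eps i) x) = 0 → ∃ y, K.act (.r i) y = x)
    (ot_eta_eps : ∀ {i m n : ℤ} (h : i = m + 1) (h' : m = n + 1) (x : K.obj .O i),
      K.act (.eps i) x = 0 →
      ∃ y, K.act (.tau m i h) (K.act (.eps m) (K.act (.tau n m h') (K.act (.eps n) y))) = x)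
    (ot_eps_tau : ∀ {i n l : ℤ} (h : n = i + 4) (hl : l = i + 1) (x : K.obj .T i),
      K.act (.tau i l hl) x = 0 → ∃ y, K.act (.eps n) y = K.act (.betaT i n h) x)
    (ot_tau_eta : ∀ {i m n l : ℤ} (h : m = i + 1) (h' : n = m + 1) (hl : i = l + 1)
      (x : K.obj .O i),
      K.act (.tau m n h') (K.act (.eps m) (K.act (.tau i m h) (K.act (.eps i) x))) = 0 →
      ∃ y, K.act (.tau l i hl) y = x)
    (ut_gamma_zeta : ∀ {i n : ℤ} (h : i = n - 1) (x : K.obj .T i), K.act (.zeta i) x = 0 →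
      ∃ y, K.act (.gamma n i h) y = x)
    (ut_zeta_psi : ∀ {i : ℤ} (x : K.obj .U i), K.act (.psiU i) x = x → ∃ y, K.act (.zeta i) y = x)
    (ut_psi_gamma : ∀ {i n : ℤ} (h : n = i - 1) (x : K.obj .U i), K.act (.gamma i n h) x = 0 →
      ∃ y, y - K.act (.psiU i) y = x) : K.Acyclic where
  -- In all nine cases the composite of consecutive arrows vanishes by the CRT-relations alone.
  ou_eta_c n := exact_of_surjective_onto_kernel _ _ (fun x => c_tau_eps _ x)
    fun y hy => ou_eta_c _ y hy
  ou_c_r n := exact_of_surjective_onto_kernel _ _ (fun x => r_betaUInv_c _ x) fun y hy => by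
    obtain ⟨x, hx⟩ := ou_c_r (n := n + 1) (by omega) _ hy
    exact ⟨x, hx.trans (betaU_betaUInv _ _ y)⟩
  ou_r_eta n := exact_of_surjective_onto_kernel _ _ (fun x => tau_eps_r _ _) fun y hy => by
    obtain ⟨x, hx⟩ := ou_r_eta (n := n) (by omega) y hy
    exact ⟨K.act (.betaU (n - 1) (n + 1)) x, (congrArg _ (betaUInv_betaU _ _ x)).trans hx⟩
  ot_eta_eps n := exact_of_surjective_onto_kernel _ _
    (fun x => eps_tau_eps_tau_eps (j := n + 1) rfl (by omega) x)
    fun y hy => ot_eta_eps (m := n + 1) (by omega) rfl y hy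
  ot_eps_tau n := exact_of_surjective_onto_kernel _ _
    (fun x => tau_betaTInv_eps (j := n - 2) (k := n - 1) (by omega) (by omega) x)
    fun y hy => by
      obtain ⟨x, hx⟩ := ot_eps_tau (n := n + 2) (l := n - 1) (by omega) (by omega)
        (K.act (.betaTInv (n + 2) (n - 2)) y) hy
      exact ⟨x, hx.trans (betaT_betaTInv _ _ y)⟩
  ot_tau_eta n := exact_of_surjective_onto_kernel _ _
    (fun x => tau_eps_tau_eps_tau (j := n - 1) (k := n) (by omega) (by omega) rfl
      (K.act (.betaTInv (n + 2) (n - 2)) x))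
    fun y hy => by
      obtain ⟨x, hx⟩ := ot_tau_eta (l := n - 2) (m := n) (n := n + 1) (by omega) rfl (by omega) y hy
      exact ⟨K.act (.betaT (n - 2) (n + 2)) x, (congrArg _ (betaTInv_betaT _ _ x)).trans hx⟩
  ut_gamma_zeta n := exact_of_surjective_onto_kernel _ _ (fun x => zeta_gamma' _ x)
    fun y hy => ut_gamma_zeta (by omega) y hy
  ut_zeta_psi n := exact_of_surjective_onto_kernel _ _
    (fun x => sub_eq_zero.mpr (psiU_zeta' x).symm)
    fun y hy => ut_zeta_psi y (sub_eq_zero.mp hy).symm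
  ut_psi_gamma n := exact_of_surjective_onto_kernel _ _
    (fun x => (map_sub _ _ _).trans (sub_eq_zero.mpr (gamma_psiU' _ x).symm))
    fun y hy => ut_psi_gamma _ y hy

theorem acyclic_internalHom {M N : CRTModule.{u}} (hM : M.Acyclic) [Injective N] :
    (internalHom M N).Acyclic :=
  .of_exists (fun h => exists_etaO_eq hM h) (fun h => exists_c_eq hM h) (fun h => exists_r_eq hM h)
    (fun h h' => exists_etaO_etaO_eq hM h h') (fun h hl => exists_eps_eq hM h hl)
    (fun h h' hl => exists_tau_eq hM h h' hl) (fun h => exists_gamma_eq hM h)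
    (exists_zeta_eq hM) (fun h => exists_sub_psiU_eq hM h)

/-! ### Transport of acyclicity to Hom_CRT(M, N) -/

theorem exact_of_injective_of_surjective {A B C A' B' C' : Type*} [AddCommGroup A] [AddCommGroup B]
    [AddCommGroup C] [AddCommGroup A'] [AddCommGroup B'] [AddCommGroup C'] {f : A →+ B}
    {g : B →+ C} {f' : A' →+ B'} {g' : B' →+ C'} (a : A →+ A') (b : B →+ B') (c : C →+ C')
    (ha : Function.Surjective a) (hb : Function.Injective b) (hc : Function.Injective c)
    (hf : ∀ x, b (f x) = f' (a x)) (hg : ∀ x, c (g x) = g' (b x)) (h : Function.Exact f' g') :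
    Function.Exact f g := fun y => by
  rw [← map_eq_zero_iff c hc, hg, h (b y)]
  constructor
  · rintro ⟨x', hx'⟩
    obtain ⟨x, rfl⟩ := ha x'
    exact ⟨x, hb ((hf x).trans hx')⟩
  · rintro ⟨x, rfl⟩
    exact ⟨a x, (hf x).symm⟩

theorem Acyclic.of_bijective {L K : CRTModule.{u}} (hK : K.Acyclic) (φ : L ⟶ K)
    (hφ : ∀ X i, Function.Bijective (φ.app X i)) : L.Acyclic := by
  have key : ∀ {X Y Z : CRTPart} {i j k : ℤ} {f : L.obj X i →+ L.obj Y j}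
      {g : L.obj Y j →+ L.obj Z k} {f' : K.obj X i →+ K.obj Y j} {g' : K.obj Y j →+ K.obj Z k},
      Function.Exact f' g' → (∀ x, φ.app Y j (f x) = f' (φ.app X i x)) →
      (∀ x, φ.app Z k (g x) = g' (φ.app Y j x)) → Function.Exact f g := fun h hf hg =>
    exact_of_injective_of_surjective (φ.app _ _) (φ.app _ _) (φ.app _ _) (hφ _ _).2 (hφ _ _).1
      (hφ _ _).1 hf hg h
  have heta : ∀ i j h x, φ.app .O j (L.etaO i j h x) = K.etaO i j h (φ.app .O i x) :=
    fun i j h x => by simp only [etaO, AddMonoidHom.comp_apply, φ.comm]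
  constructor
  · intro n
    exact key (hK.ou_eta_c n) (heta _ _ _) (φ.comm _)
  · intro n
    exact key (hK.ou_c_r n) (φ.comm _) (fun x => by simp only [AddMonoidHom.comp_apply, φ.comm])
  · intro n
    exact key (hK.ou_r_eta n) (fun x => by simp only [AddMonoidHom.comp_apply, φ.comm]) (heta _ _ _)
  · intro n
    exact key (hK.ot_eta_eps n) (fun x => by simp only [AddMonoidHom.comp_apply, heta]) (φ.comm _)
  · intro n
    exact key (hK.ot_eps_tau n) (φ.comm _) (fun x => by simp only [AddMonoidHom.comp_apply, φ.comm])
  · intro n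
    exact key (hK.ot_tau_eta n) (fun x => by simp only [AddMonoidHom.comp_apply, φ.comm])
      (fun x => by simp only [AddMonoidHom.comp_apply, heta])
  · intro n
    exact key (hK.ut_gamma_zeta n) (φ.comm _) (φ.comm _)
  · intro n
    exact key (hK.ut_zeta_psi n) (φ.comm _)
      (fun x => (map_sub _ _ _).trans (congrArg (_ - ·) (φ.comm _ _)))
  · intro n
    exact key (hK.ut_psi_gamma n)
      (fun x => (map_sub _ _ _).trans (congrArg (_ - ·) (φ.comm _ _))) (φ.comm _)

theorem acyclic_CRTHom {M N : CRTModule.{u}} (hM : M.Acyclic) [Injective N] :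
    (CRTHom M N).Acyclic :=
  (acyclic_internalHom hM).of_bijective (homComparison M N) fun X i =>
    ⟨homComparison_injective X i, homComparison_surjective X i⟩

end CRTModule

theorem mainTheorem11 (M N : CRTModule.{u}) (hM : M.Acyclic) (hN : CategoryTheory.Injective N) :
    (CRTHom M N).Acyclic := by
  exact CRTModule.acyclic_CRTHom hM
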